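/- **Setting.** Let $X\subseteq\mathbb R^n$ be closed and convex, $\|\cdot\|$ the Euclidean norm, and $\Psi=f+h$, where $f$ is differentiable with $L$-Lipschitz gradient on $X$ ($L>0$), $h:X\to\mathbb R$ is convex, and $\Psi^*:=\inf_X\Psi>-\infty$. Let $\omega:X\to\mathbb R$ be continuously differentiable with $\langle x-z,\nabla\omega(x)-\nabla\omega(z)\rangle\ge\alpha\|x-z\|^2$ on $X$ ($\alpha>0$), and $V(x,z)=\omega(x)-\omega(z)-\langle\nabla\omega(z),x-z\rangle$. Assume that for all $\gamma>0$, $g\in\mathbb R^n$, $x\in X$ the minimizer $x^+=\arg\min_{u\in X}\{\langle g,u\rangle+\frac1\gamma V(u,x)+h(u)\}$ exists, and put $P_X(x,g,\gamma)=\frac1\gamma(x-x^+)$. Let $x_1\in X$ and $D_\Psi=\sqrt{(\Psi(x_1)-\Psi^*)/L}$. A stochastic zeroth-order oracle returns noisy values $F(\cdot,\xi)$ of $f$, where the law of the noise $\xi$ may depend on the iteration $k$ and on the current iterate $x\in X$. For all such $k$ and $x$, $F(\cdot,\xi)$ is almost surely differentiable on $\mathbb R^n$ with $L$-Lipschitz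 gradient, $\mathbb E[F(y,\xi)]=f(y)$ for all $y\in\mathbb R^n$, $\mathbb E[\nabla_xF(x,\xi)]=\nabla f(x)$ and $\mathbb E\|\nabla_xF(x,\xi)-\nabla f(x)\|^2\le\sigma^2$ ($\sigma>0$). Moreover $\|\nabla f\|\le M$ on $X$. **Algorithm.** Fix a budget $\bar N\ge1$ of oracle calls (one call returns the pair $F(x+\mu v,\xi)$, $F(x,\xi)$), a smoothing parameter $\mu>0$ and $\tilde D>0$. Set $$m=\Big\lceil\min\Big\{\max\Big\{\tfrac{\sqrt{(n+4)(M^2+\sigma^2)\bar N}}{L\tilde D},\,n+4\Big\},\bar N\Big\}\Big\rceil,\qquad N=\lfloor\bar N/m\rfloor,\qquad \gamma=\frac{\alpha}{2L}.$$ Draw $R$ uniformly from $\{1,\dots,N\}$ (this is $P_R(k)\propto\alpha\gamma_k-L\gamma_k^2$ for the constant stepsizes $\gamma_k=\gamma$). At iteration $k$ make $m$ calls, with $\xi_{k,i}$ drawn from the oracle's law at $x_k$ and $v_{k,i}$ an independent standard Gaussian vector in $\mathbb R^n$, all independent of the past given $x_k$; set $G_{\mu,k}=\frac1m\sum_{i=1}^m\frac{F(x_k+\mu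 v_{k,i},\xi_{k,i})-F(x_k,\xi_{k,i})}{\mu}v_{k,i}$ and $x_{k+1}=\arg\min_{u\in X}\{\langle G_{\mu,k},u\rangle+\frac1\gamma V(u,x_k)+h(u)\}$. Let $g_{X,R}=P_X(x_R,\nabla f(x_R),\gamma)$ and $$\theta_1=\max\Big\{1,\tfrac{\sqrt{(n+4)(M^2+\sigma^2)}}{L\tilde D\sqrt{\bar N}}\Big\},\qquad\theta_2=\max\Big\{1,\tfrac{n+4}{\bar N}\Big\}.$$ **Statement.** 1. If $\mu\le D_\Psi/\sqrt{(n+4)\bar N}$, then $\|g_{X,R}\|^2$ is integrable and $$\frac{\alpha^2}{L}\mathbb E\|g_{X,R}\|^2\le\bar{\mathcal B}_{\bar N}:=\frac{(24\theta_2+41)LD_\Psi^2(n+4)}{\bar N}+\frac{32\sqrt{(n+4)(M^2+\sigma^2)}}{\sqrt{\bar N}}\Big(\frac{D_\Psi^2}{\tilde D}+\tilde D\theta_1\Big);$$ in particular, if $\bar N\ge n+4$, then $\frac{\alpha^2}{L}\mathbb E\|g_{X,R}\|^2\le65\Big[\frac{LD_\Psi^2(n+4)}{\bar N}+\sqrt{\frac{(n+4)(M^2+\sigma^2)}{\bar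 N}}\Big(\frac{D_\Psi^2}{\tilde D}+\tilde D\theta_1\Big)\Big]$. 2. If $f$ is convex on $\mathbb R^n$, $x^*$ is a minimizer of $\Psi$ over $X$ and $\mu\le\sqrt{V(x^*,x_1)/(\alpha(n+4)\bar N)}$, then $\Psi(x_{R+1})$ and $\Psi(x_R)$ are integrable, $$\mathbb E[\Psi(x_{R+1})-\Psi(x^*)]\le\bar{\mathcal C}_{\bar N}:=\frac{(5+\theta_2)LV(x^*,x_1)(n+4)}{\alpha\bar N}+\frac{\sqrt{(n+4)(M^2+\sigma^2)}}{\alpha\sqrt{\bar N}}\Big(\frac{4V(x^*,x_1)}{\tilde D}+\alpha\tilde D\theta_1\Big)$$ and $\mathbb E[\Psi(x_R)-\Psi(x^*)]\le\bar{\mathcal C}_{\bar N}+\frac{\Psi(x_1)-\Psi(x^*)}{N}$. 3. Computing $x_{R+1}$ takes at most $\bar N$ oracle calls. In the situation of 2, for every $V_0$ there is $K>0$ depending only on $L,\alpha,M,\sigma,\tilde D,V_0$ (not on $n$, the problem or the oracle) such that if $V(x^*,x_1)\le V_0$, $0<\varepsilon\le1$ and $\bar N\ge Kn/\varepsilon^2$,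 then $\mathbb E[\Psi(x_{R+1})-\Psi(x^*)]\le\varepsilon$. The same holds for $x_R$ with $K$ depending in addition on an upper bound $\Delta_0$ for $\Psi(x_1)-\Psi(x^*)$. So $O(n/\varepsilon^2)$ oracle calls suffice in the convex case. -/

import Mathlib

open MeasureTheory ProbabilityTheory
open scoped RealInnerProductSpace

noncomputable section

namespace RSPGF

/-- The Euclidean space `ℝⁿ` with its standard Euclidean norm. -/
abbrev Eu (n : ℕ) := EuclideanSpace ℝ (Fin n)

/-! ### Prox-functions and generalized projections -/

/-- The prox-function `V(x, z) = ω(x) - [ω(z) + ⟨∇ω(z), x - z⟩]`; `dω` stands for `∇ω`. -/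
def prox {n : ℕ} (ω : Eu n → ℝ) (dω : Eu n → Eu n) (x z : Eu n) : ℝ :=
  ω x - (ω z + ⟪dω z, x - z⟫)

/-- `ω` is a distance generating function on `X` with modulus `α`: it is continuously
differentiable on `X` with gradient `dω` (only the values of `ω` on `X` matter), and strongly
convex. -/
structure IsDistGen {n : ℕ} (X : Set (Eu n)) (ω : Eu n → ℝ) (dω : Eu n → Eu n) (α : ℝ) :
    Prop where
  hasGradient : ∀ x ∈ X, HasGradientWithinAt ω (dω x) X x
  continuous_grad : ContinuousOn dω X
  strongly_convex : ∀ x ∈ X, ∀ z ∈ X, α * ‖x - z‖ ^ 2 ≤ ⟪x - z, dω x - dω z⟫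

/-- The objective `u ↦ ⟨g, u⟩ + (1/γ) V(u, x) + h(u)` of the generalized projection problem. -/
def projObjective {n : ℕ} (h ω : Eu n → ℝ) (dω : Eu n → Eu n) (γ : ℝ) (x g u : Eu n) : ℝ :=
  ⟪g, u⟫ + 1 / γ * prox ω dω u x + h u

/-- `u` solves the generalized projection problem, i.e. it minimizes the objective over `X`. -/
def IsProj {n : ℕ} (X : Set (Eu n)) (h ω : Eu n → ℝ) (dω : Eu n → Eu n) (γ : ℝ)
    (x g u : Eu n) : Prop :=
  u ∈ X ∧ IsMinOn (projObjective h ω dω γ x g) X u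

/-- `x⁺ = argmin_{u ∈ X} {⟨g, u⟩ + (1/γ) V(u, x) + h(u)}`. -/
def projPoint {n : ℕ} (X : Set (Eu n)) (h ω : Eu n → ℝ) (dω : Eu n → Eu n) (γ : ℝ)
    (x g : Eu n) : Eu n :=
  Classical.epsilon (IsProj X h ω dω γ x g)

/-- `P_X(x, g, γ) = (1/γ) (x - x⁺)`. -/
def projGrad {n : ℕ} (X : Set (Eu n)) (h ω : Eu n → ℝ) (dω : Eu n → Eu n)
    (x g : Eu n) (γ : ℝ) : Eu n :=
  (1 / γ) • (x - projPoint X h ω dω γ x g)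

/-- The class `C_L^{1,1}(ℝⁿ)`: differentiable with an `L`-Lipschitz gradient. -/
def IsC11 {n : ℕ} (L : ℝ) (g : Eu n → ℝ) : Prop :=
  Differentiable ℝ g ∧ ∀ x y, ‖gradient g y - gradient g x‖ ≤ L * ‖y - x‖

/-! ### The stochastic composite problem -/

/-- The data of `min_{x ∈ X} {f(x) + h(x)}` with a stochastic zeroth-order oracle: `F x s` is the
noisy value of `f` at `x` for the noise realization `s`, `noise k x` is the distribution of the
noise in a call made at iteration `k` when the current iterate is `x`, and `ω` is the distance
generating function with gradient `dω`. -/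
structure Problem (n : ℕ) (Ξ : Type*) [MeasurableSpace Ξ] where
  X : Set (Eu n)
  f : Eu n → ℝ
  h : Eu n → ℝ
  F : Eu n → Ξ → ℝ
  noise : ℕ → Kernel (Eu n) Ξ
  ω : Eu n → ℝ
  dω : Eu n → Eu n

namespace Problem

variable {n : ℕ} {Ξ : Type*} [MeasurableSpace Ξ]

/-- `Ψ = f + h`. -/
def Psi (Q : Problem n Ξ) (x : Eu n) : ℝ := Q.f x + Q.h x

/-- `Ψ* = inf_{x ∈ X} Ψ(x)`. -/
def PsiStar (Q : Problem n Ξ) : ℝ := sInf (Q.Psi '' Q.X)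

/-- `V(x, z)`. -/
def V (Q : Problem n Ξ) (x z : Eu n) : ℝ := prox Q.ω Q.dω x z

/-- `D_Ψ = [(Ψ(x₁) - Ψ*) / L]^{1/2}`. -/
def DPsi (Q : Problem n Ξ) (L : ℝ) (x₁ : Eu n) : ℝ := √((Q.Psi x₁ - Q.PsiStar) / L)

/-- `G(x, s) = ∇ₓ F(x, s)`. -/
def G (Q : Problem n Ξ) (x : Eu n) (s : Ξ) : Eu n := gradient (fun y => Q.F y s) x

/-- `G_μ(x, s, v) = ((F(x + μ v, s) - F(x, s)) / μ) v`. -/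
def Gμ (Q : Problem n Ξ) (μ : ℝ) (x : Eu n) (s : Ξ) (v : Eu n) : Eu n :=
  ((Q.F (x + μ • v) s - Q.F x s) / μ) • v

/-- `g_X(x) = P_X(x, ∇f(x), γ)`, the generalized projected gradient of `Ψ` at `x`. -/
def gX (Q : Problem n Ξ) (γ : ℝ) (x : Eu n) : Eu n :=
  projGrad Q.X Q.h Q.ω Q.dω x (gradient Q.f x) γ

/-- `x` is an optimal solution. -/
def IsOptimal (Q : Problem n Ξ) (x : Eu n) : Prop := x ∈ Q.X ∧ IsMinOn Q.Psi Q.X x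

/-- The standing assumptions on the problem and on the oracle. -/
structure Assumptions (Q : Problem n Ξ) (L α σ M : ℝ) : Prop where
  closed_X : IsClosed Q.X
  convex_X : Convex ℝ Q.X
  convex_h : ConvexOn ℝ Q.X Q.h
  diff_f : ∀ x ∈ Q.X, DifferentiableAt ℝ Q.f x
  lipschitz_f : ∀ x ∈ Q.X, ∀ y ∈ Q.X,
    ‖gradient Q.f y - gradient Q.f x‖ ≤ L * ‖y - x‖
  bddBelow : BddBelow (Q.Psi '' Q.X)
  distGen : IsDistGen Q.X Q.ω Q.dω α
  /-- the generalized projection problems are solvable -/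
  solvable : ∀ γ > 0, ∀ g, ∀ x ∈ Q.X, ∃ u, IsProj Q.X Q.h Q.ω Q.dω γ x g u
  measurable_F : Measurable (Function.uncurry Q.F)
  noise_prob : ∀ k ≥ 1, ∀ x ∈ Q.X, IsProbabilityMeasure (Q.noise k x)
  /-- `F(·, ξ_k)` is almost surely of class `C_L^{1,1}(ℝⁿ)` -/
  smooth_F : ∀ k ≥ 1, ∀ x ∈ Q.X, ∀ᵐ s ∂(Q.noise k x), IsC11 L (fun y => Q.F y s)
  /-- the oracle values are unbiased -/
  unbiased_F : ∀ k ≥ 1, ∀ x ∈ Q.X, ∀ y,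
    Integrable (Q.F y) (Q.noise k x) ∧ ∫ s, Q.F y s ∂(Q.noise k x) = Q.f y
  /-- the gradients of the oracle functions are unbiased and have variance at most `σ²` -/
  memLp_G : ∀ k ≥ 1, ∀ x ∈ Q.X, MemLp (Q.G x) 2 (Q.noise k x)
  unbiased_G : ∀ k ≥ 1, ∀ x ∈ Q.X, ∫ s, Q.G x s ∂(Q.noise k x) = gradient Q.f x
  variance_G : ∀ k ≥ 1, ∀ x ∈ Q.X,
    ∫ s, ‖Q.G x s - gradient Q.f x‖ ^ 2 ∂(Q.noise k x) ≤ σ ^ 2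
  gradient_bound : ∀ x ∈ Q.X, ‖gradient Q.f x‖ ≤ M

end Problem

/-! ### The randomized stochastic projected gradient free algorithm -/

section Algorithm

variable {n : ℕ} {Ξ : Type*} [MeasurableSpace Ξ]

/-- `G_{μ,k} = (1/m_k) ∑_{i=1}^{m_k} G_μ(x, ξ_{k,i}, v_{k,i})` at the point `x`. -/
def batchGrad (Q : Problem n Ξ) (μ : ℝ) (mk : ℕ) (x : Eu n) (ξ : ℕ → Ξ) (v : ℕ → Eu n) : Eu n :=
  (1 / (mk : ℝ)) • ∑ i ∈ Finset.Icc 1 mk, Q.Gμ μ x (ξ i) (v i)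

/-- The iterates `x_1, x_2, …` of the algorithm, as functions of the samples; the value at the
unused index `0` is irrelevant. -/
def iter (Q : Problem n Ξ) (x₁ : Eu n) (μ : ℝ) (γ : ℕ → ℝ) (m : ℕ → ℕ)
    (ξ : ℕ → ℕ → Ξ) (v : ℕ → ℕ → Eu n) : ℕ → Eu n
  | 0 => x₁
  | 1 => x₁
  | k + 2 =>
    projPoint Q.X Q.h Q.ω Q.dω (γ (k + 1)) (iter Q x₁ μ γ m ξ v (k + 1))
      (batchGrad Q μ (m (k + 1)) (iter Q x₁ μ γ m ξ v (k + 1)) (ξ (k + 1)) (v (k + 1)))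

/-- The probability mass function `P_R(k) = (αγ_k - Lγ_k²) / ∑_{j=1}^N (αγ_j - Lγ_j²)`. -/
def stopPMF (α L : ℝ) (γ : ℕ → ℝ) (N : ℕ) (k : ℕ) : ℝ :=
  (α * γ k - L * γ k ^ 2) / ∑ j ∈ Finset.Icc 1 N, (α * γ j - L * γ j ^ 2)

variable {Ω : Type*} [MeasurableSpace Ω]

/-- The information available just before the `i`-th call of iteration `k`: the stopping index `R`
drawn in step `0` and the outcomes of all earlier calls. -/
abbrev history (m : ℕ → ℕ) (R : Ω → ℕ) (ξ : ℕ → ℕ → Ω → Ξ) (v : ℕ → ℕ → Ω → Eu n) (k i : ℕ) :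
    MeasurableSpace Ω :=
  MeasurableSpace.comap R ⊤ ⊔
    ⨆ (l : ℕ) (j : ℕ) (_ : 1 ≤ l ∧ 1 ≤ j ∧ j ≤ m l ∧ (l < k ∨ (l = k ∧ j < i))),
      MeasurableSpace.comap (fun ω => (ξ l j ω, v l j ω)) inferInstance

/-- The `k`-th iterate as a random variable. -/
def iterRV (Q : Problem n Ξ) (x₁ : Eu n) (μ : ℝ) (γ : ℕ → ℝ) (m : ℕ → ℕ)
    (ξ : ℕ → ℕ → Ω → Ξ) (v : ℕ → ℕ → Ω → Eu n) (k : ℕ) (ω : Ω) : Eu n :=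
  iter Q x₁ μ γ m (fun l j => ξ l j ω) (fun l j => v l j ω) k

/-- `R`, `ξ`, `v` are the random inputs of a run of the algorithm with iteration limit `N`,
stepsizes `γ`, batch sizes `m` and probability mass function `pR`: `R` has mass function `pR` on
`{1, …, N}`, and, conditionally on the past, the pair `(ξ_{k,i}, v_{k,i})` used in the `i`-th call
of iteration `k` has the law `noise k x_k ⊗ N(0, I)`. -/
structure IsRun (Q : Problem n Ξ) (x₁ : Eu n) (μ : ℝ) (γ : ℕ → ℝ) (m : ℕ → ℕ) (N : ℕ)
    (pR : ℕ → ℝ) (P : Measure Ω) (R : Ω → ℕ) (ξ : ℕ → ℕ → Ω → Ξ) (v : ℕ → ℕ → Ω → Eu n) :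
    Prop where
  measurable_R : Measurable R
  measurable_ξ : ∀ k i, Measurable (ξ k i)
  measurable_v : ∀ k i, Measurable (v k i)
  R_mem : ∀ᵐ ω ∂P, R ω ∈ Finset.Icc 1 N
  R_law : ∀ k ∈ Finset.Icc 1 N, P.real {ω | R ω = k} = pR k
  fresh : ∀ k ∈ Finset.Icc 1 N, ∀ i ∈ Finset.Icc 1 (m k),
    ∀ H : Set Ω, MeasurableSet[history m R ξ v k i] H →
    ∀ A : Set Ξ, MeasurableSet A → ∀ B : Set (Eu n), MeasurableSet B →
      P (H ∩ ξ k i ⁻¹' A ∩ v k i ⁻¹' B) =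
        ∫⁻ ω in H, Q.noise k (iterRV Q x₁ μ γ m ξ v k ω) A * stdGaussian (Eu n) B ∂P

/-- The number of oracle calls made to compute `x_r`. -/
def calls (m : ℕ → ℕ) (r : ℕ) : ℕ := ∑ k ∈ Finset.Icc 1 (r - 1), m k

end Algorithm

/-! ### Parameters for a total budget of `N̄` oracle calls -/

/-- The batch size
`m = ⌈min {max {√((n+4)(M²+σ²)N̄) / (L D̃), n+4}, N̄}⌉`. -/
def batchSize (n : ℕ) (L M σ Dt : ℝ) (Nbar : ℕ) : ℕ :=
  ⌈min (max (√((n + 4) * (M ^ 2 + σ ^ 2) * Nbar) / (L * Dt)) ((n : ℝ) + 4)) (Nbar : ℝ)⌉₊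

/-- The iteration limit `N = ⌊N̄ / m⌋`. -/
def iterLimit (n : ℕ) (L M σ Dt : ℝ) (Nbar : ℕ) : ℕ := Nbar / batchSize n L M σ Dt Nbar

/-- `θ₁ = max {1, √((n+4)(M²+σ²)) / (L D̃ √N̄)}`. -/
def θ₁ (n : ℕ) (L M σ Dt : ℝ) (Nbar : ℕ) : ℝ :=
  max 1 (√((n + 4) * (M ^ 2 + σ ^ 2)) / (L * Dt * √(Nbar : ℝ)))

/-- `θ₂ = max {1, (n+4) / N̄}`. -/
def θ₂ (n : ℕ) (Nbar : ℕ) : ℝ := max 1 (((n : ℝ) + 4) / Nbar)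

/-- The bound for the nonconvex case; `D` stands for `D_Ψ`. -/
def Bbar (n : ℕ) (L M σ Dt D : ℝ) (Nbar : ℕ) : ℝ :=
  (24 * θ₂ n Nbar + 41) * L * D ^ 2 * (n + 4) / Nbar +
    32 * √((n + 4) * (M ^ 2 + σ ^ 2)) / √(Nbar : ℝ) *
      (D ^ 2 / Dt + Dt * θ₁ n L M σ Dt Nbar)

/-- The bound for the convex case; `V₁` stands for `V(x*, x₁)`. -/
def Cbar (n : ℕ) (L α M σ Dt V₁ : ℝ) (Nbar : ℕ) : ℝ :=
  (5 + θ₂ n Nbar) * L * V₁ * (n + 4) / (α * Nbar) +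
    √((n + 4) * (M ^ 2 + σ ^ 2)) / (α * √(Nbar : ℝ)) *
      (4 * V₁ / Dt + α * Dt * θ₁ n L M σ Dt Nbar)

section Budget

variable {n : ℕ} {Ξ : Type*} [MeasurableSpace Ξ] {Ω : Type*} [MeasurableSpace Ω]

/-- The `k`-th iterate of the algorithm run with budget `N̄`: constant stepsizes `γ_k = α/(2L)` and
constant batch sizes `m_k = m`. -/
def budgetIter (Q : Problem n Ξ) (L α M σ Dt : ℝ) (Nbar : ℕ) (x₁ : Eu n) (μ : ℝ)
    (ξ : ℕ → ℕ → Ω → Ξ) (v : ℕ → ℕ → Ω → Eu n) (k : ℕ) (ω : Ω) : Eu n :=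
  iterRV Q x₁ μ (fun _ => α / (2 * L)) (fun _ => batchSize n L M σ Dt Nbar) ξ v k ω

/-- `R`, `ξ`, `v` are the random inputs of a run with budget `N̄`. -/
def IsBudgetRun (Q : Problem n Ξ) (L α M σ Dt : ℝ) (Nbar : ℕ) (x₁ : Eu n) (μ : ℝ)
    (P : Measure Ω) (R : Ω → ℕ) (ξ : ℕ → ℕ → Ω → Ξ) (v : ℕ → ℕ → Ω → Eu n) : Prop :=
  IsRun Q x₁ μ (fun _ => α / (2 * L)) (fun _ => batchSize n L M σ Dt Nbar)
    (iterLimit n L M σ Dt Nbar)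
    (stopPMF α L (fun _ => α / (2 * L)) (iterLimit n L M σ Dt Nbar)) P R ξ v

end Budget

end RSPGF

end

namespace RSPGF

/-! ### Gaussian integration by parts and moments -/

/-! One iteration is first analysed deterministically. Let p be the projection point computed from x
with an arbitrary vector g, and let δ = ‖g - ∇f(x)‖. For γ = α/(2L), optimality of p, strong
convexity of ω and smoothness of f give L‖x - p‖² ≤ Ψ(x) - Ψ(p) + δ²/(2L)
(`normSq_sub_projPoint_le`). The projection depends on g with Lipschitz constant 1/(2L), so passing
from g to the true gradient costs only another multiple of δ² (`normSq_gX_le`). The Ψ-differences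
telescope, and averaging over the uniform index R leaves 8(Ψ(x₁) - Ψ*)/N plus 6/L times the mean
squared error of the gradient estimate.

In the convex case the three-point inequality replaces descent, and the telescoping quantity is
V(x*, x_k) (`Psi_projPoint_sub_le`). The linear error term pairs x* - x_k with the estimate minus
its conditional mean `smoothGrad`, and it vanishes in expectation. Using `smoothGrad` in place of
the gradient in the first-order convexity inequality costs only μ²Ln/2
(`f_sub_le_inner_smoothGrad`).

The mean squared error comes from Gaussian integration by parts, which evaluates the needed moments
exactly: E⟨a,w⟩²‖w‖² = (n+2)‖a‖², E‖w‖⁴ = n(n+2), E‖w‖⁶ = n(n+2)(n+4). The first makes the noise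
contribution to one call linear in n (`Gμ_moments`), the second controls the smoothing bias
(`normSq_smoothGrad_sub_le`). A batch of m calls divides the variance bound by m.

The noise law depends on the current iterate, so the calls are not independent. Each call is
therefore treated conditionally on the past, through the joint law of past and call
(`map_prodMk_eq_compProd`). Within a batch the centred calls are orthogonal in L² (`sum_calls`). The
stopping index belongs to the history, but the conditional law of a call depends on the iterate
alone, so R is independent of the whole trajectory (`indep_traj`) and expectations at x_R become
averages (`integral_randomIndex`).

What remains is arithmetic: m is large enough to control the variance and small enough to keep 1/N
of order m/N̄. The truncations in its definition are paid for by θ₁ and θ₂. -/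

theorem gaussianPDFReal_zero_one_hasDerivAt (x : ℝ) :
    HasDerivAt (gaussianPDFReal 0 1) (-x * gaussianPDFReal 0 1 x) x := by
  simp only [gaussianPDFReal_def]
  have h : HasDerivAt (fun x : ℝ => -(x - 0) ^ 2 / (2 * ((1 : NNReal) : ℝ))) (-x) x := by
    have := (((hasDerivAt_id x).sub_const 0).pow 2).neg.div_const (2 * ((1 : NNReal) : ℝ))
    refine this.congr_deriv ?_
    simp
    ring
  refine ((h.exp).const_mul ((√(2 * Real.pi * ((1 : NNReal) : ℝ)))⁻¹)).congr_deriv ?_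
  ring

theorem integrable_gaussianReal_iff {φ : ℝ → ℝ} :
    Integrable φ (gaussianReal 0 1) ↔ Integrable (fun x => φ x * gaussianPDFReal 0 1 x) := by
  rw [gaussianReal_of_var_ne_zero 0 one_ne_zero,
    integrable_withDensity_iff (measurable_gaussianPDF 0 1)
      (ae_of_all _ fun x => gaussianPDF_lt_top)]
  simp [toReal_gaussianPDF]

/-- Integration by parts on the line: the standard Gaussian density ρ satisfies ρ' = -xρ, and
integrability makes the boundary terms vanish. -/
theorem integral_gaussianReal_mul_self {φ φ' : ℝ → ℝ} (hφ : ∀ x, HasDerivAt φ (φ' x) x)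
    (h₀ : Integrable φ (gaussianReal 0 1)) (h₁ : Integrable (fun x => φ x * x) (gaussianReal 0 1))
    (h₂ : Integrable φ' (gaussianReal 0 1)) :
    ∫ x, φ x * x ∂(gaussianReal 0 1) = ∫ x, φ' x ∂(gaussianReal 0 1) := by
  rw [integrable_gaussianReal_iff] at h₀ h₁ h₂
  simp only [integral_gaussianReal_eq_integral_smul one_ne_zero, smul_eq_mul]
  have key := integral_mul_deriv_eq_deriv_mul_of_integrable (u := φ) (u' := φ')
    (v := gaussianPDFReal 0 1) (v' := fun x => -x * gaussianPDFReal 0 1 x)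
    (fun x _ => hφ x) (fun x _ => gaussianPDFReal_zero_one_hasDerivAt x)
    ((h₁.neg).congr (ae_of_all _ fun x => by simp; ring)) h₂ h₀
  calc ∫ x, gaussianPDFReal 0 1 x * (φ x * x)
      = -∫ x, φ x * (-x * gaussianPDFReal 0 1 x) := by
        rw [← integral_neg]; congr 1; ext x; ring
    _ = ∫ x, gaussianPDFReal 0 1 x * φ' x := by
        rw [key, neg_neg]; congr 1; ext x; ring

variable {n : ℕ}

theorem integrable_stdGaussian_of_growth {E : Type*} [NormedAddCommGroup E] {h : Eu n → E}
    (hm : AEStronglyMeasurable h (stdGaussian (Eu n))) {C : ℝ} {p : ℕ}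
    (hb : ∀ w, ‖h w‖ ≤ C * (1 + ‖w‖ ^ p)) : Integrable h (stdGaussian (Eu n)) := by
  have h1 : Integrable (fun w : Eu n => C * (1 + ‖w‖ ^ p)) (stdGaussian (Eu n)) := by
    have : MemLp id (p : ENNReal) (stdGaussian (Eu n)) := IsGaussian.memLp_id _ _ (by simp)
    exact ((integrable_const 1).add this.integrable_norm_pow').const_mul C
  exact h1.mono' hm (ae_of_all _ hb)

/-- Fubini reduces this to the one-dimensional identity: the other coordinates are frozen, and
almost every slice inherits the three integrability hypotheses. -/
theorem integral_stdGaussian_mul_coord {g : Eu n → ℝ} {G : Eu n → Eu n}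
    (hg : ∀ w, HasGradientAt g (G w) w) (h₀ : Integrable g (stdGaussian (Eu n)))
    (h₁ : Integrable (fun w => g w • w) (stdGaussian (Eu n)))
    (h₂ : Integrable G (stdGaussian (Eu n))) (i : Fin n) :
    ∫ w, g w * w i ∂(stdGaussian (Eu n)) = ∫ w, G w i ∂(stdGaussian (Eu n)) := by
  obtain ⟨k, rfl⟩ : ∃ k, n = k + 1 := ⟨n - 1, by have := i.2; omega⟩
  have hcoord : ∀ {H : Eu (k + 1) → Eu (k + 1)}, Integrable H (stdGaussian (Eu (k + 1))) →
      Integrable (fun w => H w i) (stdGaussian (Eu (k + 1))) := fun hH =>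
    (EuclideanSpace.proj (𝕜 := ℝ) i).integrable_comp hH
  have h₁' := hcoord h₁
  have h₂' := hcoord h₂
  simp only [PiLp.smul_apply, smul_eq_mul] at h₁'
  let ν := (gaussianReal 0 1).prod (Measure.pi fun _ : Fin k => gaussianReal 0 1)
  -- `T` inserts the i-th coordinate into the remaining ones. It transports the product Gaussian to
  -- the standard Gaussian and is affine in the inserted coordinate with direction e_i.
  let T : ℝ × (Fin k → ℝ) → Eu (k + 1) := fun p => WithLp.toLp 2 (i.insertNth p.1 p.2)
  have hT : MeasurePreserving T ν (stdGaussian (Eu (k + 1))) := by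
    have e1 := (measurePreserving_piFinSuccAbove (fun _ : Fin (k + 1) => gaussianReal 0 1) i).symm
    have e2 : MeasurePreserving (WithLp.toLp 2 : (Fin (k + 1) → ℝ) → Eu (k + 1))
        (Measure.pi fun _ => gaussianReal 0 1) (stdGaussian (Eu (k + 1))) :=
      ⟨by fun_prop, map_pi_eq_stdGaussian⟩
    exact e2.comp e1
  have hTadd : ∀ t y, T (t, y) = T (0, y) + t • EuclideanSpace.single i (1 : ℝ) := by
    intro t y
    ext j
    refine Fin.succAboveCases i ?_ (fun j => ?_) j
    · simp [T]
    · simp [T]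
  have hTd : ∀ t y, HasDerivAt (fun t => T (t, y)) (EuclideanSpace.single i (1 : ℝ)) t := by
    intro t y
    have := ((hasDerivAt_id t).smul_const (EuclideanSpace.single i (1 : ℝ))).const_add (T (0, y))
    simp only [one_smul, id] at this
    exact this.congr_of_eventuallyEq (Filter.Eventually.of_forall fun t => hTadd t y)
  have hd : ∀ t y, HasDerivAt (fun t => g (T (t, y))) (G (T (t, y)) i) t := by
    intro t y
    have := (hg (T (t, y))).hasFDerivAt.comp_hasDerivAt t (hTd t y)
    refine HasDerivAt.congr_deriv (f := fun t => g (T (t, y))) this ?_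
    simp [EuclideanSpace.inner_single_right]
  have hTi : ∀ t y, (T (t, y)) i = t := by intro t y; simp [T]
  have tr : ∀ {φ : Eu (k + 1) → ℝ}, Integrable φ (stdGaussian (Eu (k + 1))) →
      Integrable (fun p => φ (T p)) ν ∧
      ∫ w, φ w ∂(stdGaussian (Eu (k + 1))) = ∫ p, φ (T p) ∂ν := by
    intro φ hφ
    refine ⟨hT.integrable_comp_of_integrable hφ, ?_⟩
    conv_lhs => rw [← hT.map_eq]
    exact integral_map hT.measurable.aemeasurable (by rw [hT.map_eq]; exact hφ.1)
  obtain ⟨i0, -⟩ := tr h₀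
  obtain ⟨i1, e1⟩ := tr h₁'
  obtain ⟨i2, e2⟩ := tr h₂'
  rw [e1, e2, integral_prod_symm _ i1, integral_prod_symm _ i2]
  apply integral_congr_ae
  filter_upwards [i0.prod_left_ae, i1.prod_left_ae, i2.prod_left_ae] with y a0 a1 a2
  simp only [hTi] at a1 ⊢
  exact integral_gaussianReal_mul_self (fun t => hd t y) a0 a1 a2

/-- Gaussian integration by parts. -/
theorem integral_stdGaussian_mul_inner {g : Eu n → ℝ} {G : Eu n → Eu n}
    (hg : ∀ w, HasGradientAt g (G w) w) (h₀ : Integrable g (stdGaussian (Eu n)))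
    (h₁ : Integrable (fun w => g w • w) (stdGaussian (Eu n)))
    (h₂ : Integrable G (stdGaussian (Eu n))) (a : Eu n) :
    ∫ w, g w * ⟪a, w⟫ ∂(stdGaussian (Eu n)) = ∫ w, ⟪a, G w⟫ ∂(stdGaussian (Eu n)) := by
  have hcoord : ∀ {H : Eu n → Eu n}, Integrable H (stdGaussian (Eu n)) → ∀ i,
      Integrable (fun w => H w i) (stdGaussian (Eu n)) := fun hH i =>
    (EuclideanSpace.proj (𝕜 := ℝ) i).integrable_comp hH
  have e : ∀ x y : Eu n, ⟪x, y⟫ = ∑ i, x i * y i := by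
    intro x y; simp [PiLp.inner_apply, mul_comm]
  simp only [e, Finset.mul_sum]
  rw [integral_finsetSum _ fun i _ => ((hcoord h₂ i).const_mul (a i)),
    integral_finsetSum _ fun i _ => ?_]
  · refine Finset.sum_congr rfl fun i _ => ?_
    rw [integral_const_mul, ← integral_stdGaussian_mul_coord hg h₀ h₁ h₂ i, ← integral_const_mul]
    congr 1; ext w; ring
  · refine ((hcoord h₁ i).const_mul (a i)).congr (ae_of_all _ fun w => ?_)
    simp; ring

/-! ### Exact moments of the standard Gaussian -/

theorem integral_inner_sq_stdGaussian (a : Eu n) :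
    ∫ w, ⟪a, w⟫ ^ 2 ∂(stdGaussian (Eu n)) = ‖a‖ ^ 2 := by
  have hg : ∀ w, HasGradientAt (fun w : Eu n => ⟪a, w⟫) a w := by
    intro w
    rw [hasGradientAt_iff_hasFDerivAt]
    exact ((innerSL ℝ a).hasFDerivAt (x := w))
  have hn : ∀ w : Eu n, |⟪a, w⟫| ≤ ‖a‖ * ‖w‖ := fun w => abs_real_inner_le_norm a w
  have := integral_stdGaussian_mul_inner hg
    (integrable_stdGaussian_of_growth (by fun_prop) (C := ‖a‖) (p := 1) fun w => by
      rw [Real.norm_eq_abs]; nlinarith [hn w, norm_nonneg a])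
    (integrable_stdGaussian_of_growth (by fun_prop) (C := ‖a‖) (p := 2) fun w => by
      rw [norm_smul, Real.norm_eq_abs]
      nlinarith [mul_le_mul_of_nonneg_right (hn w) (norm_nonneg w), norm_nonneg a])
    (integrable_const a) a
  simpa [pow_two] using this

/-- Integration by parts in direction a, applied to w ↦ ⟨a,w⟩‖w‖^{2(k+1)}: one term of the gradient
comes from the linear factor, the other from the power of the norm. Summing over an orthonormal
basis turns this into a recursion for the even moments of ‖w‖. -/
theorem integral_inner_sq_mul_normSq_pow_stdGaussian (a : Eu n) (k : ℕ) :
    ∫ w, ⟪a, w⟫ ^ 2 * (‖w‖ ^ 2) ^ (k + 1) ∂(stdGaussian (Eu n)) =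
      ‖a‖ ^ 2 * ∫ w, (‖w‖ ^ 2) ^ (k + 1) ∂(stdGaussian (Eu n)) +
        2 * (k + 1) * ∫ w, ⟪a, w⟫ ^ 2 * (‖w‖ ^ 2) ^ k ∂(stdGaussian (Eu n)) := by
  have hg : ∀ w, HasGradientAt (fun w : Eu n => ⟪a, w⟫ * (‖w‖ ^ 2) ^ (k + 1))
      ((‖w‖ ^ 2) ^ (k + 1) • a + (2 * (k + 1) * ⟪a, w⟫ * (‖w‖ ^ 2) ^ k) • w) w := by
    intro w
    have h1 := (innerSL ℝ a).hasFDerivAt (x := w)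
    have h2 : HasFDerivAt (fun w : Eu n => ‖w‖ ^ 2) (2 • innerSL ℝ w) w :=
      (hasStrictFDerivAt_norm_sq w).hasFDerivAt
    have h3 := h1.mul (h2.pow (k + 1))
    rw [hasGradientAt_iff_hasFDerivAt]
    refine HasFDerivAt.congr_fderiv (f := fun w : Eu n => ⟪a, w⟫ * (‖w‖ ^ 2) ^ (k + 1)) h3 ?_
    ext x
    simp
    ring
  have hn : ∀ w : Eu n, |⟪a, w⟫| ≤ ‖a‖ * ‖w‖ := fun w => abs_real_inner_le_norm a w
  have hn2 : ∀ w : Eu n, ⟪a, w⟫ ^ 2 ≤ ‖a‖ ^ 2 * ‖w‖ ^ 2 := fun w => by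
    rw [← mul_pow, ← sq_abs]; exact pow_le_pow_left₀ (abs_nonneg _) (hn w) 2
  have i0 : Integrable (fun w : Eu n => ⟪a, w⟫ * (‖w‖ ^ 2) ^ (k + 1)) (stdGaussian (Eu n)) :=
    integrable_stdGaussian_of_growth (by fun_prop) (C := ‖a‖) (p := 2 * k + 3) fun w => by
      rw [norm_mul, Real.norm_eq_abs, Real.norm_of_nonneg (by positivity)]
      calc _ ≤ ‖a‖ * ‖w‖ * (‖w‖ ^ 2) ^ (k + 1) := by gcongr; exact hn w
        _ = ‖a‖ * ‖w‖ ^ (2 * k + 3) := by ring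
        _ ≤ _ := by gcongr; linarith
  have i1 : Integrable (fun w : Eu n => (⟪a, w⟫ * (‖w‖ ^ 2) ^ (k + 1)) • w)
      (stdGaussian (Eu n)) :=
    integrable_stdGaussian_of_growth (by fun_prop) (C := ‖a‖) (p := 2 * k + 4) fun w => by
      rw [norm_smul, norm_mul, Real.norm_eq_abs, Real.norm_of_nonneg (by positivity)]
      calc _ ≤ ‖a‖ * ‖w‖ * (‖w‖ ^ 2) ^ (k + 1) * ‖w‖ := by gcongr; exact hn w
        _ = ‖a‖ * ‖w‖ ^ (2 * k + 4) := by ring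
        _ ≤ _ := by gcongr; linarith
  have j1 : Integrable (fun w : Eu n => (‖w‖ ^ 2) ^ (k + 1)) (stdGaussian (Eu n)) :=
    integrable_stdGaussian_of_growth (by fun_prop) (C := 1) (p := 2 * k + 2) fun w => by
      rw [Real.norm_of_nonneg (by positivity), ← pow_mul]
      ring_nf; linarith
  have j2 : Integrable (fun w : Eu n => ⟪a, w⟫ ^ 2 * (‖w‖ ^ 2) ^ k) (stdGaussian (Eu n)) :=
    integrable_stdGaussian_of_growth (by fun_prop) (C := ‖a‖ ^ 2) (p := 2 * k + 2) fun w => by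
      rw [Real.norm_of_nonneg (by positivity)]
      calc _ ≤ ‖a‖ ^ 2 * ‖w‖ ^ 2 * (‖w‖ ^ 2) ^ k := by gcongr; exact hn2 w
        _ = ‖a‖ ^ 2 * ‖w‖ ^ (2 * k + 2) := by ring
        _ ≤ _ := by gcongr; linarith
  have i2a : Integrable (fun w : Eu n => (2 * (k + 1) * ⟪a, w⟫ * (‖w‖ ^ 2) ^ k) • w)
      (stdGaussian (Eu n)) :=
    integrable_stdGaussian_of_growth (by fun_prop) (C := 2 * (k + 1) * ‖a‖) (p := 2 * k + 2)
      fun w => by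
      rw [norm_smul, norm_mul, norm_mul, Real.norm_eq_abs ⟪a, w⟫,
        Real.norm_of_nonneg (by positivity : (0:ℝ) ≤ (‖w‖ ^ 2) ^ k),
        Real.norm_of_nonneg (by positivity : (0:ℝ) ≤ 2 * ((k : ℝ) + 1))]
      calc _ ≤ 2 * ((k : ℝ) + 1) * (‖a‖ * ‖w‖) * (‖w‖ ^ 2) ^ k * ‖w‖ := by gcongr; exact hn w
        _ = 2 * ((k : ℝ) + 1) * ‖a‖ * ‖w‖ ^ (2 * k + 2) := by ring
        _ ≤ _ := by gcongr; linarith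
  have key := integral_stdGaussian_mul_inner hg i0 i1 ((j1.smul_const a).add i2a) a
  calc _ = ∫ w, ⟪a, w⟫ * (‖w‖ ^ 2) ^ (k + 1) * ⟪a, w⟫ ∂(stdGaussian (Eu n)) := by
        congr 1; ext w; ring
    _ = _ := by
        rw [key, ← integral_const_mul, ← integral_const_mul, ← integral_add (j1.const_mul _)
          (j2.const_mul _)]
        congr 1; ext w
        simp only [inner_add_right, inner_smul_right, real_inner_self_eq_norm_sq]
        ring

theorem normSq_eq_sum_inner_single (w : Eu n) :
    ‖w‖ ^ 2 = ∑ i, ⟪EuclideanSpace.single i (1 : ℝ), w⟫ ^ 2 := by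
  simp [EuclideanSpace.norm_sq_eq, EuclideanSpace.inner_single_left]

theorem integrable_inner_sq_mul_normSq_pow_stdGaussian (a : Eu n) (k : ℕ) :
    Integrable (fun w : Eu n => ⟪a, w⟫ ^ 2 * (‖w‖ ^ 2) ^ k) (stdGaussian (Eu n)) :=
  integrable_stdGaussian_of_growth (by fun_prop) (C := ‖a‖ ^ 2) (p := 2 * k + 2) fun w => by
    rw [Real.norm_of_nonneg (by positivity)]
    have hn2 : ⟪a, w⟫ ^ 2 ≤ ‖a‖ ^ 2 * ‖w‖ ^ 2 := by
      rw [← mul_pow, ← sq_abs]; exact pow_le_pow_left₀ (abs_nonneg _) (abs_real_inner_le_norm a w) 2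
    calc _ ≤ ‖a‖ ^ 2 * ‖w‖ ^ 2 * (‖w‖ ^ 2) ^ k := by gcongr
      _ = ‖a‖ ^ 2 * ‖w‖ ^ (2 * k + 2) := by ring
      _ ≤ _ := by gcongr; linarith

theorem integral_normSq_pow_succ_stdGaussian (k : ℕ) :
    ∫ w : Eu n, (‖w‖ ^ 2) ^ (k + 1) ∂(stdGaussian (Eu n)) =
      ∑ i : Fin n, ∫ w, ⟪EuclideanSpace.single i (1 : ℝ), w⟫ ^ 2 * (‖w‖ ^ 2) ^ k
        ∂(stdGaussian (Eu n)) := by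
  rw [← integral_finsetSum _ fun i _ => integrable_inner_sq_mul_normSq_pow_stdGaussian _ k]
  congr 1; ext w
  rw [← Finset.sum_mul, ← normSq_eq_sum_inner_single]; ring

theorem integral_normSq_stdGaussian :
    ∫ w : Eu n, ‖w‖ ^ 2 ∂(stdGaussian (Eu n)) = n := by
  have := integral_normSq_pow_succ_stdGaussian (n := n) 0
  simpa [integral_inner_sq_stdGaussian] using this

theorem integral_normSq_pow_add_two_stdGaussian (k : ℕ) :
    ∫ w : Eu n, (‖w‖ ^ 2) ^ (k + 2) ∂(stdGaussian (Eu n)) =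
      (n + 2 * (k + 1)) * ∫ w : Eu n, (‖w‖ ^ 2) ^ (k + 1) ∂(stdGaussian (Eu n)) := by
  rw [integral_normSq_pow_succ_stdGaussian (k + 1)]
  simp only [integral_inner_sq_mul_normSq_pow_stdGaussian]
  rw [Finset.sum_add_distrib, ← Finset.mul_sum, ← integral_normSq_pow_succ_stdGaussian]
  simp
  ring

theorem integral_norm_pow_four_stdGaussian :
    ∫ w : Eu n, (‖w‖ ^ 2) ^ 2 ∂(stdGaussian (Eu n)) = n * (n + 2) := by
  rw [integral_normSq_pow_add_two_stdGaussian 0]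
  simp [integral_normSq_stdGaussian]; ring

theorem integral_norm_pow_six_stdGaussian :
    ∫ w : Eu n, (‖w‖ ^ 2) ^ 3 ∂(stdGaussian (Eu n)) = n * (n + 2) * (n + 4) := by
  rw [integral_normSq_pow_add_two_stdGaussian 1, integral_norm_pow_four_stdGaussian]
  push_cast; ring

theorem integral_inner_sq_mul_normSq_stdGaussian (a : Eu n) :
    ∫ w, ⟪a, w⟫ ^ 2 * ‖w‖ ^ 2 ∂(stdGaussian (Eu n)) = (n + 2) * ‖a‖ ^ 2 := by
  have := integral_inner_sq_mul_normSq_pow_stdGaussian a 0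
  simp only [zero_add, pow_one, pow_zero, mul_one, integral_normSq_stdGaussian,
    integral_inner_sq_stdGaussian] at this
  rw [this]; push_cast; ring

end RSPGF

namespace RSPGF

variable {n : ℕ}

/-! ### Prox-functions and generalized projections -/

/-- Subtracting D₀t + ct²/2 leaves a function with nonnegative derivative. With c ≥ 0 this
integrates strong monotonicity of ∇ω; with c ≤ 0, applied to -φ, it gives the descent lemma. -/
theorem add_half_le_of_deriv_ge {q D : ℝ → ℝ} {D₀ c : ℝ}
    (hq : ∀ t ∈ Set.Icc (0 : ℝ) 1, HasDerivWithinAt q (D t) (Set.Icc 0 1) t)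
    (hD : ∀ t ∈ Set.Ioo (0 : ℝ) 1, D₀ + t * c ≤ D t) : q 0 + D₀ + c / 2 ≤ q 1 := by
  have hr : ∀ t ∈ Set.Icc (0 : ℝ) 1, HasDerivWithinAt (fun t => q t - (D₀ * t + c / 2 * t ^ 2))
      (D t - (D₀ + t * c)) (Set.Icc 0 1) t := by
    intro t ht
    have h1 : HasDerivAt (fun t : ℝ => D₀ * t + c / 2 * t ^ 2) (D₀ + t * c) t := by
      refine (((hasDerivAt_id t).const_mul D₀).add
        (((hasDerivAt_id t).pow 2).const_mul (c / 2))).congr_deriv ?_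
      simp; ring
    exact (hq t ht).sub h1.hasDerivWithinAt
  have hmono : MonotoneOn (fun t => q t - (D₀ * t + c / 2 * t ^ 2)) (Set.Icc 0 1) := by
    apply monotoneOn_of_deriv_nonneg (convex_Icc 0 1) fun t ht => (hr t ht).continuousWithinAt
    · intro t ht
      exact ((hr t (interior_subset ht)).mono interior_subset).differentiableWithinAt
    · intro t ht
      rw [interior_Icc] at ht
      rw [((hr t ⟨ht.1.le, ht.2.le⟩).hasDerivAt (Icc_mem_nhds ht.1 ht.2)).deriv]
      linarith [hD t ht]
  have := hmono (Set.left_mem_Icc.2 zero_le_one) (Set.right_mem_Icc.2 zero_le_one) zero_le_one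
  simp only at this
  linarith

theorem HasGradientWithinAt.hasDerivWithinAt_segment {X : Set (Eu n)} (hX : Convex ℝ X)
    {φ : Eu n → ℝ} {dφ : Eu n → Eu n} (hφ : ∀ x ∈ X, HasGradientWithinAt φ (dφ x) X x)
    {x z : Eu n} (hx : x ∈ X) (hz : z ∈ X) {t : ℝ} (ht : t ∈ Set.Icc (0 : ℝ) 1) :
    HasDerivWithinAt (fun t : ℝ => φ (z + t • (x - z))) ⟪dφ (z + t • (x - z)), x - z⟫
      (Set.Icc 0 1) t := by
  have hmem : ∀ t ∈ Set.Icc (0 : ℝ) 1, z + t • (x - z) ∈ X := fun t ht =>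
    hX.add_smul_sub_mem hz hx ht
  have h1 : HasDerivWithinAt (fun t : ℝ => z + t • (x - z)) (x - z) (Set.Icc 0 1) t := by
    have := (((hasDerivAt_id t).smul_const (x - z)).const_add z).hasDerivWithinAt
      (s := Set.Icc (0 : ℝ) 1)
    simpa using this
  have := (hφ _ (hmem t ht)).hasFDerivWithinAt.comp_hasDerivWithinAt t h1 hmem
  exact HasDerivWithinAt.congr_deriv (f := fun t : ℝ => φ (z + t • (x - z))) this (by simp)

namespace IsDistGen

variable {X : Set (Eu n)} {ω : Eu n → ℝ} {dω : Eu n → Eu n} {α : ℝ}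

theorem le_prox (hω : IsDistGen X ω dω α) (hX : Convex ℝ X) {x z : Eu n} (hx : x ∈ X)
    (hz : z ∈ X) : α / 2 * ‖x - z‖ ^ 2 ≤ prox ω dω x z := by
  have := add_half_le_of_deriv_ge (D₀ := ⟪dω z, x - z⟫) (c := α * ‖x - z‖ ^ 2)
    (fun t ht => HasGradientWithinAt.hasDerivWithinAt_segment hX hω.hasGradient hx hz ht)
    (fun t ht => by
      have h1 := hω.strongly_convex _ (hX.add_smul_sub_mem hz hx ⟨ht.1.le, ht.2.le⟩) z hz
      rw [add_sub_cancel_left, norm_smul, Real.norm_of_nonneg ht.1.le, inner_smul_left,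
        inner_sub_right, real_inner_comm, real_inner_comm (dω z)] at h1
      simp only [conj_trivial] at h1
      have : t * (t * (α * ‖x - z‖ ^ 2)) ≤
          t * (⟪dω (z + t • (x - z)), x - z⟫ - ⟪dω z, x - z⟫) := by nlinarith
      linarith [le_of_mul_le_mul_left this ht.1])
  simp only [zero_smul, add_zero, one_smul, add_sub_cancel] at this
  unfold prox
  linarith

theorem continuousOn (hω : IsDistGen X ω dω α) : ContinuousOn ω X := fun x hx =>
  (hω.hasGradient x hx).continuousWithinAt

end IsDistGen

/-- The ω-values cancel, so the defect in the triangle identity for V is a single inner product.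
This converts the optimality condition into a telescoping one. -/
theorem prox_sub_prox_sub_prox (ω : Eu n → ℝ) (dω : Eu n → Eu n) (u p x : Eu n) :
    prox ω dω u x - prox ω dω u p - prox ω dω p x = ⟪dω p - dω x, u - p⟫ := by
  simp only [prox, inner_sub_left, inner_sub_right]
  ring

namespace IsProj

variable {X : Set (Eu n)} {h ω : Eu n → ℝ} {dω : Eu n → Eu n} {α γ : ℝ}

/-- The optimality condition of the generalized projection problem. -/
theorem variational (hX : Convex ℝ X) (hh : ConvexOn ℝ X h) (hω : IsDistGen X ω dω α)
    {x g p u : Eu n} (hp : IsProj X h ω dω γ x g p) (hu : u ∈ X) :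
    0 ≤ ⟪g + (1 / γ) • (dω p - dω x), u - p⟫ + h u - h p := by
  have hd := HasGradientWithinAt.hasDerivWithinAt_segment hX hω.hasGradient hu hp.1
    (t := 0) ⟨le_rfl, zero_le_one⟩
  simp only [zero_smul, add_zero] at hd
  -- Since `h` need not be differentiable, it is replaced along the segment by its chord, whose
  -- slope enters `c`. The chord dominates `h` and agrees with it at t = 0, so minimality of p still
  -- makes the right derivative at 0 nonnegative.
  set c : ℝ := ⟪g - (1 / γ) • dω x, u - p⟫ + (h u - h p) with hc
  have hr : HasDerivWithinAt (fun t : ℝ => c * t + 1 / γ * ω (p + t • (u - p)))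
      (c + 1 / γ * ⟪dω p, u - p⟫) (Set.Icc 0 1) 0 := by
    have := (((hasDerivAt_id (0 : ℝ)).const_mul c).hasDerivWithinAt).add (hd.const_mul (1 / γ))
    simpa using! this
  have hr' := hr.mono (Set.Ioc_subset_Icc_self)
  rw [hasDerivWithinAt_iff_tendsto_slope, Set.sdiff_singleton_eq_self (by simp)] at hr'
  have : (nhdsWithin (0 : ℝ) (Set.Ioc 0 1)).NeBot := left_nhdsWithin_Ioc_neBot zero_lt_one
  have h0 : 0 ≤ c + 1 / γ * ⟪dω p, u - p⟫ := by
    refine ge_of_tendsto hr' ?_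
    filter_upwards [self_mem_nhdsWithin] with t ht
    have hmem := hX.add_smul_sub_mem hp.1 hu ⟨ht.1.le, ht.2⟩
    have h1 := hp.2 hmem
    have h2 : h (p + t • (u - p)) ≤ (1 - t) * h p + t * h u := by
      have := hh.2 hp.1 hu (sub_nonneg.2 ht.2) ht.1.le (by ring)
      rw [smul_eq_mul, smul_eq_mul] at this
      have e : p + t • (u - p) = (1 - t) • p + t • u := by module
      rwa [e]
    simp only [Set.mem_ofPred_eq, projObjective, prox] at h1
    rw [slope_def_field, sub_zero]
    apply div_nonneg _ ht.1.le
    simp only [zero_smul, add_zero, mul_zero]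
    have e1 : p + t • (u - p) - x = (p - x) + t • (u - p) := by abel
    rw [e1] at h1
    simp only [inner_add_right, inner_smul_right] at h1
    simp only [hc, inner_sub_left, inner_smul_left, conj_trivial]
    linarith
  simp only [hc, inner_add_left, inner_sub_left, inner_smul_left, conj_trivial] at h0 ⊢
  linarith

theorem three_point (hX : Convex ℝ X) (hh : ConvexOn ℝ X h) (hω : IsDistGen X ω dω α)
    {x g p u : Eu n} (hp : IsProj X h ω dω γ x g p) (hu : u ∈ X) :
    ⟪g, p - u⟫ + h p - h u ≤
      1 / γ * (prox ω dω u x - prox ω dω u p - prox ω dω p x) := by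
  have := hp.variational hX hh hω hu
  rw [prox_sub_prox_sub_prox]
  rw [inner_add_left, inner_smul_left, conj_trivial] at this
  have e : ⟪g, p - u⟫ = -⟪g, u - p⟫ := by rw [← inner_neg_right, neg_sub]
  linarith

/-- The optimality condition is tested at u = x itself, and strong monotonicity of ∇ω turns its
inner product into a multiple of ‖x - p‖². -/
theorem norm_sq_le (hX : Convex ℝ X) (hh : ConvexOn ℝ X h) (hω : IsDistGen X ω dω α)
    (hγ : 0 < γ) {x g p : Eu n} (hx : x ∈ X) (hp : IsProj X h ω dω γ x g p) :
    α / γ * ‖x - p‖ ^ 2 ≤ ⟪g, x - p⟫ + h x - h p := by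
  have h1 := hp.variational hX hh hω hx
  have h2 := hω.strongly_convex x hx p hp.1
  rw [inner_add_left, inner_smul_left, conj_trivial] at h1
  rw [real_inner_comm, ← neg_sub (dω p), inner_neg_left] at h2
  have h3 : 1 / γ * (α * ‖x - p‖ ^ 2) ≤ 1 / γ * -⟪dω p - dω x, x - p⟫ :=
    mul_le_mul_of_nonneg_left h2 (by positivity)
  have e : α / γ * ‖x - p‖ ^ 2 = 1 / γ * (α * ‖x - p‖ ^ 2) := by ring
  linarith

/-- The solution of the projection problem depends on `(x, g)` in a Lipschitz way. -/
theorem norm_sub_le (hX : Convex ℝ X) (hh : ConvexOn ℝ X h) (hω : IsDistGen X ω dω α)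
    (hα : 0 < α) (hγ : 0 < γ) {x₁ x₂ g₁ g₂ p₁ p₂ : Eu n}
    (h₁ : IsProj X h ω dω γ x₁ g₁ p₁) (h₂ : IsProj X h ω dω γ x₂ g₂ p₂) :
    ‖p₁ - p₂‖ ≤ γ / α * ‖(g₁ - (1 / γ) • dω x₁) - (g₂ - (1 / γ) • dω x₂)‖ := by
  -- Each solution is a competitor in the other's optimality condition. In the sum of the two, `h`
  -- cancels, and strong monotonicity of ∇ω bounds ‖p₁ - p₂‖² from above.
  have a1 := h₁.variational hX hh hω h₂.1
  have a2 := h₂.variational hX hh hω h₁.1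
  have a3 := hω.strongly_convex p₁ h₁.1 p₂ h₂.1
  set y := (g₁ - (1 / γ) • dω x₁) - (g₂ - (1 / γ) • dω x₂) with hy
  have a4 : 1 / γ * (α * ‖p₁ - p₂‖ ^ 2) ≤ 1 / γ * ⟪p₁ - p₂, dω p₁ - dω p₂⟫ :=
    mul_le_mul_of_nonneg_left a3 (by positivity)
  have a5 : 1 / γ * (α * ‖p₁ - p₂‖ ^ 2) ≤ ⟪y, p₂ - p₁⟫ := by
    rw [real_inner_comm] at a4
    simp only [hy, inner_add_left, inner_sub_left, inner_sub_right, inner_smul_left,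
      conj_trivial] at *
    linarith
  have a6 := real_inner_le_norm y (p₂ - p₁)
  rw [norm_sub_rev p₂ p₁] at a6
  rcases (norm_nonneg (p₁ - p₂)).eq_or_lt with h0 | h0
  · rw [← h0]; positivity
  · have a7 : 1 / γ * (α * ‖p₁ - p₂‖) ≤ ‖y‖ := by
      refine le_of_mul_le_mul_right ?_ h0
      nlinarith
    calc ‖p₁ - p₂‖ = γ / α * (1 / γ * (α * ‖p₁ - p₂‖)) := by field_simp
      _ ≤ _ := mul_le_mul_of_nonneg_left a7 (by positivity)

end IsProj

theorem le_of_lipschitz_gradient {X : Set (Eu n)} (hX : Convex ℝ X) {φ : Eu n → ℝ}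
    {dφ : Eu n → Eu n} {L : ℝ} (hφ : ∀ x ∈ X, HasGradientWithinAt φ (dφ x) X x)
    (hL : ∀ x ∈ X, ∀ y ∈ X, ‖dφ y - dφ x‖ ≤ L * ‖y - x‖) {x y : Eu n} (hx : x ∈ X)
    (hy : y ∈ X) : φ y ≤ φ x + ⟪dφ x, y - x⟫ + L / 2 * ‖y - x‖ ^ 2 := by
  have hg : ∀ z ∈ X, HasGradientWithinAt (fun z => -φ z) (-dφ z) X z := by
    intro z hz
    have := (hφ z hz).hasFDerivWithinAt.neg
    rw [hasGradientWithinAt_iff_hasFDerivWithinAt]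
    simpa using! this
  have := add_half_le_of_deriv_ge (D₀ := -⟪dφ x, y - x⟫) (c := -(L * ‖y - x‖ ^ 2))
    (fun t ht => HasGradientWithinAt.hasDerivWithinAt_segment hX hg hy hx ht)
    (fun t ht => by
      have h1 := hL x hx _ (hX.add_smul_sub_mem hx hy ⟨ht.1.le, ht.2.le⟩)
      rw [add_sub_cancel_left, norm_smul, Real.norm_of_nonneg ht.1.le] at h1
      have h2 := real_inner_le_norm (dφ (x + t • (y - x)) - dφ x) (y - x)
      rw [inner_sub_left] at h2
      rw [inner_neg_left]
      nlinarith [mul_le_mul_of_nonneg_right h1 (norm_nonneg (y - x))])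
  simp only [zero_smul, add_zero, one_smul, add_sub_cancel] at this
  linarith

theorem IsC11.abs_sub_le {L : ℝ} {g : Eu n → ℝ} (hg : IsC11 L g) (x y : Eu n) :
    |g y - g x - ⟪gradient g x, y - x⟫| ≤ L / 2 * ‖y - x‖ ^ 2 := by
  have h1 := le_of_lipschitz_gradient convex_univ
    (fun z _ => (hg.1 z).hasGradientAt.hasFDerivAt.hasFDerivWithinAt)
    (fun x _ y _ => hg.2 x y) (Set.mem_univ x) (Set.mem_univ y)
  have h2 := le_of_lipschitz_gradient (φ := fun z => -g z) (dφ := fun z => -gradient g z)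
    convex_univ
    (fun z _ => by
      have := (hg.1 z).hasGradientAt.hasFDerivAt.neg
      rw [hasGradientWithinAt_univ, hasGradientAt_iff_hasFDerivAt]
      simpa using! this)
    (fun x _ y _ => by
      rw [← neg_add', norm_neg, ← sub_eq_add_neg]; exact hg.2 x y)
    (Set.mem_univ x) (Set.mem_univ y)
  rw [inner_neg_left] at h2
  rw [abs_le]
  constructor <;> linarith

theorem young_inner {L : ℝ} (hL : 0 < L) (a b : Eu n) :
    ⟪a, b⟫ ≤ ‖a‖ ^ 2 / (2 * L) + L / 2 * ‖b‖ ^ 2 := by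
  have h1 := real_inner_le_norm a b
  have h2 : ‖a‖ ^ 2 / (2 * L) + L / 2 * ‖b‖ ^ 2 - ‖a‖ * ‖b‖ =
      (‖a‖ - L * ‖b‖) ^ 2 / (2 * L) := by field_simp; ring
  have h3 : 0 ≤ (‖a‖ - L * ‖b‖) ^ 2 / (2 * L) := by positivity
  linarith

namespace Problem.Assumptions

variable {Ξ : Type*} [MeasurableSpace Ξ] {Q : Problem n Ξ} {L α σ M : ℝ}

theorem isProj_projPoint (hQ : Q.Assumptions L α σ M) {γ : ℝ} (hγ : 0 < γ) {x : Eu n}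
    (hx : x ∈ Q.X) (g : Eu n) :
    IsProj Q.X Q.h Q.ω Q.dω γ x g (projPoint Q.X Q.h Q.ω Q.dω γ x g) :=
  Classical.epsilon_spec (hQ.solvable γ hγ g x hx)

theorem norm_projPoint_sub_le (hQ : Q.Assumptions L α σ M) (hα : 0 < α) {γ : ℝ} (hγ : 0 < γ)
    {x₁ x₂ : Eu n} (hx₁ : x₁ ∈ Q.X) (hx₂ : x₂ ∈ Q.X) (g₁ g₂ : Eu n) :
    ‖projPoint Q.X Q.h Q.ω Q.dω γ x₁ g₁ - projPoint Q.X Q.h Q.ω Q.dω γ x₂ g₂‖ ≤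
      γ / α * ‖(g₁ - (1 / γ) • Q.dω x₁) - (g₂ - (1 / γ) • Q.dω x₂)‖ :=
  IsProj.norm_sub_le hQ.convex_X hQ.convex_h hQ.distGen hα hγ (hQ.isProj_projPoint hγ hx₁ g₁)
    (hQ.isProj_projPoint hγ hx₂ g₂)

/-- The projection onto `X` as a function of `g - ∇ω(x)/γ` alone. -/
theorem exists_continuous_projPoint_eq (hQ : Q.Assumptions L α σ M) (hα : 0 < α) {γ : ℝ}
    (hγ : 0 < γ) (hne : Q.X.Nonempty) :
    ∃ T : Eu n → Eu n, Continuous T ∧ (∀ y, T y ∈ Q.X) ∧ Continuous (fun y => Q.h (T y)) ∧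
      ∀ x ∈ Q.X, ∀ g, projPoint Q.X Q.h Q.ω Q.dω γ x g = T (g - (1 / γ) • Q.dω x) := by
  obtain ⟨x₀, hx₀⟩ := hne
  -- V(u, x) depends on u only through ω(u) - ⟨∇ω(x), u⟩, so the minimizer depends on (x, g) only
  -- through g - ∇ω(x)/γ. Fixing the base point x₀ therefore loses nothing.
  set T : Eu n → Eu n := fun y => projPoint Q.X Q.h Q.ω Q.dω γ x₀ (y + (1 / γ) • Q.dω x₀) with hT
  have hTX : ∀ y, T y ∈ Q.X := fun y => (hQ.isProj_projPoint hγ hx₀ _).1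
  have hTc : Continuous T := by
    refine LipschitzWith.continuous (K := (γ / α).toNNReal) (LipschitzWith.of_dist_le_mul ?_)
    intro y z
    rw [dist_eq_norm, dist_eq_norm, Real.coe_toNNReal _ (by positivity)]
    simpa [hT] using hQ.norm_projPoint_sub_le hα hγ hx₀ hx₀ (y + (1 / γ) • Q.dω x₀)
      (z + (1 / γ) • Q.dω x₀)
  have hωT : Continuous fun y => Q.ω (T y) :=
    hQ.distGen.continuousOn.comp_continuous hTc hTX
  -- `h` may be discontinuous on the boundary of X, so continuity of `h ∘ T` is not a composition.
  -- It is read off from the optimal value `q`, whose continuity follows from comparing minimizers.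
  set q : Eu n → ℝ := fun y => ⟪y, T y⟫ + 1 / γ * Q.ω (T y) + Q.h (T y) with hq
  -- `T z` is admissible in the problem for y. Used with y and z exchanged as well, this squeezes
  -- `q` between functions continuous at the given point.
  have hmin : ∀ y z, q y ≤ q z + ⟪y - z, T z⟫ := by
    intro y z
    have := (hQ.isProj_projPoint hγ hx₀ (y + (1 / γ) • Q.dω x₀)).2 (hTX z)
    change projObjective Q.h Q.ω Q.dω γ x₀ (y + (1 / γ) • Q.dω x₀) (T y) ≤ _ at this
    simp only [projObjective, prox, inner_add_left, inner_sub_right, inner_smul_left,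
      conj_trivial] at this
    simp only [hq, inner_sub_left]
    linarith
  have hqc : Continuous q := by
    rw [continuous_iff_continuousAt]
    intro y
    have l1 : Filter.Tendsto (fun z => q y - ⟪y - z, T z⟫) (nhds y) (nhds (q y)) := by
      have : Continuous fun z => q y - ⟪y - z, T z⟫ := by fun_prop
      simpa using this.tendsto y
    have l2 : Filter.Tendsto (fun z => q y + ⟪z - y, T y⟫) (nhds y) (nhds (q y)) := by
      have : Continuous fun z => q y + ⟪z - y, T y⟫ := by fun_prop
      simpa using this.tendsto y
    exact tendsto_of_tendsto_of_tendsto_of_le_of_le l1 l2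
      (fun z => by have := hmin y z; simp only; linarith) (fun z => hmin z y)
  refine ⟨T, hTc, hTX, ?_, fun x hx g => ?_⟩
  · have : (fun y => Q.h (T y)) = fun y => q y - ⟪y, T y⟫ - 1 / γ * Q.ω (T y) := by
      ext y; simp only [hq]; ring
    rw [this]
    fun_prop
  · have := hQ.norm_projPoint_sub_le hα hγ hx hx₀ g (g - (1 / γ) • Q.dω x + (1 / γ) • Q.dω x₀)
    simp only [add_sub_cancel_right, sub_self, norm_zero, mul_zero] at this
    exact sub_eq_zero.1 (norm_le_zero_iff.1 this)

/-! ### Smoothness and one-step inequalities -/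

theorem f_le_of_mem (hQ : Q.Assumptions L α σ M) {x y : Eu n} (hx : x ∈ Q.X) (hy : y ∈ Q.X) :
    Q.f y ≤ Q.f x + ⟪gradient Q.f x, y - x⟫ + L / 2 * ‖y - x‖ ^ 2 :=
  le_of_lipschitz_gradient hQ.convex_X
    (fun z hz => (hQ.diff_f z hz).hasGradientAt.hasFDerivAt.hasFDerivWithinAt) hQ.lipschitz_f hx hy

/-- With γ = α/(2L) the projection gains 2L‖x - p‖². Smoothness of f spends L/2 of the coefficient,
Young's inequality for the gradient error another L/2, and L remains. -/
theorem normSq_sub_projPoint_le (hQ : Q.Assumptions L α σ M) (hL : 0 < L) (hα : 0 < α)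
    {x : Eu n} (hx : x ∈ Q.X) (g : Eu n) :
    L * ‖x - projPoint Q.X Q.h Q.ω Q.dω (α / (2 * L)) x g‖ ^ 2 ≤
      Q.Psi x - Q.Psi (projPoint Q.X Q.h Q.ω Q.dω (α / (2 * L)) x g) +
        ‖g - gradient Q.f x‖ ^ 2 / (2 * L) := by
  have hγ : 0 < α / (2 * L) := by positivity
  have hp := hQ.isProj_projPoint hγ hx g
  set p := projPoint Q.X Q.h Q.ω Q.dω (α / (2 * L)) x g
  have h1 := hp.norm_sq_le hQ.convex_X hQ.convex_h hQ.distGen hγ hx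
  have h2 := hQ.f_le_of_mem hx hp.1
  have e1 : α / (α / (2 * L)) = 2 * L := by field_simp
  rw [e1] at h1
  have h3 := young_inner hL (g - gradient Q.f x) (x - p)
  have e2 : ⟪gradient Q.f x, p - x⟫ = -⟪gradient Q.f x, x - p⟫ := by
    rw [← inner_neg_right, neg_sub]
  rw [inner_sub_left] at h3
  rw [norm_sub_rev p x, e2] at h2
  unfold Psi
  linarith

/-- Replacing the estimate by the exact gradient moves the projection point by at most ‖g -
∇f(x)‖/(2L). The error coefficient 6/L is 4/L from the descent estimate plus 2/L from this
displacement. -/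
theorem normSq_gX_le (hQ : Q.Assumptions L α σ M) (hL : 0 < L) (hα : 0 < α)
    {x : Eu n} (hx : x ∈ Q.X) (g : Eu n) :
    α ^ 2 / L * ‖Q.gX (α / (2 * L)) x‖ ^ 2 ≤
      8 * (Q.Psi x - Q.Psi (projPoint Q.X Q.h Q.ω Q.dω (α / (2 * L)) x g)) +
        6 / L * ‖g - gradient Q.f x‖ ^ 2 := by
  have hγ : 0 < α / (2 * L) := by positivity
  have h1 := hQ.normSq_sub_projPoint_le hL hα hx g
  have h2 := hQ.norm_projPoint_sub_le hα hγ hx hx g (gradient Q.f x)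
  set p := projPoint Q.X Q.h Q.ω Q.dω (α / (2 * L)) x g
  rw [gX, projGrad]
  set p' := projPoint Q.X Q.h Q.ω Q.dω (α / (2 * L)) x (gradient Q.f x)
  rw [sub_sub_sub_cancel_right, div_div_cancel_left' hα.ne'] at h2
  set δ := ‖g - gradient Q.f x‖
  have h3 : ‖x - p'‖ ≤ ‖x - p‖ + (2 * L)⁻¹ * δ := by
    calc ‖x - p'‖ = ‖(x - p) + (p - p')‖ := by congr 1; abel
      _ ≤ _ := (norm_add_le _ _).trans (by linarith)
  have h4 : ‖x - p'‖ ^ 2 ≤ 2 * ‖x - p‖ ^ 2 + 2 * ((2 * L)⁻¹ * δ) ^ 2 :=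
    (pow_le_pow_left₀ (norm_nonneg _) h3 2).trans
      (by nlinarith [sq_nonneg (‖x - p‖ - (2 * L)⁻¹ * δ)])
  rw [norm_smul, mul_pow, Real.norm_of_nonneg (by positivity)]
  calc α ^ 2 / L * ((1 / (α / (2 * L))) ^ 2 * ‖x - p'‖ ^ 2) = 4 * L * ‖x - p'‖ ^ 2 := by
        field_simp; ring
    _ ≤ 4 * L * (2 * ‖x - p‖ ^ 2 + 2 * ((2 * L)⁻¹ * δ) ^ 2) := by gcongr
    _ = 8 * (L * ‖x - p‖ ^ 2) + 2 / L * δ ^ 2 := by field_simp; ring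
    _ ≤ 8 * (Q.Psi x - Q.Psi p + δ ^ 2 / (2 * L)) + 2 / L * δ ^ 2 := by gcongr
    _ = _ := by field_simp; ring

/-- The term -V(p, x) of the three-point inequality contributes -L‖p - x‖², exactly what the
smoothness of f and Young's inequality consume. The vector b is free so that it can be the gradient
of the smoothed function, for which g - b has conditional mean zero. -/
theorem Psi_projPoint_sub_le (hQ : Q.Assumptions L α σ M) (hL : 0 < L) (hα : 0 < α)
    {x u : Eu n} (hx : x ∈ Q.X) (hu : u ∈ Q.X) (g b : Eu n) {ε : ℝ}
    (hb : Q.f x - Q.f u ≤ ⟪b, x - u⟫ + ε) :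
    Q.Psi (projPoint Q.X Q.h Q.ω Q.dω (α / (2 * L)) x g) - Q.Psi u ≤
      ε + ⟪g - b, u - x⟫ + ‖g - gradient Q.f x‖ ^ 2 / (2 * L) +
        2 * L / α * (Q.V u x - Q.V u (projPoint Q.X Q.h Q.ω Q.dω (α / (2 * L)) x g)) := by
  have hγ : 0 < α / (2 * L) := by positivity
  have hp := hQ.isProj_projPoint hγ hx g
  set p := projPoint Q.X Q.h Q.ω Q.dω (α / (2 * L)) x g
  have h1 := hp.three_point hQ.convex_X hQ.convex_h hQ.distGen hu
  have h2 := hQ.f_le_of_mem hx hp.1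
  have h3 := young_inner hL (g - gradient Q.f x) (x - p)
  have h4 := hQ.distGen.le_prox hQ.convex_X hp.1 hx
  have e1 : 1 / (α / (2 * L)) = 2 * L / α := by field_simp
  rw [e1] at h1
  have h5 : 2 * L / α * (α / 2 * ‖p - x‖ ^ 2) ≤ 2 * L / α * prox Q.ω Q.dω p x := by gcongr
  have e2 : 2 * L / α * (α / 2 * ‖p - x‖ ^ 2) = L * ‖p - x‖ ^ 2 := by field_simp
  rw [e2, norm_sub_rev p x] at h5
  rw [norm_sub_rev p x] at h2
  simp only [inner_sub_left, inner_sub_right] at *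
  unfold Psi V
  linarith

end Problem.Assumptions

end RSPGF

namespace RSPGF

variable {n : ℕ}

/-! ### The oracle and Gaussian smoothing -/

theorem integral_normSq_sub_integral {S : Type*} [MeasurableSpace S] {ρ : Measure S}
    [IsProbabilityMeasure ρ] {Y : S → Eu n} (hY : MemLp Y 2 ρ) :
    ∫ s, ‖Y s - ∫ t, Y t ∂ρ‖ ^ 2 ∂ρ = ∫ s, ‖Y s‖ ^ 2 ∂ρ - ‖∫ t, Y t ∂ρ‖ ^ 2 := by
  set c := ∫ t, Y t ∂ρ with hc
  have i1 : Integrable Y ρ := hY.integrable (by norm_num)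
  have i2 : Integrable (fun s => ‖Y s‖ ^ 2) ρ := hY.integrable_norm_pow (by norm_num)
  have i3 : Integrable (fun s => ⟪c, Y s⟫) ρ := i1.const_inner c
  have i4 : Integrable (fun s => ‖Y s‖ ^ 2 - 2 * ⟪c, Y s⟫) ρ := i2.sub (i3.const_mul 2)
  have e : ∀ s, ‖Y s - c‖ ^ 2 = ‖Y s‖ ^ 2 - 2 * ⟪c, Y s⟫ + ‖c‖ ^ 2 := by
    intro s; rw [norm_sub_sq_real, real_inner_comm]
  simp only [e]
  rw [integral_add i4 (integrable_const _),
    integral_sub i2 (i3.const_mul 2), integral_const_mul, integral_inner i1, ← hc,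
    real_inner_self_eq_norm_sq]
  simp
  ring

theorem hasGradientAt_of_abs_sub_le {φ : Eu n → ℝ} {x g : Eu n} {C : ℝ}
    (h : ∀ y, |φ y - φ x - ⟪g, y - x⟫| ≤ C * ‖y - x‖ ^ 2) : HasGradientAt φ g x := by
  rw [hasGradientAt_iff_hasFDerivAt, hasFDerivAt_iff_isLittleO]
  refine Asymptotics.IsBigO.trans_isLittleO ?_ (Asymptotics.isLittleO_pow_sub_sub x one_lt_two)
  refine Asymptotics.IsBigO.of_bound C (Filter.Eventually.of_forall fun y => ?_)
  simpa using h y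

theorem HasGradientAt.inner_le_of_convexOn {φ : Eu n → ℝ} {x g : Eu n}
    (hφ : ConvexOn ℝ Set.univ φ) (h : HasGradientAt φ g x) (y : Eu n) :
    φ x + ⟪g, y - x⟫ ≤ φ y := by
  have h1 : HasDerivAt (fun t : ℝ => x + t • (y - x)) (y - x) 0 := by
    have := ((hasDerivAt_id (0 : ℝ)).smul_const (y - x)).const_add x
    simpa using this
  have h2 : HasDerivAt (fun t : ℝ => φ (x + t • (y - x))) ⟪g, y - x⟫ 0 := by
    have h' : HasFDerivAt φ (InnerProductSpace.toDual ℝ (Eu n) g) (x + (0 : ℝ) • (y - x)) := by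
      simpa using! h.hasFDerivAt
    exact HasDerivAt.congr_deriv (f := fun t : ℝ => φ (x + t • (y - x)))
      (h'.comp_hasDerivAt 0 h1) (by simp)
  have h3 := h2.hasDerivWithinAt (s := Set.Ioc 0 1)
  rw [hasDerivWithinAt_iff_tendsto_slope, Set.sdiff_singleton_eq_self (by simp)] at h3
  have : (nhdsWithin (0 : ℝ) (Set.Ioc 0 1)).NeBot := left_nhdsWithin_Ioc_neBot zero_lt_one
  have h4 : ⟪g, y - x⟫ ≤ φ y - φ x := by
    refine le_of_tendsto h3 ?_
    filter_upwards [self_mem_nhdsWithin] with t ht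
    have h5 : φ (x + t • (y - x)) ≤ (1 - t) * φ x + t * φ y := by
      have := hφ.2 (Set.mem_univ x) (Set.mem_univ y) (sub_nonneg.2 ht.2) ht.1.le (by ring)
      rw [smul_eq_mul, smul_eq_mul] at this
      have e : x + t • (y - x) = (1 - t) • x + t • y := by module
      rwa [e]
    rw [slope_def_field, sub_zero, div_le_iff₀ ht.1]
    simp only [zero_smul, add_zero]
    linarith
  linarith

/-- The expectation of the Gaussian gradient estimator, `∇f_μ(x)`. -/
noncomputable def smoothGrad (f : Eu n → ℝ) (μ : ℝ) (x : Eu n) : Eu n :=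
  ∫ w, ((f (x + μ • w) - f x) / μ) • w ∂(stdGaussian (Eu n))

/-- The second moment bound of the Gaussian gradient estimator. -/
noncomputable def secondMoment (n : ℕ) (L M σ μ : ℝ) : ℝ :=
  2 * (n + 2) * (M ^ 2 + σ ^ 2) + μ ^ 2 * L ^ 2 * (n * (n + 2) * (n + 4)) / 2

namespace Problem.Assumptions

variable {Ξ : Type*} [MeasurableSpace Ξ] {Q : Problem n Ξ} {L α σ M : ℝ}

/-- The quadratic remainder estimate holds for almost every realization and survives integration, by
unbiasedness of values and gradient. Only the base point has to lie in X, which is what allows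
Gaussian displacements leaving X. -/
theorem abs_f_sub_le (hQ : Q.Assumptions L α σ M) {x : Eu n} (hx : x ∈ Q.X) (y : Eu n) :
    |Q.f y - Q.f x - ⟪gradient Q.f x, y - x⟫| ≤ L / 2 * ‖y - x‖ ^ 2 := by
  have := hQ.noise_prob 1 le_rfl x hx
  obtain ⟨iy, ey⟩ := hQ.unbiased_F 1 le_rfl x hx y
  obtain ⟨ix, ex⟩ := hQ.unbiased_F 1 le_rfl x hx x
  have iG : Integrable (Q.G x) (Q.noise 1 x) := (hQ.memLp_G 1 le_rfl x hx).integrable (by norm_num)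
  have e : ∫ s, (Q.F y s - Q.F x s - ⟪y - x, Q.G x s⟫) ∂(Q.noise 1 x) =
      Q.f y - Q.f x - ⟪gradient Q.f x, y - x⟫ := by
    have i2 : Integrable (fun s => Q.F y s - Q.F x s) (Q.noise 1 x) := iy.sub ix
    rw [integral_sub i2 (iG.const_inner _), integral_sub iy ix, ey, ex,
      integral_inner iG, hQ.unbiased_G 1 le_rfl x hx, real_inner_comm]
  rw [← e]
  have := norm_integral_le_of_norm_le_const (μ := Q.noise 1 x)
    (f := fun s => Q.F y s - Q.F x s - ⟪y - x, Q.G x s⟫) (C := L / 2 * ‖y - x‖ ^ 2) (by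
      filter_upwards [hQ.smooth_F 1 le_rfl x hx] with s hs
      rw [real_inner_comm]
      exact hs.abs_sub_le x y)
  simpa using this

/-- The integrability hypothesis on the oracle gradient covers only the point at which the noise law
is taken. At other points measurability is recovered coordinatewise, from limits of difference
quotients. -/
theorem aestronglyMeasurable_G (hQ : Q.Assumptions L α σ M) {x : Eu n} (hx : x ∈ Q.X)
    (y : Eu n) : AEStronglyMeasurable (Q.G y) (Q.noise 1 x) := by
  have hF : ∀ z, Measurable (Q.F z) := fun z =>
    hQ.measurable_F.comp (measurable_const.prodMk measurable_id)
  have hc : ∀ i, AEStronglyMeasurable (fun s => Q.G y s i) (Q.noise 1 x) := by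
    intro i
    let e : Eu n := EuclideanSpace.single i 1
    refine aestronglyMeasurable_of_tendsto_ae Filter.atTop
      (f := fun (m : ℕ) s => ((1 : ℝ) / (m + 1))⁻¹ *
        (Q.F (y + ((1 : ℝ) / (m + 1)) • e) s - Q.F y s))
      (fun m => (((hF _).sub (hF _)).const_mul _).aestronglyMeasurable) ?_
    filter_upwards [hQ.smooth_F 1 le_rfl x hx] with s hs
    have h1 : HasDerivAt (fun t : ℝ => y + t • e) e 0 := by
      have := ((hasDerivAt_id (0 : ℝ)).smul_const e).const_add y
      simpa using this
    have h2 : HasDerivAt (fun t : ℝ => Q.F (y + t • e) s) (Q.G y s i) 0 := by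
      have h' : HasFDerivAt (fun z => Q.F z s) (InnerProductSpace.toDual ℝ (Eu n) (Q.G y s))
          (y + (0 : ℝ) • e) := by
        rw [zero_smul, add_zero]
        exact (hs.1 y).hasGradientAt.hasFDerivAt
      have h'' := h'.comp_hasDerivAt 0 h1
      rw [InnerProductSpace.toDual_apply_apply] at h''
      exact HasDerivAt.congr_deriv (f := fun t : ℝ => Q.F (y + t • e) s) h''
        (by simp [e, EuclideanSpace.inner_single_right])
    have h3 := h2.tendsto_slope_zero
    have h4 : Filter.Tendsto (fun m : ℕ => (1 : ℝ) / (m + 1)) Filter.atTop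
        (nhdsWithin 0 {0}ᶜ) :=
      tendsto_nhdsWithin_iff.2 ⟨tendsto_one_div_add_atTop_nhds_zero_nat,
        Filter.Eventually.of_forall fun m => by
          simp only [Set.mem_compl_iff, Set.mem_singleton_iff]; positivity⟩
    simpa [Function.comp_def] using! h3.comp h4
  have : Q.G y = fun s => ∑ i, Q.G y s i • (EuclideanSpace.single i (1 : ℝ) : Eu n) := by
    ext s j
    simp [Pi.single_apply]
  rw [this]
  exact Finset.aestronglyMeasurable_fun_sum _ fun i _ => (hc i).smul_const _

/-- Since `f(y) = E[F(y, ξ)]` for all `y`, the function `f` is of class `C_L^{1,1}(ℝⁿ)`. -/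
theorem exists_gradient_f (hQ : Q.Assumptions L α σ M) (hne : Q.X.Nonempty) :
    ∃ Gf : Eu n → Eu n, (∀ y, HasGradientAt Q.f (Gf y) y) ∧
      ∀ y z, ‖Gf z - Gf y‖ ≤ L * ‖z - y‖ := by
  obtain ⟨x, hx⟩ := hne
  have := hQ.noise_prob 1 le_rfl x hx
  have iG : Integrable (Q.G x) (Q.noise 1 x) := (hQ.memLp_G 1 le_rfl x hx).integrable (by norm_num)
  have hs := hQ.smooth_F 1 le_rfl x hx
  have iG' : ∀ y, Integrable (Q.G y) (Q.noise 1 x) := by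
    intro y
    -- The Lipschitz bound transfers integrability of the oracle gradient from x to every y, so the
    -- expected gradient is available as the candidate for ∇f on the whole space.
    refine (iG.norm.add (integrable_const (L * ‖y - x‖))).mono' (hQ.aestronglyMeasurable_G hx y) ?_
    filter_upwards [hs] with s hs
    have := norm_le_insert' (Q.G y s) (Q.G x s)
    have h2 := hs.2 x y
    simp only [Pi.add_apply]
    exact this.trans (add_le_add_right h2 _)
  refine ⟨fun y => ∫ s, Q.G y s ∂(Q.noise 1 x), fun y => ?_, fun y z => ?_⟩
  · refine hasGradientAt_of_abs_sub_le (C := L / 2) fun z => ?_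
    obtain ⟨iy, ey⟩ := hQ.unbiased_F 1 le_rfl x hx y
    obtain ⟨iz, ez⟩ := hQ.unbiased_F 1 le_rfl x hx z
    have e : ∫ s, (Q.F z s - Q.F y s - ⟪z - y, Q.G y s⟫) ∂(Q.noise 1 x) =
        Q.f z - Q.f y - ⟪∫ s, Q.G y s ∂(Q.noise 1 x), z - y⟫ := by
      have i2 : Integrable (fun s => Q.F z s - Q.F y s) (Q.noise 1 x) := iz.sub iy
      rw [integral_sub i2 ((iG' y).const_inner _), integral_sub iz iy, ey, ez,
        integral_inner (iG' y), real_inner_comm]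
    rw [← e]
    have := norm_integral_le_of_norm_le_const (μ := Q.noise 1 x)
      (f := fun s => Q.F z s - Q.F y s - ⟪z - y, Q.G y s⟫) (C := L / 2 * ‖z - y‖ ^ 2) (by
        filter_upwards [hs] with s hs
        rw [real_inner_comm]
        exact hs.abs_sub_le y z)
    simpa using this
  · rw [← integral_sub (iG' z) (iG' y)]
    have := norm_integral_le_of_norm_le_const (μ := Q.noise 1 x)
      (f := fun s => Q.G z s - Q.G y s) (C := L * ‖z - y‖) (by
        filter_upwards [hs] with s hs
        exact hs.2 y z)
    simpa using this

theorem continuous_f (hQ : Q.Assumptions L α σ M) (hne : Q.X.Nonempty) : Continuous Q.f := by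
  obtain ⟨Gf, h, -⟩ := hQ.exists_gradient_f hne
  exact continuous_iff_continuousAt.2 fun y => (h y).hasFDerivAt.continuousAt

/-! ### Difference quotients and the bias of Gaussian smoothing -/

theorem abs_div_sub_le (hQ : Q.Assumptions L α σ M) {x : Eu n} (hx : x ∈ Q.X) {μ : ℝ}
    (hμ : 0 < μ) (w : Eu n) :
    |(Q.f (x + μ • w) - Q.f x) / μ - ⟪gradient Q.f x, w⟫| ≤ L * μ / 2 * ‖w‖ ^ 2 := by
  have h := hQ.abs_f_sub_le hx (x + μ • w)
  rw [add_sub_cancel_left, inner_smul_right, norm_smul, Real.norm_of_nonneg hμ.le] at h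
  have e : (Q.f (x + μ • w) - Q.f x) / μ - ⟪gradient Q.f x, w⟫ =
      (Q.f (x + μ • w) - Q.f x - μ * ⟪gradient Q.f x, w⟫) / μ := by field_simp
  rw [e, abs_div, abs_of_pos hμ, div_le_iff₀ hμ]
  calc _ ≤ _ := h
    _ = _ := by ring

theorem abs_div_le (hQ : Q.Assumptions L α σ M) (hL : 0 < L) {x : Eu n} (hx : x ∈ Q.X) {μ : ℝ}
    (hμ : 0 < μ) (w : Eu n) :
    |(Q.f (x + μ • w) - Q.f x) / μ| ≤ (‖gradient Q.f x‖ + L * μ / 2) * (‖w‖ + ‖w‖ ^ 2) := by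
  have h1 := hQ.abs_div_sub_le hx hμ w
  have h2 := abs_real_inner_le_norm (gradient Q.f x) w
  have h3 := abs_sub_abs_le_abs_sub ((Q.f (x + μ • w) - Q.f x) / μ) ⟪gradient Q.f x, w⟫
  have h4 : 0 ≤ ‖gradient Q.f x‖ * ‖w‖ ^ 2 := by positivity
  have h5 : 0 ≤ L * μ / 2 * ‖w‖ := by positivity
  nlinarith

theorem add_sq_le_growth {t : ℝ} (ht : 0 ≤ t) : t + t ^ 2 ≤ 2 * (1 + t ^ 3) := by
  nlinarith [mul_nonneg ht (sq_nonneg (t - 1)), sq_nonneg (t - 1), mul_nonneg ht ht]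

theorem integrable_div (hQ : Q.Assumptions L α σ M) (hL : 0 < L) {x : Eu n} (hx : x ∈ Q.X)
    {μ : ℝ} (hμ : 0 < μ) :
    Integrable (fun w => (Q.f (x + μ • w) - Q.f x) / μ) (stdGaussian (Eu n)) := by
  have hc := hQ.continuous_f ⟨x, hx⟩
  refine integrable_stdGaussian_of_growth (by fun_prop)
    (C := (‖gradient Q.f x‖ + L * μ / 2) * 2) (p := 3) fun w => ?_
  refine (hQ.abs_div_le hL hx hμ w).trans ?_
  rw [mul_assoc]
  exact mul_le_mul_of_nonneg_left (add_sq_le_growth (norm_nonneg w)) (by positivity)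

theorem integrable_div_smul (hQ : Q.Assumptions L α σ M) (hL : 0 < L) {x : Eu n} (hx : x ∈ Q.X)
    {μ : ℝ} (hμ : 0 < μ) :
    Integrable (fun w => ((Q.f (x + μ • w) - Q.f x) / μ) • w) (stdGaussian (Eu n)) := by
  have hc := hQ.continuous_f ⟨x, hx⟩
  refine integrable_stdGaussian_of_growth (by fun_prop)
    (C := (‖gradient Q.f x‖ + L * μ / 2) * 2) (p := 3) fun w => ?_
  rw [norm_smul, Real.norm_eq_abs]
  calc _ ≤ (‖gradient Q.f x‖ + L * μ / 2) * (‖w‖ + ‖w‖ ^ 2) * ‖w‖ := by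
        gcongr; exact hQ.abs_div_le hL hx hμ w
    _ = (‖gradient Q.f x‖ + L * μ / 2) * ((‖w‖ + ‖w‖ ^ 2) * ‖w‖) := by ring
    _ ≤ (‖gradient Q.f x‖ + L * μ / 2) * (2 * (1 + ‖w‖ ^ 3)) := by
        refine mul_le_mul_of_nonneg_left ?_ (by positivity)
        nlinarith [mul_nonneg (norm_nonneg w) (sq_nonneg (‖w‖ - 1)), sq_nonneg (‖w‖ - 1),
          norm_nonneg w]
    _ = _ := by ring

theorem integral_inner_mul_inner_stdGaussian (a b : Eu n) :
    ∫ w, ⟪a, w⟫ * ⟪b, w⟫ ∂(stdGaussian (Eu n)) = ⟪a, b⟫ := by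
  have i : ∀ a : Eu n, Integrable (fun w : Eu n => ⟪a, w⟫ ^ 2) (stdGaussian (Eu n)) := fun a => by
    simpa using integrable_inner_sq_mul_normSq_pow_stdGaussian a 0
  have e : ∀ w : Eu n, ⟪a, w⟫ * ⟪b, w⟫ = (⟪a + b, w⟫ ^ 2 - ⟪a - b, w⟫ ^ 2) / 4 := by
    intro w; rw [inner_add_left, inner_sub_left]; ring
  simp only [e]
  rw [integral_div, integral_sub (i _) (i _), integral_inner_sq_stdGaussian,
    integral_inner_sq_stdGaussian, norm_add_sq_real, norm_sub_sq_real]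
  ring

theorem integrable_inner_mul_inner (a b : Eu n) :
    Integrable (fun w : Eu n => ⟪a, w⟫ * ⟪b, w⟫) (stdGaussian (Eu n)) :=
  integrable_stdGaussian_of_growth (by fun_prop) (C := ‖a‖ * ‖b‖) (p := 2) fun w => by
    rw [norm_mul]
    calc ‖⟪a, w⟫‖ * ‖⟪b, w⟫‖ ≤ (‖a‖ * ‖w‖) * (‖b‖ * ‖w‖) := by
          gcongr <;> exact abs_real_inner_le_norm _ _
      _ = ‖a‖ * ‖b‖ * ‖w‖ ^ 2 := by ring
      _ ≤ _ := by gcongr; linarith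

/-- Let b be the bias and r(w) the remainder of the difference quotient, |r(w)| ≤ Lμ‖w‖²/2. Since
E⟨∇f(x),w⟩w = ∇f(x), one has ‖b‖² = E r(w)⟨b,w⟩. Young's inequality bounds this by half of E r² plus
half of E⟨b,w⟩² = ‖b‖²; the latter is absorbed and E‖w‖⁴ gives the constant. -/
theorem normSq_smoothGrad_sub_le (hQ : Q.Assumptions L α σ M) (hL : 0 < L) {x : Eu n}
    (hx : x ∈ Q.X) {μ : ℝ} (hμ : 0 < μ) :
    ‖smoothGrad Q.f μ x - gradient Q.f x‖ ^ 2 ≤ μ ^ 2 * L ^ 2 * (n * (n + 2)) / 4 := by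
  set b := smoothGrad Q.f μ x - gradient Q.f x with hb
  let r : Eu n → ℝ := fun w => (Q.f (x + μ • w) - Q.f x) / μ - ⟪gradient Q.f x, w⟫
  have i1 : Integrable (fun w => ((Q.f (x + μ • w) - Q.f x) / μ) * ⟪b, w⟫)
      (stdGaussian (Eu n)) := by
    refine ((hQ.integrable_div_smul hL hx hμ).const_inner b).congr (ae_of_all _ fun w => ?_)
    simp only [inner_smul_right]
  have i2 := integrable_inner_mul_inner (gradient Q.f x) b
  have e1 : ∫ w, r w * ⟪b, w⟫ ∂(stdGaussian (Eu n)) = ‖b‖ ^ 2 := by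
    simp only [r, sub_mul]
    rw [integral_sub i1 i2, integral_inner_mul_inner_stdGaussian, ← real_inner_self_eq_norm_sq]
    conv_rhs => rw [hb, inner_sub_left, ← hb, smoothGrad]
    rw [real_inner_comm b (∫ w, _ ∂(stdGaussian (Eu n))),
      ← integral_inner (hQ.integrable_div_smul hL hx hμ)]
    simp only [inner_smul_right]
  have i4 : Integrable (fun w : Eu n => (‖w‖ ^ 2) ^ 2) (stdGaussian (Eu n)) :=
    integrable_stdGaussian_of_growth (by fun_prop) (C := 1) (p := 4) fun w => by
      rw [Real.norm_of_nonneg (by positivity)]; ring_nf; linarith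
  have i5 : Integrable (fun w : Eu n => ⟪b, w⟫ ^ 2) (stdGaussian (Eu n)) := by
    simpa using integrable_inner_sq_mul_normSq_pow_stdGaussian b 0
  have h1 : ∫ w, r w * ⟪b, w⟫ ∂(stdGaussian (Eu n)) ≤
      ∫ w, ((L * μ / 2) ^ 2 / 2 * (‖w‖ ^ 2) ^ 2 + 1 / 2 * ⟪b, w⟫ ^ 2) ∂(stdGaussian (Eu n)) := by
    refine integral_mono ((i1.sub i2).congr (ae_of_all _ fun w => by simp [r, sub_mul]))
      ((i4.const_mul _).add (i5.const_mul _)) fun w => ?_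
    have h := hQ.abs_div_sub_le hx hμ w
    have h' : r w ^ 2 ≤ (L * μ / 2 * ‖w‖ ^ 2) ^ 2 := by
      rw [← sq_abs]; exact pow_le_pow_left₀ (abs_nonneg _) h 2
    simp only
    nlinarith [sq_nonneg (r w - ⟪b, w⟫)]
  rw [integral_add (i4.const_mul _) (i5.const_mul _), integral_const_mul, integral_const_mul,
    integral_norm_pow_four_stdGaussian, integral_inner_sq_stdGaussian, e1] at h1
  linarith

/-- First-order characterization of the convexity of the smoothed function. -/
theorem f_sub_le_inner_smoothGrad (hQ : Q.Assumptions L α σ M) (hL : 0 < L)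
    (hf : ConvexOn ℝ Set.univ Q.f) {x u : Eu n} (hx : x ∈ Q.X) (hu : u ∈ Q.X) {μ : ℝ}
    (hμ : 0 < μ) :
    Q.f x - Q.f u ≤ ⟪smoothGrad Q.f μ x, x - u⟫ + μ ^ 2 * L * n / 2 := by
  obtain ⟨Gf, hG, hGL⟩ := hQ.exists_gradient_f ⟨x, hx⟩
  have hc := hQ.continuous_f ⟨x, hx⟩
  have hGc : Continuous Gf :=
    (LipschitzWith.of_dist_le_mul (K := L.toNNReal) fun y z => by
      rw [dist_eq_norm, dist_eq_norm, Real.coe_toNNReal _ hL.le]; exact hGL z y).continuous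
  have hg : ∀ w, HasGradientAt (fun w => (Q.f (x + μ • w) - Q.f x) / μ) (Gf (x + μ • w)) w := by
    intro w
    have h1 : HasFDerivAt (fun w : Eu n => x + μ • w) (μ • ContinuousLinearMap.id ℝ (Eu n)) w :=
      ((hasFDerivAt_id w).const_smul μ).const_add x
    have h2 := (((hG (x + μ • w)).hasFDerivAt.comp w h1).sub_const (Q.f x)).const_mul (μ⁻¹)
    rw [hasGradientAt_iff_hasFDerivAt]
    refine (h2.congr_fderiv ?_).congr_of_eventuallyEq
      (Filter.Eventually.of_forall fun w => ?_)
    · ext y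
      simp [hμ.ne']
    · simp only [Function.comp_apply]
      ring
  have iG : Integrable (fun w => Gf (x + μ • w)) (stdGaussian (Eu n)) :=
    integrable_stdGaussian_of_growth (by fun_prop) (C := ‖Gf x‖ + L * μ) (p := 1) fun w => by
      have h1 := hGL x (x + μ • w)
      rw [add_sub_cancel_left, norm_smul, Real.norm_of_nonneg hμ.le] at h1
      have h2 := norm_le_insert' (Gf (x + μ • w)) (Gf x)
      nlinarith [norm_nonneg (Gf x), norm_nonneg w, mul_pos hL hμ,
        mul_nonneg (norm_nonneg (Gf x)) (norm_nonneg w)]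
  have iS := hQ.integrable_div_smul hL hx hμ
  -- Integration by parts identifies the mean of the estimator with E ∇f(x + μw), so pointwise
  -- first-order inequalities can be averaged.
  have key := integral_stdGaussian_mul_inner hg (hQ.integrable_div hL hx hμ) iS iG (u - x)
  have e1 : ⟪smoothGrad Q.f μ x, u - x⟫ =
      ∫ w, ((Q.f (x + μ • w) - Q.f x) / μ) * ⟪u - x, w⟫ ∂(stdGaussian (Eu n)) := by
    rw [smoothGrad, real_inner_comm, ← integral_inner iS]
    simp only [inner_smul_right]
  have i2 : Integrable (fun w : Eu n => ‖w‖ ^ 2) (stdGaussian (Eu n)) :=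
    integrable_stdGaussian_of_growth (by fun_prop) (C := 1) (p := 2) fun w => by
      rw [Real.norm_of_nonneg (by positivity)]; linarith
  have i1 : ∀ a : Eu n, Integrable (fun w : Eu n => ⟪a, w⟫) (stdGaussian (Eu n)) := fun a =>
    integrable_stdGaussian_of_growth (by fun_prop) (C := ‖a‖) (p := 1) fun w => by
      have := abs_real_inner_le_norm a w
      rw [Real.norm_eq_abs]; nlinarith [norm_nonneg a]
  have i0 : ∀ a : Eu n, ∫ w, ⟪a, w⟫ ∂(stdGaussian (Eu n)) = 0 := fun a => by
    have : Integrable (fun w : Eu n => w) (stdGaussian (Eu n)) := IsGaussian.integrable_id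
    rw [integral_inner this, integral_id_stdGaussian, inner_zero_right]
  have i3 : Integrable (fun w => μ * ⟪gradient Q.f u - gradient Q.f x, w⟫ +
      L / 2 * μ ^ 2 * ‖w‖ ^ 2) (stdGaussian (Eu n)) := ((i1 _).const_mul _).add (i2.const_mul _)
  have h2 : ∫ w, ⟪u - x, Gf (x + μ • w)⟫ ∂(stdGaussian (Eu n)) ≤
      ∫ w, ((Q.f u - Q.f x) + (μ * ⟪gradient Q.f u - gradient Q.f x, w⟫ +
        L / 2 * μ ^ 2 * ‖w‖ ^ 2)) ∂(stdGaussian (Eu n)) := by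
    refine integral_mono (iG.const_inner _)
      ((integrable_const _).add i3) fun w => ?_
    -- Convexity at x + μw towards u + μw, convexity at x, and smoothness at u. The terms linear in
    -- w have mean zero, so only Lμ²E‖w‖²/2 is left.
    have a1 := HasGradientAt.inner_le_of_convexOn hf (hG (x + μ • w)) (u + μ • w)
    have a2 := HasGradientAt.inner_le_of_convexOn hf (hQ.diff_f x hx).hasGradientAt (x + μ • w)
    have a3 := (abs_le.1 (hQ.abs_f_sub_le hu (u + μ • w))).2
    rw [add_sub_add_right_eq_sub] at a1
    rw [add_sub_cancel_left, inner_smul_right] at a2 a3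
    rw [norm_smul, Real.norm_of_nonneg hμ.le] at a3
    simp only [inner_sub_left] at *
    rw [real_inner_comm, real_inner_comm _ x, ← inner_sub_right]
    linarith
  rw [integral_add (integrable_const _) i3,
    integral_add ((i1 _).const_mul _) (i2.const_mul _), integral_const_mul, integral_const_mul, i0,
    integral_normSq_stdGaussian, ← key, ← e1] at h2
  have e2 : ⟪smoothGrad Q.f μ x, x - u⟫ = -⟪smoothGrad Q.f μ x, u - x⟫ := by
    rw [← inner_neg_right, neg_sub]
  simp at h2
  linarith

/-! ### Moments of the gradient estimator -/

theorem measurable_Gμ (hQ : Q.Assumptions L α σ M) (μ : ℝ) :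
    Measurable fun p : Eu n × (Ξ × Eu n) => Q.Gμ μ p.1 p.2.1 p.2.2 := by
  have h1 : Measurable fun p : Eu n × (Ξ × Eu n) => Q.F (p.1 + μ • p.2.2) p.2.1 :=
    hQ.measurable_F.comp
      (show Measurable fun p : Eu n × (Ξ × Eu n) => (p.1 + μ • p.2.2, p.2.1) by fun_prop)
  have h2 : Measurable fun p : Eu n × (Ξ × Eu n) => Q.F p.1 p.2.1 :=
    hQ.measurable_F.comp (show Measurable fun p : Eu n × (Ξ × Eu n) => (p.1, p.2.1) by fun_prop)
  exact ((h1.sub h2).div_const μ).smul (by fun_prop)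

theorem integral_normSq_G_le (hQ : Q.Assumptions L α σ M) {k : ℕ} (hk : 1 ≤ k) {x : Eu n}
    (hx : x ∈ Q.X) : ∫ s, ‖Q.G x s‖ ^ 2 ∂(Q.noise k x) ≤ M ^ 2 + σ ^ 2 := by
  have := hQ.noise_prob k hk x hx
  have h1 := integral_normSq_sub_integral (hQ.memLp_G k hk x hx)
  have h2 := hQ.variance_G k hk x hx
  rw [hQ.unbiased_G k hk x hx] at h1
  have h3 := pow_le_pow_left₀ (norm_nonneg _) (hQ.gradient_bound x hx) 2
  linarith

/-- From q² ≤ 2a² + 2(q - a)², with q the difference quotient and a the directional derivative of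
the realization. -/
theorem normSq_Gμ_le {μ : ℝ} (hμ : 0 < μ) {s : Ξ} (hs : IsC11 L fun y => Q.F y s)
    (x w : Eu n) :
    ‖Q.Gμ μ x s w‖ ^ 2 ≤
      2 * (⟪Q.G x s, w⟫ ^ 2 * ‖w‖ ^ 2) + (μ * L) ^ 2 / 2 * (‖w‖ ^ 2) ^ 3 := by
  have h := hs.abs_sub_le x (x + μ • w)
  rw [add_sub_cancel_left, inner_smul_right, norm_smul, Real.norm_of_nonneg hμ.le] at h
  change |Q.F (x + μ • w) s - Q.F x s - μ * ⟪Q.G x s, w⟫| ≤ _ at h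
  have e : (Q.F (x + μ • w) s - Q.F x s) / μ - ⟪Q.G x s, w⟫ =
      (Q.F (x + μ • w) s - Q.F x s - μ * ⟪Q.G x s, w⟫) / μ := by field_simp
  have h1 : |(Q.F (x + μ • w) s - Q.F x s) / μ - ⟪Q.G x s, w⟫| ≤ L * μ / 2 * ‖w‖ ^ 2 := by
    rw [e, abs_div, abs_of_pos hμ, div_le_iff₀ hμ]
    exact h.trans_eq (by ring)
  rw [Problem.Gμ, norm_smul, mul_pow, Real.norm_eq_abs, sq_abs]
  set q := (Q.F (x + μ • w) s - Q.F x s) / μ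
  set a := ⟪Q.G x s, w⟫
  have h2 : (q - a) ^ 2 ≤ (L * μ / 2 * ‖w‖ ^ 2) ^ 2 := by
    rw [← sq_abs]; exact pow_le_pow_left₀ (abs_nonneg _) h1 2
  have h3 : q ^ 2 ≤ 2 * a ^ 2 + (μ * L) ^ 2 / 2 * (‖w‖ ^ 2) ^ 2 := by
    nlinarith [sq_nonneg (q - 2 * a)]
  calc q ^ 2 * ‖w‖ ^ 2 ≤ (2 * a ^ 2 + (μ * L) ^ 2 / 2 * (‖w‖ ^ 2) ^ 2) * ‖w‖ ^ 2 := by gcongr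
    _ = _ := by ring

/-- For a fixed iterate, integrating out w leaves (n+2)‖G‖² from the main part and n(n+2)(n+4) from
the remainder. Integrating the noise instead, for fixed w, gives the mean. The centred second moment
is at most the raw one. -/
theorem Gμ_moments (hQ : Q.Assumptions L α σ M) {k : ℕ} (hk : 1 ≤ k)
    {x : Eu n} (hx : x ∈ Q.X) {μ : ℝ} (hμ : 0 < μ) :
    MemLp (fun p : Ξ × Eu n => Q.Gμ μ x p.1 p.2) 2 ((Q.noise k x).prod (stdGaussian (Eu n))) ∧
    ∫ p, Q.Gμ μ x p.1 p.2 ∂((Q.noise k x).prod (stdGaussian (Eu n))) = smoothGrad Q.f μ x ∧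
    ∫ p, ‖Q.Gμ μ x p.1 p.2 - smoothGrad Q.f μ x‖ ^ 2
      ∂((Q.noise k x).prod (stdGaussian (Eu n))) ≤ secondMoment n L M σ μ := by
  have := hQ.noise_prob k hk x hx
  have hx' : Measurable fun p : Ξ × Eu n => (x, p) := measurable_prodMk_left
  have hm : Measurable fun p : Ξ × Eu n => Q.Gμ μ x p.1 p.2 := by
    have h := (hQ.measurable_Gμ μ).comp hx'
    simpa only [Function.comp_def] using h
  have hGm := hQ.memLp_G k hk x hx
  have iG2 : Integrable (fun s => ‖Q.G x s‖ ^ 2) (Q.noise k x) :=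
    hGm.integrable_norm_pow (by norm_num)
  have i4 : Integrable (fun w : Eu n => (‖w‖ ^ 2) ^ 2) (stdGaussian (Eu n)) :=
    integrable_stdGaussian_of_growth (by fun_prop) (C := 1) (p := 4) fun w => by
      rw [Real.norm_of_nonneg (by positivity)]; ring_nf; linarith
  have i6 : Integrable (fun w : Eu n => (‖w‖ ^ 2) ^ 3) (stdGaussian (Eu n)) :=
    integrable_stdGaussian_of_growth (by fun_prop) (C := 1) (p := 6) fun w => by
      rw [Real.norm_of_nonneg (by positivity)]; ring_nf; linarith
  have j1 : Integrable (fun p : Ξ × Eu n => ⟪Q.G x p.1, p.2⟫ ^ 2 * ‖p.2‖ ^ 2)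
      ((Q.noise k x).prod (stdGaussian (Eu n))) := by
    refine (iG2.mul_prod i4).mono' ?_ (ae_of_all _ fun p => ?_)
    · have m1 : AEStronglyMeasurable (fun p : Ξ × Eu n => Q.G x p.1)
          ((Q.noise k x).prod (stdGaussian (Eu n))) := hGm.1.comp_fst
      have m2 : AEStronglyMeasurable (fun p : Ξ × Eu n => p.2)
          ((Q.noise k x).prod (stdGaussian (Eu n))) := measurable_snd.aestronglyMeasurable
      exact ((m1.inner m2).pow 2).mul (m2.norm.pow 2)
    · rw [Real.norm_of_nonneg (by positivity)]
      have : ⟪Q.G x p.1, p.2⟫ ^ 2 ≤ ‖Q.G x p.1‖ ^ 2 * ‖p.2‖ ^ 2 := by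
        rw [← mul_pow, ← sq_abs]
        exact pow_le_pow_left₀ (abs_nonneg _) (abs_real_inner_le_norm _ _) 2
      calc _ ≤ ‖Q.G x p.1‖ ^ 2 * ‖p.2‖ ^ 2 * ‖p.2‖ ^ 2 := by gcongr
        _ = _ := by ring
  have j2 : Integrable (fun p : Ξ × Eu n => (‖p.2‖ ^ 2) ^ 3)
      ((Q.noise k x).prod (stdGaussian (Eu n))) := i6.comp_snd _
  have hle : ∀ᵐ p ∂((Q.noise k x).prod (stdGaussian (Eu n))), ‖Q.Gμ μ x p.1 p.2‖ ^ 2 ≤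
      2 * (⟪Q.G x p.1, p.2⟫ ^ 2 * ‖p.2‖ ^ 2) + (μ * L) ^ 2 / 2 * (‖p.2‖ ^ 2) ^ 3 := by
    filter_upwards [Measure.quasiMeasurePreserving_fst.ae (hQ.smooth_F k hk x hx)] with p hp
    exact normSq_Gμ_le hμ hp x p.2
  have j3 := (j1.const_mul 2).add (j2.const_mul ((μ * L) ^ 2 / 2))
  have jG : Integrable (fun p : Ξ × Eu n => ‖Q.Gμ μ x p.1 p.2‖ ^ 2)
      ((Q.noise k x).prod (stdGaussian (Eu n))) := by
    refine j3.mono' (by fun_prop) ?_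
    filter_upwards [hle] with p hp
    rw [Real.norm_of_nonneg (by positivity)]
    exact hp
  have hLp := (memLp_two_iff_integrable_sq_norm hm.aestronglyMeasurable).2 jG
  have hmean : ∫ p, Q.Gμ μ x p.1 p.2 ∂((Q.noise k x).prod (stdGaussian (Eu n))) =
      smoothGrad Q.f μ x := by
    rw [integral_prod_symm _ (hLp.integrable (by norm_num)), smoothGrad]
    congr 1; ext1 w
    obtain ⟨iy, ey⟩ := hQ.unbiased_F k hk x hx (x + μ • w)
    obtain ⟨ix, ex⟩ := hQ.unbiased_F k hk x hx x
    simp only [Problem.Gμ]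
    rw [integral_smul_const, integral_div, integral_sub iy ix, ex, ey]
  refine ⟨hLp, hmean, ?_⟩
  have h1 := integral_normSq_sub_integral hLp
  rw [hmean] at h1
  have h2 := integral_mono_ae jG j3 hle
  simp only [Pi.add_apply] at h2
  rw [integral_add (j1.const_mul 2) (j2.const_mul _), integral_const_mul, integral_const_mul,
    integral_prod _ j1, integral_prod _ j2] at h2
  simp only [integral_inner_sq_mul_normSq_stdGaussian, integral_norm_pow_six_stdGaussian] at h2
  rw [integral_const_mul] at h2
  simp only [integral_const, probReal_univ, one_smul] at h2
  have h3 := hQ.integral_normSq_G_le hk hx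
  have h4 : 2 * ((n + 2) * ∫ s, ‖Q.G x s‖ ^ 2 ∂(Q.noise k x)) ≤
      2 * (((n : ℝ) + 2) * (M ^ 2 + σ ^ 2)) := by gcongr
  unfold secondMoment
  nlinarith [sq_nonneg ‖smoothGrad Q.f μ x‖]

end Problem.Assumptions

end RSPGF

namespace RSPGF

variable {n : ℕ} {Ξ : Type*} [MeasurableSpace Ξ]

/-! ### A single oracle call -/

theorem integrable_inner_of_memLp {Ω : Type*} {mΩ : MeasurableSpace Ω} {P : Measure Ω}
    {Y D : Ω → Eu n} (hY : MemLp Y 2 P) (hD : MemLp D 2 P) :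
    Integrable (fun ω => ⟪Y ω, D ω⟫) P :=
  (hY.norm.integrable_mul hD.norm).mono' (hY.1.inner hD.1)
    (ae_of_all _ fun ω => norm_inner_le_norm (𝕜 := ℝ) (Y ω) (D ω))

/-- Freshness, tested on events determined by `Z`, prescribes the joint law on product sets, and
these determine a finite measure. Thus a call may be integrated with the past variable `Z` frozen.
-/
theorem map_prodMk_eq_compProd {Ω E : Type*} [MeasurableSpace E] {T mΩ : MeasurableSpace Ω}
    {P : Measure Ω} [IsFiniteMeasure P] (hT : T ≤ mΩ) {ξ : Ω → Ξ} {v : Ω → Eu n}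
    (hξ : Measurable ξ) (hv : Measurable v) (κ : Kernel E Ξ) [IsMarkovKernel κ] {Z : Ω → E}
    (hZ : Measurable[T] Z)
    (hfresh : ∀ H, MeasurableSet[T] H → ∀ A : Set Ξ, MeasurableSet A →
      ∀ B : Set (Eu n), MeasurableSet B →
      P (H ∩ ξ ⁻¹' A ∩ v ⁻¹' B) = ∫⁻ ω in H, κ (Z ω) A * stdGaussian (Eu n) B ∂P) :
    P.map (fun ω => (Z ω, (ξ ω, v ω))) =
      (P.map Z) ⊗ₘ (κ ×ₖ Kernel.const E (stdGaussian (Eu n))) := by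
  have hZ' : Measurable Z := hZ.mono hT le_rfl
  refine Measure.ext_prod₃ fun {C A B} hC hA hB => ?_
  rw [Measure.map_apply (by fun_prop) (hC.prod (hA.prod hB)),
    Measure.compProd_apply_prod hC (hA.prod hB),
    setLIntegral_map hC (Kernel.measurable_coe _ (hA.prod hB)) hZ']
  have := hfresh (Z ⁻¹' C) (hZ hC) A hA B hB
  have e : (fun ω => (Z ω, (ξ ω, v ω))) ⁻¹' C ×ˢ A ×ˢ B = Z ⁻¹' C ∩ ξ ⁻¹' A ∩ v ⁻¹' B := by
    ext ω; simp [and_assoc]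
  rw [e, this]
  refine lintegral_congr fun ω => ?_
  rw [Kernel.prod_apply, Measure.prod_prod, Kernel.const_apply]

/-- Given both S and T, the law of the new call is a T-measurable function, so S carries no
information on it beyond T. Independence therefore passes from T to T enlarged by the call; it is
checked on the π-system of sets C ∩ ξ⁻¹(A) ∩ v⁻¹(B). -/
theorem indep_of_fresh {Ω : Type*} {T S mΩ : MeasurableSpace Ω} {P : Measure Ω}
    [IsProbabilityMeasure P] (hT : T ≤ mΩ) (hS : S ≤ mΩ) {ξ : Ω → Ξ} {v : Ω → Eu n}
    (hξ : Measurable ξ) (hv : Measurable v) {q : Set Ξ → Ω → ENNReal}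
    (hq : ∀ A, MeasurableSet A → Measurable[T] (q A))
    (hfresh : ∀ H, MeasurableSet[S ⊔ T] H → ∀ A : Set Ξ, MeasurableSet A →
      ∀ B : Set (Eu n), MeasurableSet B →
      P (H ∩ ξ ⁻¹' A ∩ v ⁻¹' B) = ∫⁻ ω in H, q A ω * stdGaussian (Eu n) B ∂P)
    (h : Indep S T P) :
    Indep S (T ⊔ MeasurableSpace.comap (fun ω => (ξ ω, v ω)) inferInstance) P := by
  let p : Set (Set Ω) := {D | ∃ C, MeasurableSet[T] C ∧ ∃ A : Set Ξ, MeasurableSet A ∧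
    ∃ B : Set (Eu n), MeasurableSet B ∧ D = C ∩ ξ ⁻¹' A ∩ v ⁻¹' B}
  have hp : IsPiSystem p := by
    rintro _ ⟨C, hC, A, hA, B, hB, rfl⟩ _ ⟨C', hC', A', hA', B', hB', rfl⟩ -
    refine ⟨C ∩ C', hC.inter hC', A ∩ A', hA.inter hA', B ∩ B', hB.inter hB', ?_⟩
    ext ω; simp only [Set.mem_inter_iff, Set.mem_preimage]; tauto
  have hpm : ∀ s ∈ p, MeasurableSet s := by
    rintro _ ⟨C, hC, A, hA, B, hB, rfl⟩
    exact ((hT _ hC).inter (hξ hA)).inter (hv hB)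
  have hle : T ⊔ MeasurableSpace.comap (fun ω => (ξ ω, v ω)) inferInstance ≤
      MeasurableSpace.generateFrom p := by
    refine sup_le (fun C hC => ?_) ?_
    · exact MeasurableSpace.measurableSet_generateFrom
        ⟨C, hC, Set.univ, .univ, Set.univ, .univ, by simp⟩
    · refine Measurable.comap_le (Measurable.prodMk (fun A hA => ?_) (fun B hB => ?_))
      · exact MeasurableSpace.measurableSet_generateFrom
          ⟨Set.univ, @MeasurableSet.univ _ T, A, hA, Set.univ, .univ, by simp⟩
      · exact MeasurableSpace.measurableSet_generateFrom
          ⟨Set.univ, @MeasurableSet.univ _ T, Set.univ, .univ, B, hB, by simp⟩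
  have key : Indep (MeasurableSpace.generateFrom {s | MeasurableSet[S] s})
      (MeasurableSpace.generateFrom p) P := by
    refine IndepSets.indep' (fun s hs => hS _ hs) hpm
      (@MeasurableSpace.isPiSystem_measurableSet _ S) hp ?_
    rw [IndepSets_iff]
    rintro H _ hH ⟨C, hC, A, hA, B, hB, rfl⟩
    have hH' : MeasurableSet[S] H := hH
    have hHS : MeasurableSet[S ⊔ T] H := (le_sup_left : S ≤ S ⊔ T) _ hH'
    have hCS : MeasurableSet[S ⊔ T] C := (le_sup_right : T ≤ S ⊔ T) _ hC
    have hφ : Measurable[T] (C.indicator fun ω => q A ω * stdGaussian (Eu n) B) :=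
      ((hq A hA).mul_const _).indicator hC
    have hψ : Measurable[S] (H.indicator fun _ => (1 : ENNReal)) :=
      Measurable.indicator (m := S) (by fun_prop) hH'
    have e1 := hfresh (H ∩ C) (hHS.inter hCS) A hA B hB
    have e2 := hfresh C hCS A hA B hB
    have e3 : H ∩ (C ∩ ξ ⁻¹' A ∩ v ⁻¹' B) = H ∩ C ∩ ξ ⁻¹' A ∩ v ⁻¹' B := by
      simp only [Set.inter_assoc]
    rw [e3, e1, e2, ← lintegral_indicator (hT _ hC), Set.inter_comm H C,
      ← setLIntegral_indicator (hT _ hC),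
      ← lintegral_indicator (hS _ hH')]
    have e4 : ∀ ω, H.indicator (C.indicator fun ω => q A ω * stdGaussian (Eu n) B) ω =
        (C.indicator (fun ω => q A ω * stdGaussian (Eu n) B) ω) * H.indicator (fun _ => 1) ω := by
      intro ω; by_cases hω : ω ∈ H <;> simp [hω]
    simp only [e4]
    -- The indicator of H is S-measurable and the conditional probability on C is T-measurable, so
    -- the integral of their product factors.
    have e5 := lintegral_mul_eq_lintegral_mul_lintegral_of_independent_measurableSpace hT hS
      h.symm hφ hψ
    rw [e5, lintegral_indicator (hS _ hH')]
    simp [mul_comm]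
  rw [@MeasurableSpace.generateFrom_measurableSet _ S] at key
  exact indep_of_indep_of_le_right key hle

namespace Problem.Assumptions

variable {Q : Problem n Ξ} {L α σ M : ℝ}

/-- The law of the noise, modified outside `X` so as to be a Markov kernel. -/
theorem exists_markovKernel (hQ : Q.Assumptions L α σ M) (hne : Q.X.Nonempty) {k : ℕ}
    (hk : 1 ≤ k) :
    ∃ κ : Kernel (Eu n) Ξ, IsMarkovKernel κ ∧ ∀ x ∈ Q.X, κ x = Q.noise k x := by
  obtain ⟨x₀, hx₀⟩ := hne
  have := hQ.noise_prob k hk x₀ hx₀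
  classical
  refine ⟨Kernel.piecewise hQ.closed_X.measurableSet (Q.noise k)
    (Kernel.const _ (Q.noise k x₀)), ⟨fun x => ?_⟩, fun x hx => ?_⟩
  · rw [Kernel.piecewise_apply]
    split_ifs with hx
    · exact hQ.noise_prob k hk x hx
    · simpa using this
  · rw [Kernel.piecewise_apply, if_pos hx]

theorem measurable_smoothGrad (hQ : Q.Assumptions L α σ M) (hne : Q.X.Nonempty) (μ : ℝ) :
    Measurable (smoothGrad Q.f μ) := by
  have hc := hQ.continuous_f hne
  have h : StronglyMeasurable (Function.uncurry fun x w : Eu n =>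
      ((Q.f (x + μ • w) - Q.f x) / μ) • w) := by
    apply Continuous.stronglyMeasurable
    fun_prop
  exact h.integral_prod_right.measurable

section Call

variable {Ω : Type*} {T mΩ : MeasurableSpace Ω} {P : Measure Ω} [IsProbabilityMeasure P]
  {ξ : Ω → Ξ} {v : Ω → Eu n} {x : Ω → Eu n} {k : ℕ} {μ : ℝ}

theorem measurable_Gμ_sub (hQ : Q.Assumptions L α σ M) (hne : Q.X.Nonempty)
    (hx : Measurable x) (hξ : Measurable ξ) (hv : Measurable v) (μ : ℝ) :
    Measurable fun ω => Q.Gμ μ (x ω) (ξ ω) (v ω) - smoothGrad Q.f μ (x ω) := by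
  have h1 := (hQ.measurable_Gμ μ).comp (hx.prodMk (hξ.prodMk hv))
  have h2 := (hQ.measurable_smoothGrad hne μ).comp hx
  simp only [Function.comp_def] at h1 h2
  exact h1.sub h2

theorem measurable_uncurry_Gμ_sub (hQ : Q.Assumptions L α σ M) (hne : Q.X.Nonempty) (μ : ℝ) :
    Measurable fun p : Eu n × (Ξ × Eu n) =>
      Q.Gμ μ p.1 p.2.1 p.2.2 - smoothGrad Q.f μ p.1 :=
  hQ.measurable_Gμ_sub hne measurable_fst (measurable_fst.comp measurable_snd)
    (measurable_snd.comp measurable_snd) μ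

theorem call_secondMoment (hQ : Q.Assumptions L α σ M) (hne : Q.X.Nonempty) (hk : 1 ≤ k)
    (hμ : 0 < μ) (hT : T ≤ mΩ) (hξ : Measurable ξ) (hv : Measurable v)
    (hx : Measurable[T] x) (hxX : ∀ ω, x ω ∈ Q.X)
    (hfresh : ∀ H, MeasurableSet[T] H → ∀ A : Set Ξ, MeasurableSet A →
      ∀ B : Set (Eu n), MeasurableSet B →
      P (H ∩ ξ ⁻¹' A ∩ v ⁻¹' B) = ∫⁻ ω in H, Q.noise k (x ω) A * stdGaussian (Eu n) B ∂P) :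
    MemLp (fun ω => Q.Gμ μ (x ω) (ξ ω) (v ω) - smoothGrad Q.f μ (x ω)) 2 P ∧
    ∫ ω, ‖Q.Gμ μ (x ω) (ξ ω) (v ω) - smoothGrad Q.f μ (x ω)‖ ^ 2 ∂P ≤
      secondMoment n L M σ μ := by
  have hx' : Measurable x := hx.mono hT le_rfl
  have hm := hQ.measurable_Gμ_sub hne hx' hξ hv μ
  have hmu := hQ.measurable_uncurry_Gμ_sub hne μ
  obtain ⟨κ, hκ, hκX⟩ := hQ.exists_markovKernel hne hk
  have hmap := map_prodMk_eq_compProd hT hξ hv κ hx (fun H hH A hA B hB => by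
    simp only [hκX _ (hxX _)]; exact hfresh H hH A hA B hB)
  let Φ : Eu n × (Ξ × Eu n) → ENNReal := fun p =>
    ENNReal.ofReal (‖Q.Gμ μ p.1 p.2.1 p.2.2 - smoothGrad Q.f μ p.1‖ ^ 2)
  have hΦ : Measurable Φ := (hmu.norm.pow_const 2).ennreal_ofReal
  have hs0 : 0 ≤ secondMoment n L M σ μ := by unfold secondMoment; positivity
  have hle : ∫⁻ ω, ENNReal.ofReal
      (‖Q.Gμ μ (x ω) (ξ ω) (v ω) - smoothGrad Q.f μ (x ω)‖ ^ 2) ∂P ≤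
      ENNReal.ofReal (secondMoment n L M σ μ) := by
    calc _ = ∫⁻ ω, Φ (x ω, (ξ ω, v ω)) ∂P := rfl
      _ = ∫⁻ ω, ∫⁻ p, Φ (x ω, p) ∂((κ (x ω)).prod (stdGaussian (Eu n))) ∂P := by
          rw [← lintegral_map hΦ (hx'.prodMk (hξ.prodMk hv)), hmap,
            Measure.lintegral_compProd hΦ, lintegral_map
              (Measurable.lintegral_kernel_prod_right' hΦ) hx']
          simp only [Kernel.prod_apply, Kernel.const_apply]
      _ ≤ ∫⁻ ω, ENNReal.ofReal (secondMoment n L M σ μ) ∂P := by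
          refine lintegral_mono fun ω => ?_
          rw [hκX _ (hxX ω)]
          have := hQ.noise_prob k hk _ (hxX ω)
          obtain ⟨h1, -, h3⟩ := hQ.Gμ_moments hk (hxX ω) hμ
          have h4 : Integrable (fun p : Ξ × Eu n =>
              ‖Q.Gμ μ (x ω) p.1 p.2 - smoothGrad Q.f μ (x ω)‖ ^ 2)
              ((Q.noise k (x ω)).prod (stdGaussian (Eu n))) :=
            (h1.sub (memLp_const (smoothGrad Q.f μ (x ω)))).integrable_norm_pow (by norm_num)
          simp only [Φ]
          rw [← ofReal_integral_eq_lintegral_ofReal h4 (ae_of_all _ fun p => by positivity)]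
          exact ENNReal.ofReal_le_ofReal h3
      _ = _ := by simp
  have hint : Integrable (fun ω =>
      ‖Q.Gμ μ (x ω) (ξ ω) (v ω) - smoothGrad Q.f μ (x ω)‖ ^ 2) P := by
    refine ⟨(hm.norm.pow_const 2).aestronglyMeasurable, ?_⟩
    rw [hasFiniteIntegral_iff_ofReal (ae_of_all _ fun ω => by positivity)]
    exact hle.trans_lt ENNReal.ofReal_lt_top
  refine ⟨(memLp_two_iff_integrable_sq_norm hm.aestronglyMeasurable).2 hint, ?_⟩
  rw [integral_eq_lintegral_of_nonneg_ae (ae_of_all _ fun ω => by positivity) hint.1]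
  exact ENNReal.toReal_le_of_le_ofReal hs0 hle

theorem call_unbiased (hQ : Q.Assumptions L α σ M) (hne : Q.X.Nonempty) (hk : 1 ≤ k)
    (hμ : 0 < μ) (hT : T ≤ mΩ) (hξ : Measurable ξ) (hv : Measurable v)
    (hx : Measurable[T] x) (hxX : ∀ ω, x ω ∈ Q.X)
    (hfresh : ∀ H, MeasurableSet[T] H → ∀ A : Set Ξ, MeasurableSet A →
      ∀ B : Set (Eu n), MeasurableSet B →
      P (H ∩ ξ ⁻¹' A ∩ v ⁻¹' B) = ∫⁻ ω in H, Q.noise k (x ω) A * stdGaussian (Eu n) B ∂P)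
    {Y : Ω → Eu n} (hY : Measurable[T] Y) (hY2 : MemLp Y 2 P) :
    ∫ ω, ⟪Y ω, Q.Gμ μ (x ω) (ξ ω) (v ω) - smoothGrad Q.f μ (x ω)⟫ ∂P = 0 := by
  have hx' : Measurable x := hx.mono hT le_rfl
  have hY' : Measurable Y := hY.mono hT le_rfl
  have hmu := hQ.measurable_uncurry_Gμ_sub hne μ
  obtain ⟨hD, -⟩ := hQ.call_secondMoment hne hk hμ hT hξ hv hx hxX hfresh
  have hint := integrable_inner_of_memLp hY2 hD
  obtain ⟨κ, hκ, hκX⟩ := hQ.exists_markovKernel hne hk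
  -- The frozen variable is the pair (x, Y), although the kernel sees only x: the inner product with
  -- Y is then linear in the centred call for fixed Y.
  have hmap := map_prodMk_eq_compProd (Z := fun ω => (x ω, Y ω)) hT hξ hv
    (κ.comap Prod.fst measurable_fst) (hx.prodMk hY) (fun H hH A hA B hB => by
      simp only [Kernel.comap_apply, hκX _ (hxX _)]; exact hfresh H hH A hA B hB)
  let Φ : (Eu n × Eu n) × (Ξ × Eu n) → ℝ := fun p =>
    ⟪p.1.2, Q.Gμ μ p.1.1 p.2.1 p.2.2 - smoothGrad Q.f μ p.1.1⟫
  have hΦ : Measurable Φ := by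
    have h1 : Measurable fun p : (Eu n × Eu n) × (Ξ × Eu n) => (p.1.1, p.2) := by fun_prop
    have h2 := hmu.comp h1
    simp only [Function.comp_def] at h2
    exact (measurable_snd.comp measurable_fst).inner h2
  have hZm : Measurable fun ω => ((x ω, Y ω), (ξ ω, v ω)) :=
    (hx'.prodMk hY').prodMk (hξ.prodMk hv)
  have hi : Integrable Φ (P.map fun ω => ((x ω, Y ω), (ξ ω, v ω))) :=
    (integrable_map_measure hΦ.aestronglyMeasurable hZm.aemeasurable).2 hint
  calc _ = ∫ ω, Φ ((x ω, Y ω), (ξ ω, v ω)) ∂P := rfl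
    _ = ∫ ω, ∫ p, Φ ((x ω, Y ω), p) ∂((κ (x ω)).prod (stdGaussian (Eu n))) ∂P := by
        rw [← integral_map hZm.aemeasurable hΦ.aestronglyMeasurable, hmap] at *
        rw [Measure.integral_compProd hi, integral_map (hx'.prodMk hY').aemeasurable]
        · simp only [Kernel.prod_apply, Kernel.const_apply, Kernel.comap_apply]
        · exact (StronglyMeasurable.integral_kernel_prod_right'
            hΦ.stronglyMeasurable).aestronglyMeasurable
    _ = ∫ ω, (0 : ℝ) ∂P := by
        congr 1; ext ω
        rw [hκX _ (hxX ω)]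
        have := hQ.noise_prob k hk _ (hxX ω)
        obtain ⟨h1, h2, -⟩ := hQ.Gμ_moments hk (hxX ω) hμ
        have i1 := h1.integrable one_le_two
        have i2 : Integrable (fun p : Ξ × Eu n =>
            Q.Gμ μ (x ω) p.1 p.2 - smoothGrad Q.f μ (x ω))
            ((Q.noise k (x ω)).prod (stdGaussian (Eu n))) := i1.sub (integrable_const _)
        simp only [Φ]
        rw [integral_inner i2, integral_sub i1 (integrable_const _), h2]
        simp
    _ = 0 := by simp

end Call

end Problem.Assumptions

end RSPGF

namespace RSPGF

variable {n : ℕ} {Ξ : Type*} [MeasurableSpace Ξ]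

/-! ### The trajectory -/

/-- The information contained in the calls made before the `i`-th call of iteration `k`. -/
@[reducible] def traj {Ω : Type*} (m : ℕ → ℕ) (ξ : ℕ → ℕ → Ω → Ξ) (v : ℕ → ℕ → Ω → Eu n) (k i : ℕ) :
    MeasurableSpace Ω :=
  ⨆ (l : ℕ) (j : ℕ) (_ : 1 ≤ l ∧ 1 ≤ j ∧ j ≤ m l ∧ (l < k ∨ (l = k ∧ j < i))),
    MeasurableSpace.comap (fun ω => (ξ l j ω, v l j ω)) inferInstance

theorem measurable_comp_of_continuousOn {Ω E : Type*} {mΩ : MeasurableSpace Ω}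
    [TopologicalSpace E] [MeasurableSpace E] [BorelSpace E] {X : Set (Eu n)} {φ : Eu n → E}
    (hφ : ContinuousOn φ X) {x : Ω → Eu n} (hx : Measurable x) (hX : ∀ ω, x ω ∈ X) :
    Measurable fun ω => φ (x ω) :=
  (continuousOn_iff_continuous_domRestrict.1 hφ).measurable.comp (hx.subtype_mk (h := hX))

namespace Problem.Assumptions

variable {Q : Problem n Ξ} {L α σ M : ℝ} {Ω : Type*} {mΩ : MeasurableSpace Ω}

theorem measurable_projPoint (hQ : Q.Assumptions L α σ M) (hα : 0 < α) {γ : ℝ} (hγ : 0 < γ)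
    {x g : Ω → Eu n} (hx : Measurable x) (hX : ∀ ω, x ω ∈ Q.X) (hg : Measurable g)
    (hΩ : Q.X.Nonempty) :
    Measurable (fun ω => projPoint Q.X Q.h Q.ω Q.dω γ (x ω) (g ω)) ∧
      Measurable (fun ω => Q.h (projPoint Q.X Q.h Q.ω Q.dω γ (x ω) (g ω))) := by
  obtain ⟨T, hT, -, hhT, hTx⟩ := hQ.exists_continuous_projPoint_eq hα hγ hΩ
  have hd := measurable_comp_of_continuousOn hQ.distGen.continuous_grad hx hX
  have hy : Measurable fun ω => g ω - (1 / γ) • Q.dω (x ω) := hg.sub (hd.const_smul (1 / γ))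
  simp only [hTx _ (hX _)]
  exact ⟨hT.measurable.comp hy, hhT.measurable.comp hy⟩

theorem continuousOn_gradient_f (hQ : Q.Assumptions L α σ M) (hL : 0 < L) :
    ContinuousOn (gradient Q.f) Q.X := by
  refine (LipschitzOnWith.of_dist_le_mul (K := L.toNNReal) fun y hy z hz => ?_).continuousOn
  rw [dist_eq_norm, dist_eq_norm, Real.coe_toNNReal _ hL.le]
  exact hQ.lipschitz_f z hz y hy

theorem measurable_gX (hQ : Q.Assumptions L α σ M) (hL : 0 < L) (hα : 0 < α) {γ : ℝ}
    (hγ : 0 < γ) {x : Ω → Eu n} (hx : Measurable x) (hX : ∀ ω, x ω ∈ Q.X)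
    (hΩ : Q.X.Nonempty) : Measurable fun ω => Q.gX γ (x ω) := by
  have hg := measurable_comp_of_continuousOn (hQ.continuousOn_gradient_f hL) hx hX
  exact (hx.sub (hQ.measurable_projPoint hα hγ hx hX hg hΩ).1).const_smul (1 / γ)

theorem measurable_V (hQ : Q.Assumptions L α σ M) {x : Ω → Eu n} (hx : Measurable x)
    (hX : ∀ ω, x ω ∈ Q.X) (u : Eu n) : Measurable fun ω => Q.V u (x ω) := by
  have h1 := measurable_comp_of_continuousOn hQ.distGen.continuousOn hx hX
  have h2 := measurable_comp_of_continuousOn hQ.distGen.continuous_grad hx hX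
  exact measurable_const.sub (h1.add (h2.inner (measurable_const.sub hx)))

end Problem.Assumptions

section Trajectory

variable {Ω : Type*} {m : ℕ → ℕ} {ξ : ℕ → ℕ → Ω → Ξ} {v : ℕ → ℕ → Ω → Eu n}

theorem traj_le_of_forall {T : MeasurableSpace Ω} {k i : ℕ}
    (h : ∀ l j, 1 ≤ l ∧ 1 ≤ j ∧ j ≤ m l ∧ (l < k ∨ (l = k ∧ j < i)) →
      MeasurableSpace.comap (fun ω => (ξ l j ω, v l j ω)) inferInstance ≤ T) :
    traj m ξ v k i ≤ T :=
  iSup_le fun l => iSup_le fun j => iSup_le fun hlj => h l j hlj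

theorem comap_le_traj {k i l j : ℕ}
    (h : 1 ≤ l ∧ 1 ≤ j ∧ j ≤ m l ∧ (l < k ∨ (l = k ∧ j < i))) :
    MeasurableSpace.comap (fun ω => (ξ l j ω, v l j ω)) inferInstance ≤ traj m ξ v k i :=
  le_iSup_of_le l (le_iSup_of_le j (le_iSup_of_le h le_rfl))

theorem traj_mono {k i k' i' : ℕ} (h : k < k' ∨ (k = k' ∧ i ≤ i')) :
    traj m ξ v k i ≤ traj m ξ v k' i' :=
  traj_le_of_forall fun l j hlj => comap_le_traj (by omega)

theorem traj_succ_le {k i : ℕ} :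
    traj m ξ v k (i + 1) ≤
      traj m ξ v k i ⊔ MeasurableSpace.comap (fun ω => (ξ k i ω, v k i ω)) inferInstance := by
  refine traj_le_of_forall fun l j hlj => ?_
  by_cases h : l = k ∧ j = i
  · obtain ⟨rfl, rfl⟩ := h
    exact le_sup_right
  · exact (comap_le_traj (by omega)).trans le_sup_left

theorem traj_succ_one_le {k : ℕ} : traj m ξ v (k + 1) 1 ≤ traj m ξ v k (m k + 1) := by
  refine traj_le_of_forall fun l j hlj => comap_le_traj ?_
  rcases hlj with ⟨h1, h2, h3, h4⟩
  refine ⟨h1, h2, h3, ?_⟩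
  rcases Nat.lt_or_ge l k with h | h
  · exact Or.inl h
  -- A trajectory contains only calls with j ≤ m l, so at the end of iteration k the bound j < m k +
  -- 1 excludes nothing.
  · obtain rfl : l = k := by omega
    exact Or.inr ⟨rfl, by omega⟩

theorem traj_one_one : traj m ξ v 1 1 = ⊥ :=
  le_bot_iff.1 (traj_le_of_forall fun l j hlj => by omega)

theorem measurable_call_traj {k i : ℕ} (hk : 1 ≤ k) (hi : 1 ≤ i) (him : i ≤ m k) :
    Measurable[traj m ξ v k (i + 1)] (ξ k i) ∧ Measurable[traj m ξ v k (i + 1)] (v k i) := by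
  have h : Measurable[traj m ξ v k (i + 1)] fun ω => (ξ k i ω, v k i ω) :=
    Measurable.of_comap_le (comap_le_traj (by omega))
  exact ⟨measurable_fst.comp h, measurable_snd.comp h⟩

theorem traj_le [mΩ : MeasurableSpace Ω] (hξ : ∀ k i, Measurable (ξ k i))
    (hv : ∀ k i, Measurable (v k i)) (k i : ℕ) : traj m ξ v k i ≤ mΩ :=
  traj_le_of_forall fun l j _ => ((hξ l j).prodMk (hv l j)).comap_le

/-- The gradient estimate of iteration `k`. -/
noncomputable def gradEst (Q : Problem n Ξ) (x₁ : Eu n) (μ : ℝ) (γ : ℕ → ℝ) (m : ℕ → ℕ)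
    (ξ : ℕ → ℕ → Ω → Ξ) (v : ℕ → ℕ → Ω → Eu n) (k : ℕ) (ω : Ω) : Eu n :=
  batchGrad Q μ (m k) (iterRV Q x₁ μ γ m ξ v k ω) (fun i => ξ k i ω) (fun i => v k i ω)

variable {Q : Problem n Ξ} {L α σ M : ℝ} {x₁ : Eu n} {μ : ℝ} {γ : ℕ → ℝ}

theorem iterRV_one (ω : Ω) : iterRV Q x₁ μ γ m ξ v 1 ω = x₁ := rfl

theorem iterRV_succ {k : ℕ} (hk : 1 ≤ k) (ω : Ω) :
    iterRV Q x₁ μ γ m ξ v (k + 1) ω = projPoint Q.X Q.h Q.ω Q.dω (γ k)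
      (iterRV Q x₁ μ γ m ξ v k ω) (gradEst Q x₁ μ γ m ξ v k ω) := by
  obtain ⟨k, rfl⟩ : ∃ l, k = l + 1 := ⟨k - 1, by omega⟩
  rfl

theorem iterRV_mem (hQ : Q.Assumptions L α σ M) (hγ : ∀ k, 0 < γ k) (hx₁ : x₁ ∈ Q.X) (k : ℕ)
    (ω : Ω) : iterRV Q x₁ μ γ m ξ v k ω ∈ Q.X := by
  induction k with
  | zero => exact hx₁
  | succ k ih =>
    rcases Nat.eq_zero_or_pos k with rfl | hk
    · exact hx₁
    · rw [iterRV_succ hk]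
      exact (hQ.isProj_projPoint (hγ k) ih _).1

theorem measurable_gradEst (hQ : Q.Assumptions L α σ M) {k : ℕ} (hk : 1 ≤ k)
    (h : Measurable[traj m ξ v k 1] (iterRV Q x₁ μ γ m ξ v k)) :
    Measurable[traj m ξ v (k + 1) 1] (gradEst Q x₁ μ γ m ξ v k) := by
  have h' : Measurable[traj m ξ v (k + 1) 1] (iterRV Q x₁ μ γ m ξ v k) :=
    h.mono (traj_mono (by omega)) le_rfl
  have hs : Measurable[traj m ξ v (k + 1) 1] fun ω => ∑ i ∈ Finset.Icc 1 (m k),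
      Q.Gμ μ (iterRV Q x₁ μ γ m ξ v k ω) (ξ k i ω) (v k i ω) := by
    refine @Finset.measurable_fun_sum _ _ _ _ _ _ (traj m ξ v (k + 1) 1) _ _ fun i hi => ?_
    rw [Finset.mem_Icc] at hi
    obtain ⟨h1, h2⟩ := measurable_call_traj (m := m) (ξ := ξ) (v := v) hk hi.1 hi.2
    have hle : traj m ξ v k (i + 1) ≤ traj m ξ v (k + 1) 1 := traj_mono (by omega)
    have := (hQ.measurable_Gμ μ).comp (h'.prodMk ((h1.mono hle le_rfl).prodMk (h2.mono hle le_rfl)))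
    simpa only [Function.comp_def] using this
  exact hs.const_smul (1 / (m k : ℝ))

theorem measurable_iterRV (hQ : Q.Assumptions L α σ M) (hα : 0 < α) (hγ : ∀ k, 0 < γ k)
    (hx₁ : x₁ ∈ Q.X) (k : ℕ) :
    Measurable[traj m ξ v k 1] (iterRV Q x₁ μ γ m ξ v k) ∧
      Measurable[traj m ξ v k 1] (fun ω => Q.h (iterRV Q x₁ μ γ m ξ v k ω)) := by
  induction k with
  | zero => exact ⟨@measurable_const _ _ _ (traj m ξ v 0 1) x₁,
      @measurable_const _ _ _ (traj m ξ v 0 1) (Q.h x₁)⟩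
  | succ k ih =>
    rcases Nat.eq_zero_or_pos k with rfl | hk
    · exact ⟨@measurable_const _ _ _ (traj m ξ v 1 1) x₁,
        @measurable_const _ _ _ (traj m ξ v 1 1) (Q.h x₁)⟩
    · have h1 := measurable_gradEst hQ hk ih.1
      have h2 : Measurable[traj m ξ v (k + 1) 1] (iterRV Q x₁ μ γ m ξ v k) :=
        ih.1.mono (traj_mono (by omega)) le_rfl
      have h3 := hQ.measurable_projPoint hα (hγ k) h2 (iterRV_mem hQ hγ hx₁ k) h1 ⟨x₁, hx₁⟩
      have e : iterRV Q x₁ μ γ m ξ v (k + 1) = fun ω => projPoint Q.X Q.h Q.ω Q.dω (γ k)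
        (iterRV Q x₁ μ γ m ξ v k ω) (gradEst Q x₁ μ γ m ξ v k ω) := funext (iterRV_succ hk)
      rw [e]
      exact h3

theorem measurable_Psi_iterRV (hQ : Q.Assumptions L α σ M) (hα : 0 < α) (hγ : ∀ k, 0 < γ k)
    (hx₁ : x₁ ∈ Q.X) (k : ℕ) :
    Measurable[traj m ξ v k 1] (fun ω => Q.Psi (iterRV Q x₁ μ γ m ξ v k ω)) := by
  obtain ⟨h1, h2⟩ := measurable_iterRV (m := m) (ξ := ξ) (v := v) (μ := μ) hQ hα hγ hx₁ k
  exact ((hQ.continuous_f ⟨x₁, hx₁⟩).measurable.comp h1).add h2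

end Trajectory

/-! ### The stopping index and the random iterate -/

namespace IsRun

variable {Q : Problem n Ξ} {L α σ M : ℝ} {x₁ : Eu n} {μ : ℝ} {γ : ℕ → ℝ} {m : ℕ → ℕ} {N : ℕ}
  {pR : ℕ → ℝ} {Ω : Type*} [mΩ : MeasurableSpace Ω] {P : Measure Ω} {R : Ω → ℕ}
  {ξ : ℕ → ℕ → Ω → Ξ} {v : ℕ → ℕ → Ω → Eu n}

theorem traj_le (hrun : IsRun Q x₁ μ γ m N pR P R ξ v) (k i : ℕ) : traj m ξ v k i ≤ mΩ :=
  RSPGF.traj_le hrun.measurable_ξ hrun.measurable_v k i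

theorem fresh_traj (hrun : IsRun Q x₁ μ γ m N pR P R ξ v) {k : ℕ} (hk : k ∈ Finset.Icc 1 N)
    {i : ℕ} (hi : i ∈ Finset.Icc 1 (m k)) (H : Set Ω) (hH : MeasurableSet[traj m ξ v k i] H)
    (A : Set Ξ) (hA : MeasurableSet A) (B : Set (Eu n)) (hB : MeasurableSet B) :
    P (H ∩ ξ k i ⁻¹' A ∩ v k i ⁻¹' B) =
      ∫⁻ ω in H, Q.noise k (iterRV Q x₁ μ γ m ξ v k ω) A * stdGaussian (Eu n) B ∂P :=
  hrun.fresh k hk i hi H ((le_sup_right : traj m ξ v k i ≤ _) H hH) A hA B hB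

/-- The stopping index is independent of the calls. -/
theorem indep_traj [IsProbabilityMeasure P] (hrun : IsRun Q x₁ μ γ m N pR P R ξ v)
    (hQ : Q.Assumptions L α σ M) (hα : 0 < α) (hγ : ∀ k, 0 < γ k) (hx₁ : x₁ ∈ Q.X) :
    Indep (MeasurableSpace.comap R ⊤) (traj m ξ v (N + 1) 1) P := by
  have step : ∀ k ∈ Finset.Icc 1 N, Indep (MeasurableSpace.comap R ⊤) (traj m ξ v k 1) P →
      ∀ i ≤ m k, Indep (MeasurableSpace.comap R ⊤) (traj m ξ v k (i + 1)) P := by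
    intro k hk h0 i
    induction i with
    | zero => exact fun _ => h0
    | succ i ih =>
      intro hi
      have him : i + 1 ∈ Finset.Icc 1 (m k) := Finset.mem_Icc.2 ⟨by omega, hi⟩
      refine indep_of_indep_of_le_right ?_ traj_succ_le
      refine indep_of_fresh (hrun.traj_le _ _) hrun.measurable_R.comap_le
        (hrun.measurable_ξ k (i + 1)) (hrun.measurable_v k (i + 1))
        -- The iterate is measurable with respect to the trajectory without R, so this conditional
        -- law qualifies for the independence step.
        (q := fun A ω => Q.noise k (iterRV Q x₁ μ γ m ξ v k ω) A) (fun A hA => ?_)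
        (fun H hH A hA B hB => hrun.fresh k hk (i + 1) him H hH A hA B hB) (ih (by omega))
      have hx := (measurable_iterRV (m := m) (ξ := ξ) (v := v) (μ := μ) hQ hα hγ hx₁ k).1
      exact (Kernel.measurable_coe _ hA).comp (hx.mono (traj_mono (by omega)) le_rfl)
  have main : ∀ k, k ≤ N → Indep (MeasurableSpace.comap R ⊤) (traj m ξ v (k + 1) 1) P := by
    intro k
    induction k with
    | zero =>
      intro _
      rw [zero_add, traj_one_one]
      exact indep_bot_right _
    | succ k ih =>
      intro hk
      exact indep_of_indep_of_le_right
        (step (k + 1) (Finset.mem_Icc.2 ⟨by omega, hk⟩) (ih (by omega)) _ le_rfl) traj_succ_one_le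
  exact main N le_rfl

/-- Decompose φ_R as the sum of 1_{R=k} φ_k. Independence of R from the trajectory factors each
expectation. -/
theorem integral_randomIndex [IsProbabilityMeasure P] (hrun : IsRun Q x₁ μ γ m N pR P R ξ v)
    (hQ : Q.Assumptions L α σ M) (hα : 0 < α) (hγ : ∀ k, 0 < γ k) (hx₁ : x₁ ∈ Q.X)
    {φ : ℕ → Ω → ℝ} (hφ : ∀ k ∈ Finset.Icc 1 N, Measurable[traj m ξ v (N + 1) 1] (φ k))
    (hint : ∀ k ∈ Finset.Icc 1 N, Integrable (φ k) P) :
    Integrable (fun ω => φ (R ω) ω) P ∧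
      ∫ ω, φ (R ω) ω ∂P = ∑ k ∈ Finset.Icc 1 N, pR k * ∫ ω, φ k ω ∂P := by
  have hR : ∀ k, MeasurableSet {ω | R ω = k} :=
    fun k => hrun.measurable_R (measurableSet_singleton k)
  have hae : (fun ω => φ (R ω) ω) =ᵐ[P]
      fun ω => ∑ k ∈ Finset.Icc 1 N, {ω | R ω = k}.indicator (fun _ => (1 : ℝ)) ω * φ k ω := by
    filter_upwards [hrun.R_mem] with ω hω
    rw [Finset.sum_eq_single_of_mem _ hω]
    · simp
    · intro k _ hk
      simp [Set.indicator_of_notMem (s := {ω | R ω = k}) (a := ω) (by simpa using hk.symm)]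
  have hi : ∀ k ∈ Finset.Icc 1 N, Integrable
      (fun ω => {ω | R ω = k}.indicator (fun _ => (1 : ℝ)) ω * φ k ω) P := by
    intro k hk
    refine ((hint k hk).indicator (hR k)).congr (ae_of_all _ fun ω => ?_)
    by_cases h : R ω = k <;> simp [h]
  refine ⟨(integrable_finsetSum _ hi).congr hae.symm, ?_⟩
  rw [integral_congr_ae hae, integral_finsetSum _ hi]
  refine Finset.sum_congr rfl fun k hk => ?_
  have hind : IndepFun ({ω | R ω = k}.indicator fun _ => (1 : ℝ)) (φ k) P := by
    rw [IndepFun_iff_Indep]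
    refine indep_of_indep_of_le (hrun.indep_traj hQ hα hγ hx₁) ?_ (hφ k hk).comap_le
    have : Measurable[MeasurableSpace.comap R ⊤] ({ω | R ω = k}.indicator fun _ => (1 : ℝ)) :=
      Measurable.indicator (m := MeasurableSpace.comap R ⊤) (by fun_prop) ⟨{k}, trivial, rfl⟩
    exact this.comap_le
  rw [hind.integral_fun_mul_eq_mul_integral
    ((measurable_const.indicator (hR k)).aestronglyMeasurable) (hint k hk).1,
    integral_indicator_const _ (hR k), hrun.R_law k hk]
  simp

/-! ### The error of the gradient estimate -/

/-- The partial sums of a batch are a martingale: each centred call is orthogonal to every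
square-integrable function of the earlier calls. Hence second moments add, giving j rather than j²,
although the calls are only conditionally fresh. -/
theorem sum_calls [IsProbabilityMeasure P] (hrun : IsRun Q x₁ μ γ m N pR P R ξ v)
    (hQ : Q.Assumptions L α σ M) (hα : 0 < α) (hγ : ∀ k, 0 < γ k) (hx₁ : x₁ ∈ Q.X)
    (hμ : 0 < μ) {k : ℕ} (hk : k ∈ Finset.Icc 1 N) {S : ℕ → Ω → Eu n}
    (hS : ∀ j ω, S j ω = ∑ i ∈ Finset.Icc 1 j,
      (Q.Gμ μ (iterRV Q x₁ μ γ m ξ v k ω) (ξ k i ω) (v k i ω) -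
        smoothGrad Q.f μ (iterRV Q x₁ μ γ m ξ v k ω))) :
    ∀ j ≤ m k, Measurable[traj m ξ v k (j + 1)] (S j) ∧ MemLp (S j) 2 P ∧
      ∫ ω, ‖S j ω‖ ^ 2 ∂P ≤ j * secondMoment n L M σ μ ∧
      ∀ Y : Ω → Eu n, Measurable[traj m ξ v k 1] Y → MemLp Y 2 P →
        ∫ ω, ⟪Y ω, S j ω⟫ ∂P = 0 := by
  have hk1 := (Finset.mem_Icc.1 hk).1
  intro j
  induction j with
  | zero =>
    intro _
    have : S 0 = fun _ => 0 := by ext1 ω; simp [hS]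
    rw [this]
    refine ⟨@measurable_const _ _ _ (traj m ξ v k 1) 0, MemLp.zero, by simp, by simp⟩
  | succ j ih =>
    intro hj
    obtain ⟨i1, i2, i3, i4⟩ := ih (by omega)
    let D : Ω → Eu n := fun ω => Q.Gμ μ (iterRV Q x₁ μ γ m ξ v k ω) (ξ k (j + 1) ω)
      (v k (j + 1) ω) - smoothGrad Q.f μ (iterRV Q x₁ μ γ m ξ v k ω)
    have hSD : S (j + 1) = fun ω => S j ω + D ω := by
      ext1 ω; rw [hS, hS, Finset.sum_Icc_succ_top (by omega)]
    have him : j + 1 ∈ Finset.Icc 1 (m k) := Finset.mem_Icc.2 ⟨by omega, hj⟩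
    have hT := hrun.traj_le k (j + 1)
    have hx := (measurable_iterRV (m := m) (ξ := ξ) (v := v) (μ := μ) hQ hα hγ hx₁ k).1
    have hx2 : Measurable[traj m ξ v k (j + 1)] (iterRV Q x₁ μ γ m ξ v k) :=
      hx.mono (traj_mono (by omega)) le_rfl
    have hx3 : Measurable[traj m ξ v k (j + 2)] (iterRV Q x₁ μ γ m ξ v k) :=
      hx.mono (traj_mono (by omega)) le_rfl
    have hX := iterRV_mem (m := m) (ξ := ξ) (v := v) (μ := μ) hQ hγ hx₁ k
    have hfr := fun H hH A hA B hB => hrun.fresh_traj hk him H hH A hA B hB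
    obtain ⟨d1, d2⟩ := hQ.call_secondMoment ⟨x₁, hx₁⟩ hk1 hμ hT (hrun.measurable_ξ k (j + 1))
      (hrun.measurable_v k (j + 1)) hx2 hX hfr
    have d3 := fun (Y : Ω → Eu n) (hY : Measurable[traj m ξ v k (j + 1)] Y) (hY2 : MemLp Y 2 P) =>
      hQ.call_unbiased ⟨x₁, hx₁⟩ hk1 hμ hT (hrun.measurable_ξ k (j + 1))
      (hrun.measurable_v k (j + 1)) hx2 hX hfr hY hY2
    change MemLp D 2 P at d1
    change ∫ ω, ‖D ω‖ ^ 2 ∂P ≤ _ at d2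
    obtain ⟨c1, c2⟩ := measurable_call_traj (m := m) (ξ := ξ) (v := v) hk1 (by omega) hj
    have hDm : Measurable[traj m ξ v k (j + 2)] D :=
      hQ.measurable_Gμ_sub ⟨x₁, hx₁⟩ hx3 c1 c2 μ
    rw [hSD]
    refine ⟨(i1.mono (traj_mono (by omega)) le_rfl).add hDm, i2.add d1, ?_, fun Y hY hY2 => ?_⟩
    · have e : ∀ ω, ‖S j ω + D ω‖ ^ 2 = ‖S j ω‖ ^ 2 + 2 * ⟪S j ω, D ω⟫ + ‖D ω‖ ^ 2 :=
        fun ω => norm_add_sq_real _ _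
      have a1 : Integrable (fun ω => ‖S j ω‖ ^ 2) P := i2.integrable_norm_pow (by norm_num)
      have a2 : Integrable (fun ω => ‖D ω‖ ^ 2) P := d1.integrable_norm_pow (by norm_num)
      have a3 : Integrable (fun ω => 2 * ⟪S j ω, D ω⟫) P :=
        (integrable_inner_of_memLp i2 d1).const_mul 2
      have a4 : Integrable (fun ω => ‖S j ω‖ ^ 2 + 2 * ⟪S j ω, D ω⟫) P := a1.add a3
      simp only [e]
      rw [integral_add a4 a2, integral_add a1 a3, integral_const_mul, d3 (S j) i1 i2]
      push_cast
      linarith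
    · simp only [inner_add_right]
      rw [integral_add (integrable_inner_of_memLp hY2 i2) (integrable_inner_of_memLp hY2 d1),
        i4 Y hY hY2, d3 Y (hY.mono (traj_mono (by omega)) le_rfl) hY2, add_zero]

/-- The bound for the mean squared error of the gradient estimate. -/
noncomputable def mse (n : ℕ) (L M σ μ : ℝ) (mk : ℕ) : ℝ :=
  secondMoment n L M σ μ / mk + μ ^ 2 * L ^ 2 * (n * (n + 2)) / 4

/-- The error splits into the smoothing bias b, known before the batch, and the centred batch
average. They are orthogonal because b is measurable with respect to the past, so their second
moments add. -/
theorem gradEst_error [IsProbabilityMeasure P] (hrun : IsRun Q x₁ μ γ m N pR P R ξ v)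
    (hQ : Q.Assumptions L α σ M) (hL : 0 < L) (hα : 0 < α) (hγ : ∀ k, 0 < γ k) (hx₁ : x₁ ∈ Q.X)
    (hμ : 0 < μ) {k : ℕ} (hk : k ∈ Finset.Icc 1 N) (hm : 0 < m k) :
    MemLp (fun ω => gradEst Q x₁ μ γ m ξ v k ω -
      smoothGrad Q.f μ (iterRV Q x₁ μ γ m ξ v k ω)) 2 P ∧
    MemLp (fun ω => gradEst Q x₁ μ γ m ξ v k ω -
      gradient Q.f (iterRV Q x₁ μ γ m ξ v k ω)) 2 P ∧
    ∫ ω, ‖gradEst Q x₁ μ γ m ξ v k ω - gradient Q.f (iterRV Q x₁ μ γ m ξ v k ω)‖ ^ 2 ∂P ≤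
      mse n L M σ μ (m k) ∧
    ∀ Y : Ω → Eu n, Measurable[traj m ξ v k 1] Y → MemLp Y 2 P →
      ∫ ω, ⟪Y ω, gradEst Q x₁ μ γ m ξ v k ω -
        smoothGrad Q.f μ (iterRV Q x₁ μ γ m ξ v k ω)⟫ ∂P = 0 := by
  set x := iterRV Q x₁ μ γ m ξ v k with hxdef
  obtain ⟨-, s2, s3, s4⟩ := hrun.sum_calls hQ hα hγ hx₁ hμ hk
    (S := fun j ω => ∑ i ∈ Finset.Icc 1 j,
      (Q.Gμ μ (x ω) (ξ k i ω) (v k i ω) - smoothGrad Q.f μ (x ω))) (fun j ω => rfl) (m k) le_rfl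
  set S : Ω → Eu n := fun ω => ∑ i ∈ Finset.Icc 1 (m k),
      (Q.Gμ μ (x ω) (ξ k i ω) (v k i ω) - smoothGrad Q.f μ (x ω)) with hSdef
  have hm' : (0 : ℝ) < m k := by exact_mod_cast hm
  have e1 : ∀ ω, gradEst Q x₁ μ γ m ξ v k ω - smoothGrad Q.f μ (x ω) =
      (1 / (m k : ℝ)) • S ω := by
    intro ω
    simp only [hSdef, Finset.sum_sub_distrib, Finset.sum_const, Nat.card_Icc, smul_sub,
      gradEst, batchGrad, add_tsub_cancel_right]
    rw [← Nat.cast_smul_eq_nsmul ℝ, smul_smul, one_div_mul_cancel hm'.ne', one_smul]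
  have hx := (measurable_iterRV (m := m) (ξ := ξ) (v := v) (μ := μ) hQ hα hγ hx₁ k).1
  rw [← hxdef] at hx
  have hX : ∀ ω, x ω ∈ Q.X := iterRV_mem hQ hγ hx₁ k
  let b : Ω → Eu n := fun ω => smoothGrad Q.f μ (x ω) - gradient Q.f (x ω)
  have hb : Measurable[traj m ξ v k 1] b :=
    ((hQ.measurable_smoothGrad ⟨x₁, hx₁⟩ μ).comp hx).sub
      (measurable_comp_of_continuousOn (hQ.continuousOn_gradient_f hL) hx hX)
  have hbn : ∀ ω, ‖b ω‖ ^ 2 ≤ μ ^ 2 * L ^ 2 * (n * (n + 2)) / 4 := fun ω =>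
    hQ.normSq_smoothGrad_sub_le hL (hX ω) hμ
  have hbL : MemLp b 2 P :=
    MemLp.of_bound (hb.mono (hrun.traj_le _ _) le_rfl).aestronglyMeasurable
      (√(μ ^ 2 * L ^ 2 * (n * (n + 2)) / 4)) (ae_of_all _ fun ω => Real.le_sqrt_of_sq_le (hbn ω))
  have hδ' : MemLp (fun ω => (1 / (m k : ℝ)) • S ω) 2 P := s2.const_smul (1 / (m k : ℝ))
  have hun : ∀ Y : Ω → Eu n, Measurable[traj m ξ v k 1] Y → MemLp Y 2 P →
      ∫ ω, ⟪Y ω, (1 / (m k : ℝ)) • S ω⟫ ∂P = 0 := by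
    intro Y hY hY2
    simp only [inner_smul_right]
    rw [integral_const_mul, s4 Y hY hY2, mul_zero]
  have e2 : ∀ ω, gradEst Q x₁ μ γ m ξ v k ω - gradient Q.f (x ω) =
      b ω + (1 / (m k : ℝ)) • S ω := by
    intro ω; rw [← e1]; simp only [b]; abel
  simp only [e1, e2]
  refine ⟨hδ', hbL.add hδ', ?_, hun⟩
  have a1 : Integrable (fun ω => ‖b ω‖ ^ 2) P := hbL.integrable_norm_pow (by norm_num)
  have a2 : Integrable (fun ω => ‖S ω‖ ^ 2) P := s2.integrable_norm_pow (by norm_num)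
  have a3 : Integrable (fun ω => 2 * ⟪b ω, (1 / (m k : ℝ)) • S ω⟫) P :=
    (integrable_inner_of_memLp hbL hδ').const_mul 2
  have a4 : Integrable (fun ω => ‖b ω‖ ^ 2 + 2 * ⟪b ω, (1 / (m k : ℝ)) • S ω⟫) P := a1.add a3
  simp only [norm_add_sq_real]
  have e3 : ∀ ω, ‖(1 / (m k : ℝ)) • S ω‖ ^ 2 = (1 / (m k : ℝ)) ^ 2 * ‖S ω‖ ^ 2 := by
    intro ω; rw [norm_smul, mul_pow, Real.norm_of_nonneg (by positivity)]
  have e4 : (fun ω => ‖b ω‖ ^ 2 + 2 * ⟪b ω, (1 / (m k : ℝ)) • S ω⟫ + ‖(1 / (m k : ℝ)) • S ω‖ ^ 2) =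
      fun ω => ‖b ω‖ ^ 2 + 2 * ⟪b ω, (1 / (m k : ℝ)) • S ω⟫ + (1 / (m k : ℝ)) ^ 2 * ‖S ω‖ ^ 2 := by
    ext ω; rw [e3]
  rw [e4, integral_add a4 (a2.const_mul _), integral_add a1 a3, integral_const_mul,
    hun b hb hbL, integral_const_mul]
  have h1 : ∫ ω, ‖b ω‖ ^ 2 ∂P ≤ μ ^ 2 * L ^ 2 * (n * (n + 2)) / 4 := by
    have := integral_mono a1 (integrable_const _) hbn
    simpa using this
  have h2 : (1 / (m k : ℝ)) ^ 2 * ∫ ω, ‖S ω‖ ^ 2 ∂P ≤ secondMoment n L M σ μ / m k := by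
    calc _ ≤ (1 / (m k : ℝ)) ^ 2 * (m k * secondMoment n L M σ μ) := by gcongr
      _ = _ := by field_simp
  unfold mse
  linarith

end IsRun

end RSPGF

namespace RSPGF

/-! ### Rates of convergence -/

theorem sum_le_of_telescope {a E : ℕ → ℝ} {c d : ℝ} {N : ℕ}
    (h : ∀ k ∈ Finset.Icc 1 N, a k ≤ c * (E k - E (k + 1)) + d) :
    ∑ k ∈ Finset.Icc 1 N, a k ≤ c * (E 1 - E (N + 1)) + N * d := by
  induction N with
  | zero => simp
  | succ N ih =>
    rw [Finset.sum_Icc_succ_top (by omega)]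
    have h1 := ih fun k hk => h k (by rw [Finset.mem_Icc] at *; omega)
    have h2 := h (N + 1) (by rw [Finset.mem_Icc]; omega)
    push_cast
    linarith

theorem integrable_of_le_of_le {Ω : Type*} {mΩ : MeasurableSpace Ω} {P : Measure Ω}
    [IsFiniteMeasure P] {φ g : Ω → ℝ} {c : ℝ} (hφ : Measurable φ) (hg : Integrable g P)
    (h₁ : ∀ ω, c ≤ φ ω) (h₂ : ∀ ω, φ ω ≤ g ω) : Integrable φ P := by
  refine ((integrable_const |c|).add hg.abs).mono' hφ.aestronglyMeasurable (ae_of_all _ fun ω => ?_)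
  rw [Real.norm_eq_abs, abs_le]
  simp only [Pi.add_apply]
  constructor
  · linarith [h₁ ω, neg_abs_le c, abs_nonneg (g ω)]
  · linarith [h₂ ω, le_abs_self (g ω), abs_nonneg c]

theorem stopPMF_const {α L g : ℝ} (h : α * g - L * g ^ 2 ≠ 0) (N k : ℕ) :
    stopPMF α L (fun _ => g) N k = 1 / N := by
  simp only [stopPMF, Finset.sum_const, Nat.card_Icc, add_tsub_cancel_right, nsmul_eq_mul]
  rw [div_mul_cancel_right₀ h, one_div]

variable {n : ℕ} {Ξ : Type*} [MeasurableSpace Ξ]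

theorem Problem.Assumptions.PsiStar_le {Q : Problem n Ξ} {L α σ M : ℝ}
    (hQ : Q.Assumptions L α σ M) {x : Eu n} (hx : x ∈ Q.X) : Q.PsiStar ≤ Q.Psi x :=
  csInf_le hQ.bddBelow ⟨x, hx, rfl⟩

namespace IsRun

variable {Q : Problem n Ξ} {L α σ M : ℝ} {x₁ : Eu n} {μ : ℝ} {m : ℕ} {N : ℕ}
  {pR : ℕ → ℝ} {Ω : Type*} [mΩ : MeasurableSpace Ω] {P : Measure Ω} {R : Ω → ℕ}
  {ξ : ℕ → ℕ → Ω → Ξ} {v : ℕ → ℕ → Ω → Eu n}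

/-- Induction along the run: the next value lies between Ψ* and the previous value plus the squared
gradient error over 2L. -/
theorem integrable_Psi [IsProbabilityMeasure P]
    (hrun : IsRun Q x₁ μ (fun _ => α / (2 * L)) (fun _ => m) N pR P R ξ v)
    (hQ : Q.Assumptions L α σ M) (hL : 0 < L) (hα : 0 < α) (hx₁ : x₁ ∈ Q.X) (hμ : 0 < μ)
    (hm : 0 < m) {k : ℕ} (hk : 1 ≤ k) (hkN : k ≤ N + 1) :
    Integrable (fun ω => Q.Psi (iterRV Q x₁ μ (fun _ => α / (2 * L)) (fun _ => m) ξ v k ω)) P := by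
  have hγ : ∀ _ : ℕ, 0 < α / (2 * L) := fun _ => by positivity
  induction k, hk using Nat.le_induction with
  | base => exact integrable_const (Q.Psi x₁)
  | succ k hk ih =>
    have hkm : k ∈ Finset.Icc 1 N := Finset.mem_Icc.2 ⟨hk, by omega⟩
    obtain ⟨-, e2, -, -⟩ := hrun.gradEst_error hQ hL hα hγ hx₁ hμ hkm hm
    have e3 := (e2.integrable_norm_pow (p := 2) (by norm_num)).div_const (2 * L)
    refine integrable_of_le_of_le (c := Q.PsiStar)
      ((measurable_Psi_iterRV hQ hα hγ hx₁ (k + 1)).mono (hrun.traj_le _ _) le_rfl)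
      ((ih (by omega)).add e3) (fun ω => hQ.PsiStar_le (iterRV_mem hQ hγ hx₁ _ _)) fun ω => ?_
    have h := hQ.normSq_sub_projPoint_le hL hα
      (iterRV_mem (m := fun _ => m) (ξ := ξ) (v := v) (μ := μ) hQ hγ hx₁ k ω)
      (gradEst Q x₁ μ (fun _ => α / (2 * L)) (fun _ => m) ξ v k ω)
    rw [iterRV_succ hk]
    simp only [Pi.add_apply]
    nlinarith [mul_nonneg hL.le (sq_nonneg
      ‖iterRV Q x₁ μ (fun _ => α / (2 * L)) (fun _ => m) ξ v k ω -
      projPoint Q.X Q.h Q.ω Q.dω (α / (2 * L))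
      (iterRV Q x₁ μ (fun _ => α / (2 * L)) (fun _ => m) ξ v k ω)
      (gradEst Q x₁ μ (fun _ => α / (2 * L)) (fun _ => m) ξ v k ω)‖)]

theorem gX_step [IsProbabilityMeasure P]
    (hrun : IsRun Q x₁ μ (fun _ => α / (2 * L)) (fun _ => m) N pR P R ξ v)
    (hQ : Q.Assumptions L α σ M) (hL : 0 < L) (hα : 0 < α) (hx₁ : x₁ ∈ Q.X) (hμ : 0 < μ)
    (hm : 0 < m) {k : ℕ} (hk : k ∈ Finset.Icc 1 N) :
    Integrable (fun ω => ‖Q.gX (α / (2 * L))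
      (iterRV Q x₁ μ (fun _ => α / (2 * L)) (fun _ => m) ξ v k ω)‖ ^ 2) P ∧
    α ^ 2 / L * ∫ ω, ‖Q.gX (α / (2 * L))
      (iterRV Q x₁ μ (fun _ => α / (2 * L)) (fun _ => m) ξ v k ω)‖ ^ 2 ∂P ≤
      8 * (∫ ω, Q.Psi (iterRV Q x₁ μ (fun _ => α / (2 * L)) (fun _ => m) ξ v k ω) ∂P -
        ∫ ω, Q.Psi (iterRV Q x₁ μ (fun _ => α / (2 * L)) (fun _ => m) ξ v (k + 1) ω) ∂P) +
        6 / L * mse n L M σ μ m := by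
  have hγ : ∀ _ : ℕ, 0 < α / (2 * L) := fun _ => by positivity
  obtain ⟨hk1, hkN⟩ := Finset.mem_Icc.1 hk
  set x := iterRV Q x₁ μ (fun _ => α / (2 * L)) (fun _ => m) ξ v with hxdef
  have p0 := hrun.integrable_Psi hQ hL hα hx₁ hμ hm hk1 (by omega)
  have p1 := hrun.integrable_Psi hQ hL hα hx₁ hμ hm (k := k + 1) (by omega) (by omega)
  rw [← hxdef] at p0 p1
  obtain ⟨-, e2, e3, -⟩ := hrun.gradEst_error hQ hL hα hγ hx₁ hμ hk hm
  rw [← hxdef] at e2 e3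
  have e4 := e2.integrable_norm_pow (p := 2) (by norm_num)
  have hxm : Measurable (x k) := (measurable_iterRV hQ hα hγ hx₁ k).1.mono (hrun.traj_le _ _) le_rfl
  have hX : ∀ ω, x k ω ∈ Q.X := iterRV_mem hQ hγ hx₁ k
  have hg : Measurable fun ω => α ^ 2 / L * ‖Q.gX (α / (2 * L)) (x k ω)‖ ^ 2 :=
    ((hQ.measurable_gX hL hα (hγ 0) hxm hX ⟨x₁, hx₁⟩).norm.pow_const 2).const_mul _
  have i0 : Integrable (fun ω => 8 * (Q.Psi (x k ω) - Q.Psi (x (k + 1) ω))) P :=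
    (p0.sub p1).const_mul 8
  have i1 : Integrable (fun ω => 6 / L *
      ‖gradEst Q x₁ μ (fun _ => α / (2 * L)) (fun _ => m) ξ v k ω -
      gradient Q.f (x k ω)‖ ^ 2) P := e4.const_mul _
  have hle : ∀ ω, α ^ 2 / L * ‖Q.gX (α / (2 * L)) (x k ω)‖ ^ 2 ≤
      8 * (Q.Psi (x k ω) - Q.Psi (x (k + 1) ω)) +
        6 / L * ‖gradEst Q x₁ μ (fun _ => α / (2 * L)) (fun _ => m) ξ v k ω -
          gradient Q.f (x k ω)‖ ^ 2 := by
    intro ω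
    rw [hxdef, iterRV_succ hk1]
    exact hQ.normSq_gX_le hL hα (hX ω) _
  have hint : Integrable (fun ω => α ^ 2 / L * ‖Q.gX (α / (2 * L)) (x k ω)‖ ^ 2) P :=
    integrable_of_le_of_le (c := 0) hg (i0.add i1) (fun ω => by positivity) hle
  constructor
  · refine (hint.const_mul ((α ^ 2 / L)⁻¹)).congr (ae_of_all _ fun ω => ?_)
    have : α ^ 2 / L ≠ 0 := by positivity
    simp only
    rw [inv_mul_cancel_left₀ this]
  · rw [← integral_const_mul]
    refine (integral_mono hint (i0.add i1) hle).trans ?_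
    simp only [Pi.add_apply]
    rw [integral_add i0 i1, integral_const_mul, integral_const_mul, integral_sub p0 p1]
    gcongr

theorem integral_gX_randomIndex_le [IsProbabilityMeasure P]
    (hrun : IsRun Q x₁ μ (fun _ => α / (2 * L)) (fun _ => m) N (fun _ => 1 / (N : ℝ)) P R ξ v)
    (hQ : Q.Assumptions L α σ M) (hL : 0 < L) (hα : 0 < α) (hx₁ : x₁ ∈ Q.X) (hμ : 0 < μ)
    (hm : 0 < m) (hN : 0 < N) :
    Integrable (fun ω => ‖Q.gX (α / (2 * L))
      (iterRV Q x₁ μ (fun _ => α / (2 * L)) (fun _ => m) ξ v (R ω) ω)‖ ^ 2) P ∧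
    α ^ 2 / L * ∫ ω, ‖Q.gX (α / (2 * L))
      (iterRV Q x₁ μ (fun _ => α / (2 * L)) (fun _ => m) ξ v (R ω) ω)‖ ^ 2 ∂P ≤
      8 * (Q.Psi x₁ - Q.PsiStar) / N + 6 / L * mse n L M σ μ m := by
  have hγ : ∀ _ : ℕ, 0 < α / (2 * L) := fun _ => by positivity
  have hN' : (0 : ℝ) < N := by exact_mod_cast hN
  have hmeas : ∀ k ∈ Finset.Icc 1 N, Measurable[traj (fun _ => m) ξ v (N + 1) 1] fun ω =>
      ‖Q.gX (α / (2 * L)) (iterRV Q x₁ μ (fun _ => α / (2 * L)) (fun _ => m) ξ v k ω)‖ ^ 2 := by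
    intro k hk
    obtain ⟨hk1, hkN⟩ := Finset.mem_Icc.1 hk
    have hxm : Measurable[traj (fun _ => m) ξ v (N + 1) 1]
        (iterRV Q x₁ μ (fun _ => α / (2 * L)) (fun _ => m) ξ v k) :=
      (measurable_iterRV hQ hα hγ hx₁ k).1.mono (traj_mono (by omega)) le_rfl
    exact (measurable_norm.comp
      (hQ.measurable_gX hL hα (hγ 0) hxm (iterRV_mem hQ hγ hx₁ k) ⟨x₁, hx₁⟩)).pow_const 2
  obtain ⟨r1, r2⟩ := hrun.integral_randomIndex hQ hα hγ hx₁ hmeas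
    fun k hk => (hrun.gX_step hQ hL hα hx₁ hμ hm hk).1
  refine ⟨r1, ?_⟩
  rw [r2, ← Finset.mul_sum, mul_left_comm, Finset.mul_sum]
  have h1 := sum_le_of_telescope fun k hk => (hrun.gX_step hQ hL hα hx₁ hμ hm hk).2
  have h2 : Q.PsiStar ≤ ∫ ω, Q.Psi
      (iterRV Q x₁ μ (fun _ => α / (2 * L)) (fun _ => m) ξ v (N + 1) ω) ∂P := by
    have := integral_mono (integrable_const Q.PsiStar)
      (hrun.integrable_Psi hQ hL hα hx₁ hμ hm (k := N + 1) (by omega) le_rfl)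
      fun ω => hQ.PsiStar_le (iterRV_mem hQ hγ hx₁ _ _)
    simpa using this
  have h3 : ∫ ω, Q.Psi (iterRV Q x₁ μ (fun _ => α / (2 * L)) (fun _ => m) ξ v 1 ω) ∂P =
      Q.Psi x₁ := by simp [iterRV_one]
  rw [h3] at h1
  calc _ ≤ 1 / (N : ℝ) * (8 * (Q.Psi x₁ - Q.PsiStar) + N * (6 / L * mse n L M σ μ m)) := by
        gcongr; linarith
    _ = _ := by field_simp

theorem convex_step [IsProbabilityMeasure P]
    (hrun : IsRun Q x₁ μ (fun _ => α / (2 * L)) (fun _ => m) N pR P R ξ v)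
    (hQ : Q.Assumptions L α σ M) (hL : 0 < L) (hα : 0 < α) (hx₁ : x₁ ∈ Q.X) (hμ : 0 < μ)
    (hm : 0 < m) (hf : ConvexOn ℝ Set.univ Q.f) {u : Eu n} (hu : Q.IsOptimal u) {k : ℕ}
    (hk : k ∈ Finset.Icc 1 N)
    (hV : Integrable (fun ω =>
      Q.V u (iterRV Q x₁ μ (fun _ => α / (2 * L)) (fun _ => m) ξ v k ω)) P) :
    Integrable (fun ω =>
      Q.V u (iterRV Q x₁ μ (fun _ => α / (2 * L)) (fun _ => m) ξ v (k + 1) ω)) P ∧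
    ∫ ω, (Q.Psi (iterRV Q x₁ μ (fun _ => α / (2 * L)) (fun _ => m) ξ v (k + 1) ω) - Q.Psi u) ∂P ≤
      2 * L / α * (∫ ω, Q.V u (iterRV Q x₁ μ (fun _ => α / (2 * L)) (fun _ => m) ξ v k ω) ∂P -
        ∫ ω, Q.V u (iterRV Q x₁ μ (fun _ => α / (2 * L)) (fun _ => m) ξ v (k + 1) ω) ∂P) +
        (μ ^ 2 * L * n / 2 + mse n L M σ μ m / (2 * L)) := by
  have hγ : ∀ _ : ℕ, 0 < α / (2 * L) := fun _ => by positivity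
  obtain ⟨hk1, hkN⟩ := Finset.mem_Icc.1 hk
  set x := iterRV Q x₁ μ (fun _ => α / (2 * L)) (fun _ => m) ξ v with hxdef
  set G := gradEst Q x₁ μ (fun _ => α / (2 * L)) (fun _ => m) ξ v with hGdef
  have p1 := hrun.integrable_Psi hQ hL hα hx₁ hμ hm (k := k + 1) (by omega) (by omega)
  rw [← hxdef] at p1
  obtain ⟨e1, e2, e3, e5⟩ := hrun.gradEst_error hQ hL hα hγ hx₁ hμ hk hm
  rw [← hxdef, ← hGdef] at e1 e2 e3 e5
  have e4 := e2.integrable_norm_pow (p := 2) (by norm_num)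
  have hxm' : Measurable[traj (fun _ => m) ξ v k 1] (x k) := (measurable_iterRV hQ hα hγ hx₁ k).1
  have hxm : ∀ k, Measurable (x k) := fun k =>
    (measurable_iterRV hQ hα hγ hx₁ k).1.mono (hrun.traj_le _ _) le_rfl
  have hX : ∀ k ω, x k ω ∈ Q.X := fun k => iterRV_mem hQ hγ hx₁ k
  have hY : Measurable[traj (fun _ => m) ξ v k 1] fun ω => u - x k ω :=
    Measurable.sub (m := traj (fun _ => m) ξ v k 1) (by fun_prop) hxm'
  have hV0 : ∀ k ω, α / 2 * ‖u - x k ω‖ ^ 2 ≤ Q.V u (x k ω) := fun k ω =>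
    hQ.distGen.le_prox hQ.convex_X hu.1 (hX k ω)
  -- Strong convexity bounds ‖u - x_k‖² by 2V(u, x_k)/α, so integrability of V is what makes the
  -- cross term integrable.
  have hY2 : MemLp (fun ω => u - x k ω) 2 P := by
    have hY' : Measurable fun ω => u - x k ω := measurable_const.sub (hxm k)
    rw [memLp_two_iff_integrable_sq_norm hY'.aestronglyMeasurable]
    refine integrable_of_le_of_le (c := 0) (hY'.norm.pow_const 2)
      (hV.const_mul (2 / α)) (fun ω => by positivity) fun ω => ?_
    calc ‖u - x k ω‖ ^ 2 = 2 / α * (α / 2 * ‖u - x k ω‖ ^ 2) := by field_simp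
      _ ≤ _ := by gcongr; exact hV0 k ω
  have i1 := integrable_inner_of_memLp hY2 e1
  have i2 : Integrable (fun ω => μ ^ 2 * L * n / 2 +
      ⟪u - x k ω, G k ω - smoothGrad Q.f μ (x k ω)⟫) P := (integrable_const _).add i1
  have i3 : Integrable (fun ω => ‖G k ω - gradient Q.f (x k ω)‖ ^ 2 / (2 * L)) P :=
    e4.div_const _
  have i4 : Integrable (fun ω => μ ^ 2 * L * n / 2 +
      ⟪u - x k ω, G k ω - smoothGrad Q.f μ (x k ω)⟫ +
      ‖G k ω - gradient Q.f (x k ω)‖ ^ 2 / (2 * L)) P := i2.add i3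
  have hle : ∀ ω, Q.Psi (x (k + 1) ω) - Q.Psi u ≤ μ ^ 2 * L * n / 2 +
      ⟪u - x k ω, G k ω - smoothGrad Q.f μ (x k ω)⟫ +
      ‖G k ω - gradient Q.f (x k ω)‖ ^ 2 / (2 * L) +
      2 * L / α * (Q.V u (x k ω) - Q.V u (x (k + 1) ω)) := by
    intro ω
    rw [real_inner_comm, hxdef, iterRV_succ hk1]
    exact hQ.Psi_projPoint_sub_le hL hα (hX k ω) hu.1 _ _
      (hQ.f_sub_le_inner_smoothGrad hL hf (hX k ω) hu.1 hμ)
  -- Optimality of u bounds the left side below by zero. The one-step inequality then dominates V(u,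
  -- x_{k+1}) by integrable terms, which carries integrability to the next iteration.
  have hopt : ∀ ω, 0 ≤ Q.Psi (x (k + 1) ω) - Q.Psi u := fun ω =>
    sub_nonneg.2 (hu.2 (hX (k + 1) ω))
  have hVi : Integrable (fun ω => Q.V u (x (k + 1) ω)) P := by
    refine integrable_of_le_of_le (c := 0) (hQ.measurable_V (hxm (k + 1)) (hX (k + 1)) u)
      ((i4.const_mul (α / (2 * L))).add hV)
      (fun ω => (by positivity : (0 : ℝ) ≤ _).trans (hV0 (k + 1) ω)) fun ω => ?_
    have h := (hopt ω).trans (hle ω)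
    have h' := mul_le_mul_of_nonneg_left h (hγ 0).le
    rw [mul_zero, mul_add, ← mul_assoc (α / (2 * L)) (2 * L / α)] at h'
    have e : α / (2 * L) * (2 * L / α) = 1 := by field_simp
    rw [e, one_mul] at h'
    simp only [Pi.add_apply]
    linarith
  refine ⟨hVi, ?_⟩
  have i5 : Integrable (fun ω => 2 * L / α * (Q.V u (x k ω) - Q.V u (x (k + 1) ω))) P :=
    (hV.sub hVi).const_mul _
  refine (integral_mono (p1.sub (integrable_const _)) (i4.add i5) hle).trans ?_
  simp only [Pi.add_apply]
  rw [integral_add i4 i5, integral_add i2 i3, integral_add (integrable_const _) i1,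
    integral_const_mul, integral_sub hV hVi, integral_div (2 * L), e5 _ hY hY2]
  have : (∫ ω, ‖G k ω - gradient Q.f (x k ω)‖ ^ 2 ∂P) / (2 * L) ≤ mse n L M σ μ m / (2 * L) := by
    gcongr
  simp only [integral_const, probReal_univ, one_smul]
  linarith

theorem integrable_V [IsProbabilityMeasure P]
    (hrun : IsRun Q x₁ μ (fun _ => α / (2 * L)) (fun _ => m) N pR P R ξ v)
    (hQ : Q.Assumptions L α σ M) (hL : 0 < L) (hα : 0 < α) (hx₁ : x₁ ∈ Q.X) (hμ : 0 < μ)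
    (hm : 0 < m) (hf : ConvexOn ℝ Set.univ Q.f) {u : Eu n} (hu : Q.IsOptimal u) {k : ℕ}
    (hk : 1 ≤ k) (hkN : k ≤ N + 1) :
    Integrable (fun ω =>
      Q.V u (iterRV Q x₁ μ (fun _ => α / (2 * L)) (fun _ => m) ξ v k ω)) P := by
  induction k, hk using Nat.le_induction with
  | base => exact integrable_const (Q.V u x₁)
  | succ k hk ih =>
    exact (hrun.convex_step hQ hL hα hx₁ hμ hm hf hu (Finset.mem_Icc.2 ⟨hk, by omega⟩)
      (ih (by omega))).1

theorem integral_Psi_randomIndex_le [IsProbabilityMeasure P]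
    (hrun : IsRun Q x₁ μ (fun _ => α / (2 * L)) (fun _ => m) N (fun _ => 1 / (N : ℝ)) P R ξ v)
    (hQ : Q.Assumptions L α σ M) (hL : 0 < L) (hα : 0 < α) (hx₁ : x₁ ∈ Q.X) (hμ : 0 < μ)
    (hm : 0 < m) (hN : 0 < N) (hf : ConvexOn ℝ Set.univ Q.f) {u : Eu n} (hu : Q.IsOptimal u) :
    Integrable (fun ω => Q.Psi
      (iterRV Q x₁ μ (fun _ => α / (2 * L)) (fun _ => m) ξ v (R ω + 1) ω) - Q.Psi u) P ∧
    ∫ ω, (Q.Psi (iterRV Q x₁ μ (fun _ => α / (2 * L)) (fun _ => m) ξ v (R ω + 1) ω) -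
      Q.Psi u) ∂P ≤
      2 * L * Q.V u x₁ / (α * N) + (μ ^ 2 * L * n / 2 + mse n L M σ μ m / (2 * L)) ∧
    Integrable (fun ω => Q.Psi
      (iterRV Q x₁ μ (fun _ => α / (2 * L)) (fun _ => m) ξ v (R ω) ω) - Q.Psi u) P ∧
    ∫ ω, (Q.Psi (iterRV Q x₁ μ (fun _ => α / (2 * L)) (fun _ => m) ξ v (R ω) ω) -
      Q.Psi u) ∂P ≤
      2 * L * Q.V u x₁ / (α * N) + (μ ^ 2 * L * n / 2 + mse n L M σ μ m / (2 * L)) +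
        (Q.Psi x₁ - Q.Psi u) / N := by
  have hγ : ∀ _ : ℕ, 0 < α / (2 * L) := fun _ => by positivity
  have hN' : (0 : ℝ) < N := by exact_mod_cast hN
  set x := iterRV Q x₁ μ (fun _ => α / (2 * L)) (fun _ => m) ξ v with hxdef
  have hX : ∀ k ω, x k ω ∈ Q.X := fun k => iterRV_mem hQ hγ hx₁ k
  have hmeas : ∀ k ≤ N + 1, Measurable[traj (fun _ => m) ξ v (N + 1) 1] fun ω =>
      Q.Psi (x k ω) - Q.Psi u := fun k hk =>
    ((measurable_Psi_iterRV hQ hα hγ hx₁ k).mono (traj_mono (by omega)) le_rfl).sub_const _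
  have hint : ∀ k, 1 ≤ k → k ≤ N + 1 → Integrable (fun ω => Q.Psi (x k ω) - Q.Psi u) P :=
    fun k hk hkN => (hrun.integrable_Psi hQ hL hα hx₁ hμ hm hk hkN).sub (integrable_const _)
  obtain ⟨r1, r2⟩ := hrun.integral_randomIndex hQ hα hγ hx₁
    (φ := fun k ω => Q.Psi (x (k + 1) ω) - Q.Psi u)
    (fun k hk => hmeas (k + 1) (by rw [Finset.mem_Icc] at hk; omega))
    (fun k hk => hint (k + 1) (by omega) (by rw [Finset.mem_Icc] at hk; omega))
  obtain ⟨r3, r4⟩ := hrun.integral_randomIndex hQ hα hγ hx₁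
    (φ := fun k ω => Q.Psi (x k ω) - Q.Psi u)
    (fun k hk => hmeas k (by rw [Finset.mem_Icc] at hk; omega))
    (fun k hk => hint k (by rw [Finset.mem_Icc] at hk; omega) (by rw [Finset.mem_Icc] at hk; omega))
  have hnn : ∀ k, 0 ≤ ∫ ω, (Q.Psi (x k ω) - Q.Psi u) ∂P := fun k =>
    integral_nonneg fun ω => sub_nonneg.2 (hu.2 (hX k ω))
  have h1 := sum_le_of_telescope fun k hk => (hrun.convex_step hQ hL hα hx₁ hμ hm hf hu hk
    (hrun.integrable_V hQ hL hα hx₁ hμ hm hf hu (Finset.mem_Icc.1 hk).1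
      (by rw [Finset.mem_Icc] at hk; omega))).2
  rw [← hxdef] at h1
  have h2 : 0 ≤ ∫ ω, Q.V u (x (N + 1) ω) ∂P := integral_nonneg fun ω =>
    (by positivity : (0 : ℝ) ≤ _).trans (hQ.distGen.le_prox hQ.convex_X hu.1 (hX (N + 1) ω))
  have h3 : ∫ ω, Q.V u (x 1 ω) ∂P = Q.V u x₁ := by simp [hxdef, iterRV_one]
  rw [h3] at h1
  have h4 : ∑ k ∈ Finset.Icc 1 N, ∫ ω, (Q.Psi (x (k + 1) ω) - Q.Psi u) ∂P ≤
      2 * L / α * Q.V u x₁ + N * (μ ^ 2 * L * n / 2 + mse n L M σ μ m / (2 * L)) := by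
    refine h1.trans (add_le_add_left (mul_le_mul_of_nonneg_left ?_ (by positivity)) _)
    linarith
  have h5 : 1 / (N : ℝ) * (2 * L / α * Q.V u x₁ +
      N * (μ ^ 2 * L * n / 2 + mse n L M σ μ m / (2 * L))) =
      2 * L * Q.V u x₁ / (α * N) + (μ ^ 2 * L * n / 2 + mse n L M σ μ m / (2 * L)) := by
    field_simp
  -- Shifting the index by one exchanges the last gap for the first. The last is nonnegative and is
  -- dropped; the first produces the additional (Ψ(x₁) - Ψ(x*))/N in the bound for x_R.
  have h6 : ∑ k ∈ Finset.Icc 1 N, ∫ ω, (Q.Psi (x k ω) - Q.Psi u) ∂P ≤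
      (Q.Psi x₁ - Q.Psi u) + ∑ k ∈ Finset.Icc 1 N, ∫ ω, (Q.Psi (x (k + 1) ω) - Q.Psi u) ∂P := by
    have := sum_le_of_telescope (N := N) (c := 1) (d := 0)
      (a := fun k => ∫ ω, (Q.Psi (x k ω) - Q.Psi u) ∂P - ∫ ω, (Q.Psi (x (k + 1) ω) - Q.Psi u) ∂P)
      (E := fun k => ∫ ω, (Q.Psi (x k ω) - Q.Psi u) ∂P) (fun k hk => by simp)
    rw [Finset.sum_sub_distrib] at this
    have h7 : ∫ ω, (Q.Psi (x 1 ω) - Q.Psi u) ∂P = Q.Psi x₁ - Q.Psi u := by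
      simp [hxdef, iterRV_one]
    rw [h7] at this
    linarith [hnn (N + 1)]
  refine ⟨r1, ?_, r3, ?_⟩
  · rw [r2, ← Finset.mul_sum, ← h5]
    gcongr
  · rw [r4, ← Finset.mul_sum]
    calc _ ≤ 1 / (N : ℝ) * ((Q.Psi x₁ - Q.Psi u) + (2 * L / α * Q.V u x₁ +
          N * (μ ^ 2 * L * n / 2 + mse n L M σ μ m / (2 * L)))) := by gcongr; linarith
      _ = _ := by rw [mul_add, h5]; ring

end IsRun

end RSPGF

namespace RSPGF

/-! ### The parameters of the budgeted algorithm -/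

section Parameters

variable {n : ℕ} {L M σ Dt : ℝ} {Nbar : ℕ}

theorem sqrt_noise_pos (n : ℕ) (M : ℝ) (hσ : 0 < σ) : 0 < √((n + 4) * (M ^ 2 + σ ^ 2)) :=
  Real.sqrt_pos.2 (by positivity)

theorem batchSize_pos (hN : 1 ≤ Nbar) : 0 < batchSize n L M σ Dt Nbar := by
  have h : (1 : ℝ) ≤ Nbar := by exact_mod_cast hN
  refine Nat.ceil_pos.2 (lt_min (lt_max_of_lt_right (by positivity)) (by linarith))

theorem batchSize_le : batchSize n L M σ Dt Nbar ≤ Nbar :=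
  Nat.ceil_le.2 (min_le_right _ _)

/-- Rounding up costs nothing extra: if n + 4 is the larger term the bound is already an integer,
and otherwise the additional 1 fits into n + 4. -/
theorem batchSize_le_add (hL : 0 < L) (hDt : 0 < Dt) :
    (batchSize n L M σ Dt Nbar : ℝ) ≤
      √((n + 4) * (M ^ 2 + σ ^ 2)) * √(Nbar : ℝ) / (L * Dt) + (n + 4) := by
  rw [← Real.sqrt_mul (by positivity)]
  set A := √((n + 4) * (M ^ 2 + σ ^ 2) * (Nbar : ℝ)) / (L * Dt) with hA
  have hA0 : 0 ≤ A := by positivity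
  rcases le_total A ((n : ℝ) + 4) with h | h
  · have : batchSize n L M σ Dt Nbar ≤ n + 4 := by
      refine Nat.ceil_le.2 ?_
      push_cast
      exact (min_le_left _ _).trans (max_le h le_rfl)
    have h' : (batchSize n L M σ Dt Nbar : ℝ) ≤ n + 4 := by exact_mod_cast this
    linarith
  · have h1 : (batchSize n L M σ Dt Nbar : ℝ) < min (max A (n + 4)) Nbar + 1 :=
      Nat.ceil_lt_add_one (by positivity)
    have h2 : min (max A ((n : ℝ) + 4)) (Nbar : ℝ) ≤ A := (min_le_left _ _).trans (max_le le_rfl h)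
    have h3 : (0 : ℝ) ≤ n := by positivity
    linarith

theorem iterLimit_pos (hN : 1 ≤ Nbar) : 0 < iterLimit n L M σ Dt Nbar :=
  Nat.div_pos batchSize_le (batchSize_pos hN)

/-- The division remainder is less than m, and N ≥ 1 gives m ≤ Nm, so at least half of the budget is
used. -/
theorem le_two_mul_iterLimit_mul (hN : 1 ≤ Nbar) :
    (Nbar : ℝ) ≤ 2 * iterLimit n L M σ Dt Nbar * batchSize n L M σ Dt Nbar := by
  have h1 := Nat.div_add_mod Nbar (batchSize n L M σ Dt Nbar)
  have h2 := Nat.mod_lt Nbar (batchSize_pos (n := n) (L := L) (M := M) (σ := σ) (Dt := Dt) hN)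
  have h3 := iterLimit_pos (n := n) (L := L) (M := M) (σ := σ) (Dt := Dt) hN
  change batchSize n L M σ Dt Nbar * iterLimit n L M σ Dt Nbar + _ = _ at h1
  have h4 : batchSize n L M σ Dt Nbar * 1 ≤
      batchSize n L M σ Dt Nbar * iterLimit n L M σ Dt Nbar := Nat.mul_le_mul_left _ h3
  have : Nbar ≤ 2 * iterLimit n L M σ Dt Nbar * batchSize n L M σ Dt Nbar := by nlinarith
  exact_mod_cast this

theorem div_iterLimit_le (hL : 0 < L) (hDt : 0 < Dt) (hN : 1 ≤ Nbar) {W : ℝ} (hW : 0 ≤ W) :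
    W / iterLimit n L M σ Dt Nbar ≤ 2 * W * (n + 4) / Nbar +
      2 * W * √((n + 4) * (M ^ 2 + σ ^ 2)) / (L * Dt * √(Nbar : ℝ)) := by
  have hN0 : (0 : ℝ) < Nbar := by exact_mod_cast hN
  have hI : (0 : ℝ) < iterLimit n L M σ Dt Nbar := by
    exact_mod_cast iterLimit_pos (n := n) (L := L) (M := M) (σ := σ) (Dt := Dt) hN
  have h1 := le_two_mul_iterLimit_mul (n := n) (L := L) (M := M) (σ := σ) (Dt := Dt) hN
  have h2 := batchSize_le_add (n := n) (M := M) (σ := σ) (Nbar := Nbar) hL hDt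
  set S := √((n + 4) * (M ^ 2 + σ ^ 2))
  have hs : 0 < √(Nbar : ℝ) := Real.sqrt_pos.2 hN0
  have hss : √(Nbar : ℝ) ^ 2 = Nbar := Real.sq_sqrt hN0.le
  calc W / iterLimit n L M σ Dt Nbar ≤ 2 * W * batchSize n L M σ Dt Nbar / Nbar := by
        rw [div_le_div_iff₀ hI hN0]; nlinarith
    _ ≤ 2 * W * (S * √(Nbar : ℝ) / (L * Dt) + (n + 4)) / Nbar := by gcongr
    _ = _ := by rw [← hss]; simp only [Real.sqrt_sq hs.le]; field_simp; ring

theorem div_batchSize_le_θ₂ (hN : 1 ≤ Nbar) :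
    ((n : ℝ) + 4) / batchSize n L M σ Dt Nbar ≤ θ₂ n Nbar := by
  have hN0 : (0 : ℝ) < Nbar := by exact_mod_cast hN
  have hb : (0 : ℝ) < batchSize n L M σ Dt Nbar := by
    exact_mod_cast batchSize_pos (n := n) (L := L) (M := M) (σ := σ) (Dt := Dt) hN
  have h1 : min (max (√((n + 4) * (M ^ 2 + σ ^ 2) * Nbar) / (L * Dt)) ((n : ℝ) + 4)) (Nbar : ℝ) ≤
      batchSize n L M σ Dt Nbar := Nat.le_ceil _
  rcases min_le_iff.1 h1 with h | h
  · refine le_max_of_le_left ?_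
    rw [div_le_one hb]
    exact (le_max_right _ _).trans h
  · refine le_max_of_le_right ?_
    gcongr

/-- Either m reaches the square-root term, which is chosen to produce the factor 1, or the cap N̄ is
active, which produces the other entry of the maximum. -/
theorem noise_div_batchSize_le_θ₁ (hL : 0 < L) (hσ : 0 < σ) (hDt : 0 < Dt) (hN : 1 ≤ Nbar) :
    ((n : ℝ) + 4) * (M ^ 2 + σ ^ 2) / batchSize n L M σ Dt Nbar ≤
      √((n + 4) * (M ^ 2 + σ ^ 2)) * L * Dt / √(Nbar : ℝ) * θ₁ n L M σ Dt Nbar := by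
  have hN0 : (0 : ℝ) < Nbar := by exact_mod_cast hN
  have hb : (0 : ℝ) < batchSize n L M σ Dt Nbar := by
    exact_mod_cast batchSize_pos (n := n) (L := L) (M := M) (σ := σ) (Dt := Dt) hN
  have h1 : min (max (√((n + 4) * (M ^ 2 + σ ^ 2) * Nbar) / (L * Dt)) ((n : ℝ) + 4)) (Nbar : ℝ) ≤
      batchSize n L M σ Dt Nbar := Nat.le_ceil _
  rw [Real.sqrt_mul (by positivity)] at h1
  have hS := sqrt_noise_pos n M hσ
  have hSS : √((n + 4) * (M ^ 2 + σ ^ 2)) ^ 2 = ((n : ℝ) + 4) * (M ^ 2 + σ ^ 2) :=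
    Real.sq_sqrt (by positivity)
  unfold θ₁
  set S := √((n + 4) * (M ^ 2 + σ ^ 2)) with hS'
  rw [show (n + 4) * (M ^ 2 + σ ^ 2) / batchSize n L M σ Dt Nbar =
    S ^ 2 / (batchSize n L M σ Dt Nbar : ℝ) by rw [hSS]]
  have hs : 0 < √(Nbar : ℝ) := Real.sqrt_pos.2 hN0
  have hss : √(Nbar : ℝ) ^ 2 = Nbar := Real.sq_sqrt hN0.le
  set s := √(Nbar : ℝ)
  rcases min_le_iff.1 h1 with h | h
  · calc S ^ 2 / batchSize n L M σ Dt Nbar ≤ S ^ 2 / (S * s / (L * Dt)) := by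
          gcongr; exact (le_max_left _ ((n : ℝ) + 4)).trans h
      _ = S * L * Dt / s * 1 := by field_simp
      _ ≤ _ := by gcongr; exact le_max_left (1 : ℝ) _
  · calc S ^ 2 / batchSize n L M σ Dt Nbar ≤ S ^ 2 / s ^ 2 := by rw [hss]; gcongr
      _ = S * L * Dt / s * (S / (L * Dt * s)) := by field_simp
      _ ≤ _ := by gcongr; exact le_max_right _ _

/-- The noise term goes to θ₁. The μ-terms use n(n+2) ≤ (n+4)² and the smallness of μ, with θ₂
absorbing the remaining (n+4)/m. W stands for D_Ψ² in the nonconvex case and V(x*, x₁)/α in the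
convex one. -/
theorem mse_div_le (hL : 0 < L) (hσ : 0 < σ) (hDt : 0 < Dt) (hN : 1 ≤ Nbar) {μ W : ℝ}
    (hμ : μ ^ 2 * ((n + 4) * Nbar) ≤ W) :
    IsRun.mse n L M σ μ (batchSize n L M σ Dt Nbar) / L ≤
      2 * √((n + 4) * (M ^ 2 + σ ^ 2)) / √(Nbar : ℝ) * (Dt * θ₁ n L M σ Dt Nbar) +
        (1 / 2 * θ₂ n Nbar + 1 / 4) * (L * W * (n + 4) / Nbar) := by
  have hN0 : (0 : ℝ) < Nbar := by exact_mod_cast hN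
  have hb : (0 : ℝ) < batchSize n L M σ Dt Nbar := by
    exact_mod_cast batchSize_pos (n := n) (L := L) (M := M) (σ := σ) (Dt := Dt) hN
  have h1 := noise_div_batchSize_le_θ₁ (n := n) (M := M) hL hσ hDt hN
  have h2 := div_batchSize_le_θ₂ (n := n) (L := L) (M := M) (σ := σ) (Dt := Dt) hN
  have hW0 : 0 ≤ W := le_trans (by positivity) hμ
  have h3 : μ ^ 2 * ((n : ℝ) + 4) ^ 2 ≤ W * (n + 4) / Nbar := by
    rw [le_div_iff₀ hN0]
    nlinarith [mul_le_mul_of_nonneg_right hμ (by positivity : (0 : ℝ) ≤ (n : ℝ) + 4)]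
  have hn : (0 : ℝ) ≤ n := by positivity
  have h4 : (n : ℝ) * (n + 2) ≤ (n + 4) ^ 2 := by nlinarith
  have h5 : (n : ℝ) + 2 ≤ n + 4 := by linarith
  have e : IsRun.mse n L M σ μ (batchSize n L M σ Dt Nbar) / L =
      2 / L * (((n : ℝ) + 2) * (M ^ 2 + σ ^ 2) / batchSize n L M σ Dt Nbar) +
      L / 2 * (μ ^ 2 * (n * (n + 2)) * (((n : ℝ) + 4) / batchSize n L M σ Dt Nbar)) +
      L / 4 * (μ ^ 2 * (n * (n + 2))) := by
    unfold IsRun.mse secondMoment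
    field_simp
  rw [e]
  have t1 : 2 / L * (((n : ℝ) + 2) * (M ^ 2 + σ ^ 2) / batchSize n L M σ Dt Nbar) ≤
      2 * √((n + 4) * (M ^ 2 + σ ^ 2)) / √(Nbar : ℝ) * (Dt * θ₁ n L M σ Dt Nbar) := by
    calc _ ≤ 2 / L * (((n : ℝ) + 4) * (M ^ 2 + σ ^ 2) / batchSize n L M σ Dt Nbar) := by gcongr
      _ ≤ 2 / L * (√((n + 4) * (M ^ 2 + σ ^ 2)) * L * Dt / √(Nbar : ℝ) * θ₁ n L M σ Dt Nbar) := by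
          gcongr
      _ = _ := by field_simp
  have hθ : 0 ≤ θ₂ n Nbar := zero_le_one.trans (le_max_left _ _)
  have h6 : μ ^ 2 * ((n : ℝ) * (n + 2)) ≤ W * (n + 4) / Nbar :=
    (mul_le_mul_of_nonneg_left h4 (sq_nonneg μ)).trans h3
  have t2 : L / 2 * (μ ^ 2 * (n * (n + 2)) * (((n : ℝ) + 4) / batchSize n L M σ Dt Nbar)) ≤
      L / 2 * (W * (n + 4) / Nbar * θ₂ n Nbar) := by gcongr
  have t3 : L / 4 * (μ ^ 2 * (n * (n + 2))) ≤ L / 4 * (W * (n + 4) / Nbar) := by gcongr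
  have e2 : L * W * (n + 4) / (Nbar : ℝ) = L * (W * (n + 4) / Nbar) := by ring
  rw [e2]
  linarith

theorem le_Bbar (hL : 0 < L) (hσ : 0 < σ) (hDt : 0 < Dt) (hN : 1 ≤ Nbar) {μ D : ℝ}
    (hμ : μ ^ 2 * ((n + 4) * Nbar) ≤ D ^ 2) :
    8 * (L * D ^ 2) / iterLimit n L M σ Dt Nbar +
      6 / L * IsRun.mse n L M σ μ (batchSize n L M σ Dt Nbar) ≤ Bbar n L M σ Dt D Nbar := by
  have hN0 : (0 : ℝ) < Nbar := by exact_mod_cast hN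
  have h1 := mse_div_le (n := n) (M := M) hL hσ hDt hN hμ
  have h2 := div_iterLimit_le (n := n) (M := M) (σ := σ) hL hDt hN (W := 8 * (L * D ^ 2))
    (by positivity)
  have hS := sqrt_noise_pos n M hσ
  unfold Bbar
  set S := √((n + 4) * (M ^ 2 + σ ^ 2))
  have hs : 0 < √(Nbar : ℝ) := Real.sqrt_pos.2 hN0
  set s := √(Nbar : ℝ)
  have hθ₁ : 0 ≤ θ₁ n L M σ Dt Nbar := zero_le_one.trans (le_max_left _ _)
  have hθ₂ : 0 ≤ θ₂ n Nbar := zero_le_one.trans (le_max_left _ _)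
  have e1 : 6 / L * IsRun.mse n L M σ μ (batchSize n L M σ Dt Nbar) =
      6 * (IsRun.mse n L M σ μ (batchSize n L M σ Dt Nbar) / L) := by ring
  have e2 : 2 * (8 * (L * D ^ 2)) * S / (L * Dt * s) = 16 * (S / s * (D ^ 2 / Dt)) := by
    field_simp; ring
  have e3 : 2 * (8 * (L * D ^ 2)) * ((n : ℝ) + 4) / Nbar = 16 * (L * D ^ 2 * (n + 4) / Nbar) := by
    ring
  have e4 : (24 * θ₂ n Nbar + 41) * L * D ^ 2 * (n + 4) / Nbar =
      (24 * θ₂ n Nbar + 41) * (L * D ^ 2 * (n + 4) / Nbar) := by ring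
  have e5 : 32 * S / s * (D ^ 2 / Dt + Dt * θ₁ n L M σ Dt Nbar) =
      32 * (S / s * (D ^ 2 / Dt)) + 32 * (S / s * (Dt * θ₁ n L M σ Dt Nbar)) := by ring
  have e6 : 2 * S / s * (Dt * θ₁ n L M σ Dt Nbar) = 2 * (S / s * (Dt * θ₁ n L M σ Dt Nbar)) := by
    ring
  rw [e6] at h1
  rw [e2, e3] at h2
  rw [e1, e4, e5]
  have p1 : 0 ≤ L * D ^ 2 * ((n : ℝ) + 4) / Nbar := by positivity
  have p2 : 0 ≤ S / s * (D ^ 2 / Dt) := by positivity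
  have p3 : 0 ≤ S / s * (Dt * θ₁ n L M σ Dt Nbar) := by positivity
  nlinarith [mul_nonneg hθ₂ p1]

theorem θ₂_eq_one (h : n + 4 ≤ Nbar) : θ₂ n Nbar = 1 := by
  have hN0 : (0 : ℝ) < Nbar := by exact_mod_cast (by omega : 0 < Nbar)
  refine max_eq_left ((div_le_one hN0).2 ?_)
  exact_mod_cast h

theorem Bbar_le (hσ : 0 < σ) (hDt : 0 < Dt) (h : n + 4 ≤ Nbar) (D : ℝ) :
    Bbar n L M σ Dt D Nbar ≤ 65 * (L * D ^ 2 * (n + 4) / Nbar +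
      √((n + 4) * (M ^ 2 + σ ^ 2) / Nbar) * (D ^ 2 / Dt + Dt * θ₁ n L M σ Dt Nbar)) := by
  have hθ₁ : 0 ≤ θ₁ n L M σ Dt Nbar := zero_le_one.trans (le_max_left _ _)
  rw [Bbar, θ₂_eq_one h, Real.sqrt_div (by positivity)]
  set S := √((n + 4) * (M ^ 2 + σ ^ 2))
  have p : 0 ≤ S / √(Nbar : ℝ) * (D ^ 2 / Dt + Dt * θ₁ n L M σ Dt Nbar) := by positivity
  have e : 32 * S / √(Nbar : ℝ) * (D ^ 2 / Dt + Dt * θ₁ n L M σ Dt Nbar) =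
      32 * (S / √(Nbar : ℝ) * (D ^ 2 / Dt + Dt * θ₁ n L M σ Dt Nbar)) := by ring
  rw [e, mul_add (65 : ℝ)]
  have e2 : (24 * 1 + 41) * L * D ^ 2 * ((n : ℝ) + 4) / Nbar =
    65 * (L * D ^ 2 * (n + 4) / Nbar) := by ring
  linarith

theorem le_Cbar {α : ℝ} (hL : 0 < L) (hα : 0 < α) (hσ : 0 < σ) (hDt : 0 < Dt) (hN : 1 ≤ Nbar)
    {μ V : ℝ} (hV : 0 ≤ V) (hμ : μ ^ 2 * ((n + 4) * Nbar) ≤ V / α) :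
    2 * L * V / (α * iterLimit n L M σ Dt Nbar) + (μ ^ 2 * L * n / 2 +
      IsRun.mse n L M σ μ (batchSize n L M σ Dt Nbar) / (2 * L)) ≤ Cbar n L α M σ Dt V Nbar := by
  have hN0 : (0 : ℝ) < Nbar := by exact_mod_cast hN
  have h1 := mse_div_le (n := n) (M := M) hL hσ hDt hN hμ
  have h2 := div_iterLimit_le (n := n) (M := M) (σ := σ) hL hDt hN (W := 2 * L * (V / α))
    (by positivity)
  have hn : (0 : ℝ) ≤ n := by positivity
  have h3 : μ ^ 2 * L * n / 2 ≤ 1 / 8 * (L * (V / α) * (n + 4) / Nbar) := by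
    have h4 : μ ^ 2 * n ≤ 1 / 4 * (V / α * (n + 4) / Nbar) := by
      rw [← mul_div_assoc, le_div_iff₀ hN0]
      have := mul_le_mul_of_nonneg_right hμ (by positivity : (0 : ℝ) ≤ (n : ℝ) + 4)
      have h5 : (n : ℝ) ≤ 1 / 4 * (n + 4) ^ 2 := by nlinarith
      nlinarith [mul_le_mul_of_nonneg_left h5 (by positivity : 0 ≤ μ ^ 2 * (Nbar : ℝ))]
    calc μ ^ 2 * L * n / 2 = L / 2 * (μ ^ 2 * n) := by ring
      _ ≤ L / 2 * (1 / 4 * (V / α * (n + 4) / Nbar)) := by gcongr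
      _ = _ := by ring
  have hS := sqrt_noise_pos n M hσ
  unfold Cbar
  set S := √((n + 4) * (M ^ 2 + σ ^ 2))
  have hs : 0 < √(Nbar : ℝ) := Real.sqrt_pos.2 hN0
  set s := √(Nbar : ℝ)
  have hθ₂ : 0 ≤ θ₂ n Nbar := zero_le_one.trans (le_max_left _ _)
  set X := L * (V / α) * ((n : ℝ) + 4) / Nbar with hX
  have p1 : 0 ≤ X := by positivity
  have e1 : 2 * L * V / (α * iterLimit n L M σ Dt Nbar) =
      2 * L * (V / α) / iterLimit n L M σ Dt Nbar := by
    rw [mul_div_assoc' (2 * L) V α, div_div]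
  have e2 : IsRun.mse n L M σ μ (batchSize n L M σ Dt Nbar) / (2 * L) =
      1 / 2 * (IsRun.mse n L M σ μ (batchSize n L M σ Dt Nbar) / L) := by ring
  have e3 : (5 + θ₂ n Nbar) * L * V * (n + 4) / (α * Nbar) = (5 + θ₂ n Nbar) * X := by
    rw [hX]; field_simp
  have e4 : 2 * (2 * L * (V / α)) * ((n : ℝ) + 4) / Nbar = 4 * X := by rw [hX]; ring
  have e5 : 2 * (2 * L * (V / α)) * S / (L * Dt * s) = S / (α * s) * (4 * V / Dt) := by
    field_simp; ring
  have e6 : 2 * S / s * (Dt * θ₁ n L M σ Dt Nbar) =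
      2 * (S / (α * s) * (α * Dt * θ₁ n L M σ Dt Nbar)) := by field_simp
  rw [e6] at h1
  rw [e4, e5] at h2
  rw [e1, e2, e3, mul_add]
  -- The terms carrying the noise level match exactly. Only the coefficient of X has slack: 4 + 1/8
  -- + 1/8 + θ₂/4 against 5 + θ₂.
  nlinarith [mul_nonneg hθ₂ p1]

/-! ### Dimension-free constants and the complexity estimate -/

theorem Cbar_le {α : ℝ} (hL : 0 < L) (hα : 0 < α) (hDt : 0 < Dt) (h : n + 4 ≤ Nbar)
    {V V₀ : ℝ} (hV : 0 ≤ V) (hV₀ : V ≤ V₀) :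
    Cbar n L α M σ Dt V Nbar ≤
      (6 * L * V₀ / α + √(M ^ 2 + σ ^ 2) / α *
        (4 * V₀ / Dt + α * Dt * (1 + √(M ^ 2 + σ ^ 2) / (L * Dt)))) * √((n + 4) / Nbar) := by
  have hN0 : (0 : ℝ) < Nbar := by exact_mod_cast (by omega : 0 < Nbar)
  have hr1 : √(((n : ℝ) + 4) / Nbar) ≤ 1 := by
    refine Real.sqrt_le_one.2 ((div_le_one hN0).2 ?_); exact_mod_cast h
  have hr0 := Real.sqrt_nonneg (((n : ℝ) + 4) / Nbar)
  have hrr : √(((n : ℝ) + 4) / Nbar) ^ 2 = (n + 4) / Nbar := Real.sq_sqrt (by positivity)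
  have er : √(((n : ℝ) + 4) / Nbar) = √((n : ℝ) + 4) / √(Nbar : ℝ) :=
    Real.sqrt_div (by positivity) _
  set r := √(((n : ℝ) + 4) / Nbar)
  set T := √(M ^ 2 + σ ^ 2) with hT
  have hT0 : 0 ≤ T := Real.sqrt_nonneg _
  have hs : 0 < √(Nbar : ℝ) := Real.sqrt_pos.2 hN0
  have eS : √((n + 4) * (M ^ 2 + σ ^ 2)) = √((n : ℝ) + 4) * T := Real.sqrt_mul (by positivity) _
  have hθ₁ : θ₁ n L M σ Dt Nbar ≤ 1 + T / (L * Dt) := by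
    refine max_le (by linarith [(by positivity : 0 ≤ T / (L * Dt))]) ?_
    calc _ = T / (L * Dt) * r := by rw [eS, er]; field_simp
      _ ≤ T / (L * Dt) * 1 := by gcongr
      _ ≤ _ := by linarith
  have hθ₀ : 0 ≤ θ₁ n L M σ Dt Nbar := zero_le_one.trans (le_max_left _ _)
  -- Dimension and budget enter through r = √((n+4)/N̄) and through θ₁, which is bounded above
  -- without reference to n. Since r ≤ 1, the faster term in r² is absorbed into the one in r.
  calc Cbar n L α M σ Dt V Nbar
      = 6 * L * V / α * r ^ 2 + T / α * (4 * V / Dt + α * Dt * θ₁ n L M σ Dt Nbar) * r := by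
        rw [Cbar, θ₂_eq_one h, eS, hrr, er]; field_simp; ring
    _ ≤ 6 * L * V₀ / α * r + T / α * (4 * V₀ / Dt + α * Dt * (1 + T / (L * Dt))) * r := by
        have : r ^ 2 ≤ r := by nlinarith
        have : 0 ≤ V₀ := hV.trans hV₀
        gcongr
    _ = _ := by ring

theorem div_iterLimit_le_mul_sqrt (hL : 0 < L) (hDt : 0 < Dt) (h : n + 4 ≤ Nbar) {W W₀ : ℝ}
    (hW : 0 ≤ W) (hW₀ : W ≤ W₀) :
    W / iterLimit n L M σ Dt Nbar ≤
      2 * W₀ * (1 + √(M ^ 2 + σ ^ 2) / (L * Dt)) * √((n + 4) / Nbar) := by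
  have hN0 : (0 : ℝ) < Nbar := by exact_mod_cast (by omega : 0 < Nbar)
  have hr1 : √(((n : ℝ) + 4) / Nbar) ≤ 1 := by
    refine Real.sqrt_le_one.2 ((div_le_one hN0).2 ?_); exact_mod_cast h
  have hr0 := Real.sqrt_nonneg (((n : ℝ) + 4) / Nbar)
  have hrr : √(((n : ℝ) + 4) / Nbar) ^ 2 = (n + 4) / Nbar := Real.sq_sqrt (by positivity)
  have er : √(((n : ℝ) + 4) / Nbar) = √((n : ℝ) + 4) / √(Nbar : ℝ) :=
    Real.sqrt_div (by positivity) _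
  have h1 := div_iterLimit_le (n := n) (M := M) (σ := σ) hL hDt (by omega : 1 ≤ Nbar) hW
  have hs : 0 < √(Nbar : ℝ) := Real.sqrt_pos.2 hN0
  have eS : √((n + 4) * (M ^ 2 + σ ^ 2)) = √((n : ℝ) + 4) * √(M ^ 2 + σ ^ 2) :=
    Real.sqrt_mul (by positivity) _
  refine h1.trans ?_
  have e1 : 2 * W * ((n : ℝ) + 4) / Nbar = 2 * W * √(((n : ℝ) + 4) / Nbar) ^ 2 := by
    rw [hrr]; ring
  have e2 : 2 * W * √((n + 4) * (M ^ 2 + σ ^ 2)) / (L * Dt * √(Nbar : ℝ)) =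
      2 * W * (√(M ^ 2 + σ ^ 2) / (L * Dt)) * √(((n : ℝ) + 4) / Nbar) := by
    rw [eS, er]; field_simp
  rw [e1, e2]
  set r := √(((n : ℝ) + 4) / Nbar)
  have h2 : r ^ 2 ≤ r := by nlinarith
  have hW₀' : 0 ≤ W₀ := hW.trans hW₀
  calc _ ≤ 2 * W₀ * r + 2 * W₀ * (√(M ^ 2 + σ ^ 2) / (L * Dt)) * r := by gcongr
    _ = _ := by ring

theorem sqrt_div_le_of_budget (hn : 1 ≤ n) {c ε : ℝ} (hc : 0 ≤ c) (hε : 0 < ε) (hε1 : ε ≤ 1)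
    (h : 5 * (c + 1) ^ 2 * n / ε ^ 2 ≤ Nbar) :
    n + 4 ≤ Nbar ∧ c * √(((n : ℝ) + 4) / Nbar) ≤ ε := by
  have hn' : (1 : ℝ) ≤ n := by exact_mod_cast hn
  -- This is the source of the factor 5 in K, and it needs n ≥ 1. Using c + 1 instead of c makes the
  -- same budget also yield N̄ ≥ n + 4, because ε ≤ 1.
  have h4 : (n : ℝ) + 4 ≤ 5 * n := by linarith
  rw [div_le_iff₀ (by positivity)] at h
  have h1 : (n : ℝ) + 4 ≤ Nbar := by
    have a1 : (1 : ℝ) ≤ (c + 1) ^ 2 := by nlinarith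
    have a2 : ε ^ 2 ≤ 1 := by nlinarith
    have a3 : 5 * 1 * (n : ℝ) ≤ 5 * (c + 1) ^ 2 * n := by gcongr
    have a4 : (Nbar : ℝ) * ε ^ 2 ≤ Nbar * 1 := by gcongr
    linarith
  have hN0 : (0 : ℝ) < Nbar := by linarith
  refine ⟨by exact_mod_cast h1, ?_⟩
  have h2 : √(((n : ℝ) + 4) / Nbar) ≤ ε / (c + 1) := by
    refine Real.sqrt_le_iff.2 ⟨by positivity, ?_⟩
    rw [div_pow, div_le_div_iff₀ hN0 (by positivity)]
    nlinarith [mul_le_mul_of_nonneg_right h4 (sq_nonneg (c + 1))]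
  calc c * √(((n : ℝ) + 4) / Nbar) ≤ c * (ε / (c + 1)) := by gcongr
    _ = c / (c + 1) * ε := by ring
    _ ≤ 1 * ε := by gcongr; rw [div_le_one (by positivity)]; linarith
    _ = ε := one_mul ε

end Parameters

/-! ### Runs with a given budget -/

section Budget

variable {n : ℕ} {Ξ : Type*} [MeasurableSpace Ξ] {Q : Problem n Ξ} {L α σ M Dt : ℝ} {x₁ : Eu n}
  {μ : ℝ} {Nbar : ℕ} {Ω : Type*} [MeasurableSpace Ω] {P : Measure Ω} {R : Ω → ℕ}
  {ξ : ℕ → ℕ → Ω → Ξ} {v : ℕ → ℕ → Ω → Eu n}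

theorem IsBudgetRun.isRun (hL : 0 < L) (hα : 0 < α)
    (h : IsBudgetRun Q L α M σ Dt Nbar x₁ μ P R ξ v) :
    IsRun Q x₁ μ (fun _ => α / (2 * L)) (fun _ => batchSize n L M σ Dt Nbar)
      (iterLimit n L M σ Dt Nbar) (fun _ => 1 / (iterLimit n L M σ Dt Nbar : ℝ)) P R ξ v := by
  have e : stopPMF α L (fun _ => α / (2 * L)) (iterLimit n L M σ Dt Nbar) =
      fun _ => 1 / (iterLimit n L M σ Dt Nbar : ℝ) := by
    ext k
    refine stopPMF_const (ne_of_gt ?_) _ k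
    have : α * (α / (2 * L)) - L * (α / (2 * L)) ^ 2 = α ^ 2 / (4 * L) := by field_simp; ring
    rw [this]; positivity
  rw [← e]
  exact h

theorem IsBudgetRun.calls_le (h : IsBudgetRun Q L α M σ Dt Nbar x₁ μ P R ξ v) :
    ∀ᵐ w ∂P, calls (fun _ => batchSize n L M σ Dt Nbar) (R w + 1) ≤ Nbar := by
  filter_upwards [h.R_mem] with w hw
  rw [Finset.mem_Icc] at hw
  simp only [calls, add_tsub_cancel_right, Finset.sum_const, Nat.card_Icc, smul_eq_mul]
  exact (Nat.mul_le_mul_right _ hw.2).trans (Nat.div_mul_le_self _ _)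

theorem Problem.Assumptions.V_nonneg (hQ : Q.Assumptions L α σ M) (hα : 0 < α) {x z : Eu n}
    (hx : x ∈ Q.X) (hz : z ∈ Q.X) : 0 ≤ Q.V x z :=
  (by positivity : (0 : ℝ) ≤ _).trans (hQ.distGen.le_prox hQ.convex_X hx hz)

theorem IsBudgetRun.nonconvex_bound [IsProbabilityMeasure P]
    (hrun : IsBudgetRun Q L α M σ Dt Nbar x₁ μ P R ξ v) (hQ : Q.Assumptions L α σ M)
    (hL : 0 < L) (hα : 0 < α) (hσ : 0 < σ) (hDt : 0 < Dt) (hx₁ : x₁ ∈ Q.X) (hN : 1 ≤ Nbar)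
    (hμ : 0 < μ) (hμD : μ ≤ Q.DPsi L x₁ / √((n + 4) * (Nbar : ℝ))) :
    Integrable (fun w => ‖Q.gX (α / (2 * L))
      (budgetIter Q L α M σ Dt Nbar x₁ μ ξ v (R w) w)‖ ^ 2) P ∧
    α ^ 2 / L * ∫ w, ‖Q.gX (α / (2 * L))
      (budgetIter Q L α M σ Dt Nbar x₁ μ ξ v (R w) w)‖ ^ 2 ∂P ≤
      Bbar n L M σ Dt (Q.DPsi L x₁) Nbar := by
  have hN0 : (0 : ℝ) < Nbar := by exact_mod_cast hN
  obtain ⟨h1, h2⟩ := (hrun.isRun hL hα).integral_gX_randomIndex_le hQ hL hα hx₁ hμ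
    (batchSize_pos hN) (iterLimit_pos hN)
  refine ⟨h1, h2.trans ?_⟩
  have hD : L * Q.DPsi L x₁ ^ 2 = Q.Psi x₁ - Q.PsiStar := by
    have := sub_nonneg.2 (hQ.PsiStar_le hx₁)
    rw [Problem.DPsi, Real.sq_sqrt (by positivity)]
    field_simp
  rw [← hD]
  refine le_Bbar hL hσ hDt hN ?_
  rw [le_div_iff₀ (Real.sqrt_pos.2 (by positivity))] at hμD
  have h3 := pow_le_pow_left₀ (by positivity) hμD 2
  rwa [mul_pow, Real.sq_sqrt (by positivity)] at h3

theorem IsBudgetRun.convex_bound [IsProbabilityMeasure P]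
    (hrun : IsBudgetRun Q L α M σ Dt Nbar x₁ μ P R ξ v) (hQ : Q.Assumptions L α σ M)
    (hL : 0 < L) (hα : 0 < α) (hσ : 0 < σ) (hDt : 0 < Dt) (hx₁ : x₁ ∈ Q.X) (hN : 1 ≤ Nbar)
    (hμ : 0 < μ) (hf : ConvexOn ℝ Set.univ Q.f) {xs : Eu n} (hxs : Q.IsOptimal xs)
    (hμV : μ ≤ √(Q.V xs x₁ / (α * (n + 4) * Nbar))) :
    Integrable (fun w => Q.Psi
      (budgetIter Q L α M σ Dt Nbar x₁ μ ξ v (R w + 1) w) - Q.Psi xs) P ∧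
    ∫ w, (Q.Psi (budgetIter Q L α M σ Dt Nbar x₁ μ ξ v (R w + 1) w) - Q.Psi xs) ∂P
      ≤ Cbar n L α M σ Dt (Q.V xs x₁) Nbar ∧
    Integrable (fun w => Q.Psi
      (budgetIter Q L α M σ Dt Nbar x₁ μ ξ v (R w) w) - Q.Psi xs) P ∧
    ∫ w, (Q.Psi (budgetIter Q L α M σ Dt Nbar x₁ μ ξ v (R w) w) - Q.Psi xs) ∂P
      ≤ Cbar n L α M σ Dt (Q.V xs x₁) Nbar +
        (Q.Psi x₁ - Q.Psi xs) / (iterLimit n L M σ Dt Nbar : ℝ) := by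
  have hN0 : (0 : ℝ) < Nbar := by exact_mod_cast hN
  obtain ⟨h1, h2, h3, h4⟩ := (hrun.isRun hL hα).integral_Psi_randomIndex_le hQ hL hα hx₁ hμ
    (batchSize_pos hN) (iterLimit_pos hN) hf hxs
  have hV := hQ.V_nonneg hα hxs.1 hx₁
  have h5 : μ ^ 2 * ((n + 4) * Nbar) ≤ Q.V xs x₁ / α := by
    have := (Real.le_sqrt hμ.le (by positivity)).1 hμV
    rw [le_div_iff₀ (by positivity)] at this
    rw [le_div_iff₀ hα]
    linarith
  have h6 := le_Cbar (n := n) (M := M) hL hα hσ hDt hN hV h5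
  exact ⟨h1, h2.trans h6, h3, h4.trans (add_le_add_left h6 _)⟩

/-- In dimension 0 the condition N̄ ≥ Kn/ε² would say nothing. That case cannot occur: there x* =
x₁, so V = 0 and no positive μ is admissible. -/
theorem one_le_of_smoothing_le (hμ : 0 < μ) {xs : Eu n}
    (hμV : μ ≤ √(Q.V xs x₁ / (α * (n + 4) * Nbar))) : 1 ≤ n := by
  by_contra h
  obtain rfl : n = 0 := by omega
  obtain rfl : xs = x₁ := Subsingleton.elim _ _
  have : Q.V xs xs = 0 := by simp [Problem.V, prox]
  rw [this] at hμV
  simp at hμV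
  linarith

end Budget

end RSPGF

/-! ### Assembly of the error bounds and the complexity estimates -/

theorem mainTheorem5 (L α M σ Dt : ℝ) (hL : 0 < L) (hα : 0 < α) (hσ : 0 < σ) (hDt : 0 < Dt) :
    -- the error bounds
    (∀ (n : ℕ) (Ξ : Type*) (_ : MeasurableSpace Ξ) (Q : RSPGF.Problem n Ξ),
      Q.Assumptions L α σ M →
      ∀ x₁ ∈ Q.X, ∀ Nbar : ℕ, 1 ≤ Nbar → ∀ μ : ℝ, 0 < μ →
      ∀ (Ω : Type*) (_ : MeasurableSpace Ω) (P : Measure Ω) (_ : IsProbabilityMeasure P)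
        (R : Ω → ℕ) (ξ : ℕ → ℕ → Ω → Ξ) (v : ℕ → ℕ → Ω → RSPGF.Eu n),
      RSPGF.IsBudgetRun Q L α M σ Dt Nbar x₁ μ P R ξ v →
      -- general, possibly nonconvex `f`
      (μ ≤ Q.DPsi L x₁ / √((n + 4) * (Nbar : ℝ)) →
        Integrable (fun w => ‖Q.gX (α / (2 * L))
          (RSPGF.budgetIter Q L α M σ Dt Nbar x₁ μ ξ v (R w) w)‖ ^ 2) P ∧
        α ^ 2 / L * ∫ w, ‖Q.gX (α / (2 * L))
            (RSPGF.budgetIter Q L α M σ Dt Nbar x₁ μ ξ v (R w) w)‖ ^ 2 ∂P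
          ≤ RSPGF.Bbar n L M σ Dt (Q.DPsi L x₁) Nbar ∧
        (n + 4 ≤ Nbar →
          α ^ 2 / L * ∫ w, ‖Q.gX (α / (2 * L))
              (RSPGF.budgetIter Q L α M σ Dt Nbar x₁ μ ξ v (R w) w)‖ ^ 2 ∂P
            ≤ 65 * (L * Q.DPsi L x₁ ^ 2 * (n + 4) / Nbar +
                √((n + 4) * (M ^ 2 + σ ^ 2) / Nbar) *
                  (Q.DPsi L x₁ ^ 2 / Dt + Dt * RSPGF.θ₁ n L M σ Dt Nbar)))) ∧
      -- convex `f`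
      (ConvexOn ℝ Set.univ Q.f → ∀ xs, Q.IsOptimal xs →
        μ ≤ √(Q.V xs x₁ / (α * (n + 4) * Nbar)) →
        Integrable (fun w => Q.Psi
          (RSPGF.budgetIter Q L α M σ Dt Nbar x₁ μ ξ v (R w + 1) w) - Q.Psi xs) P ∧
        ∫ w, (Q.Psi (RSPGF.budgetIter Q L α M σ Dt Nbar x₁ μ ξ v (R w + 1) w) - Q.Psi xs) ∂P
          ≤ RSPGF.Cbar n L α M σ Dt (Q.V xs x₁) Nbar ∧
        Integrable (fun w => Q.Psi
          (RSPGF.budgetIter Q L α M σ Dt Nbar x₁ μ ξ v (R w) w) - Q.Psi xs) P ∧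
        ∫ w, (Q.Psi (RSPGF.budgetIter Q L α M σ Dt Nbar x₁ μ ξ v (R w) w) - Q.Psi xs) ∂P
          ≤ RSPGF.Cbar n L α M σ Dt (Q.V xs x₁) Nbar +
            (Q.Psi x₁ - Q.Psi xs) / (RSPGF.iterLimit n L M σ Dt Nbar : ℝ)) ∧
      -- the budget is respected
      (∀ᵐ w ∂P, RSPGF.calls (fun _ => RSPGF.batchSize n L M σ Dt Nbar) (R w + 1) ≤ Nbar)) ∧
    -- the `O(n / ε²)` complexity for convex `f`
    (∀ V₀ : ℝ, ∃ K : ℝ, 0 < K ∧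
      ∀ (n : ℕ) (Ξ : Type*) (_ : MeasurableSpace Ξ) (Q : RSPGF.Problem n Ξ),
      Q.Assumptions L α σ M → ConvexOn ℝ Set.univ Q.f →
      ∀ xs, Q.IsOptimal xs → ∀ x₁ ∈ Q.X, Q.V xs x₁ ≤ V₀ →
      ∀ ε : ℝ, 0 < ε → ε ≤ 1 → ∀ Nbar : ℕ, 1 ≤ Nbar → K * n / ε ^ 2 ≤ Nbar →
      ∀ μ : ℝ, 0 < μ → μ ≤ √(Q.V xs x₁ / (α * (n + 4) * Nbar)) →
      ∀ (Ω : Type*) (_ : MeasurableSpace Ω) (P : Measure Ω) (_ : IsProbabilityMeasure P)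
        (R : Ω → ℕ) (ξ : ℕ → ℕ → Ω → Ξ) (v : ℕ → ℕ → Ω → RSPGF.Eu n),
      RSPGF.IsBudgetRun Q L α M σ Dt Nbar x₁ μ P R ξ v →
      ∫ w, (Q.Psi (RSPGF.budgetIter Q L α M σ Dt Nbar x₁ μ ξ v (R w + 1) w) - Q.Psi xs) ∂P
        ≤ ε) ∧
    (∀ V₀ Δ₀ : ℝ, ∃ K : ℝ, 0 < K ∧
      ∀ (n : ℕ) (Ξ : Type*) (_ : MeasurableSpace Ξ) (Q : RSPGF.Problem n Ξ),
      Q.Assumptions L α σ M → ConvexOn ℝ Set.univ Q.f →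
      ∀ xs, Q.IsOptimal xs → ∀ x₁ ∈ Q.X, Q.V xs x₁ ≤ V₀ → Q.Psi x₁ - Q.Psi xs ≤ Δ₀ →
      ∀ ε : ℝ, 0 < ε → ε ≤ 1 → ∀ Nbar : ℕ, 1 ≤ Nbar → K * n / ε ^ 2 ≤ Nbar →
      ∀ μ : ℝ, 0 < μ → μ ≤ √(Q.V xs x₁ / (α * (n + 4) * Nbar)) →
      ∀ (Ω : Type*) (_ : MeasurableSpace Ω) (P : Measure Ω) (_ : IsProbabilityMeasure P)
        (R : Ω → ℕ) (ξ : ℕ → ℕ → Ω → Ξ) (v : ℕ → ℕ → Ω → RSPGF.Eu n),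
      RSPGF.IsBudgetRun Q L α M σ Dt Nbar x₁ μ P R ξ v →
      ∫ w, (Q.Psi (RSPGF.budgetIter Q L α M σ Dt Nbar x₁ μ ξ v (R w) w) - Q.Psi xs) ∂P
        ≤ ε) := by
  refine ⟨?_, fun V₀ => ?_, fun V₀ Δ₀ => ?_⟩
  · intro n Ξ _ Q hQ x₁ hx₁ Nbar hN μ hμ Ω _ P _ R ξ v hrun
    refine ⟨fun hμD => ?_, fun hf xs hxs hμV => ?_, hrun.calls_le⟩
    · obtain ⟨h1, h2⟩ := hrun.nonconvex_bound hQ hL hα hσ hDt hx₁ hN hμ hμD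
      exact ⟨h1, h2, fun h => h2.trans (RSPGF.Bbar_le hσ hDt h _)⟩
    · exact hrun.convex_bound hQ hL hα hσ hDt hx₁ hN hμ hf hxs hμV
  -- Absolute values are used because `V₀` is an arbitrary real, while K must be chosen before any
  -- problem is known.
  · set c := 6 * L * |V₀| / α + √(M ^ 2 + σ ^ 2) / α *
      (4 * |V₀| / Dt + α * Dt * (1 + √(M ^ 2 + σ ^ 2) / (L * Dt)))
    have hc : 0 ≤ c := by positivity
    refine ⟨5 * (c + 1) ^ 2, by positivity, ?_⟩
    intro n Ξ _ Q hQ hf xs hxs x₁ hx₁ hV ε hε hε1 Nbar hN hK μ hμ hμV Ω _ P _ R ξ v hrun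
    have hn := RSPGF.one_le_of_smoothing_le hμ hμV
    obtain ⟨h1, h2⟩ := RSPGF.sqrt_div_le_of_budget hn hc hε hε1 hK
    obtain ⟨-, h3, -, -⟩ := hrun.convex_bound hQ hL hα hσ hDt hx₁ hN hμ hf hxs hμV
    exact h3.trans ((RSPGF.Cbar_le hL hα hDt h1 (hQ.V_nonneg hα hxs.1 hx₁)
      (hV.trans (le_abs_self _))).trans h2)
  · set c₁ := 6 * L * |V₀| / α + √(M ^ 2 + σ ^ 2) / α *
      (4 * |V₀| / Dt + α * Dt * (1 + √(M ^ 2 + σ ^ 2) / (L * Dt)))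
    -- `c₂` accounts for the extra initial gap divided by N, which decays at the same rate
    -- √((n+4)/N̄).
    set c₂ := 2 * |Δ₀| * (1 + √(M ^ 2 + σ ^ 2) / (L * Dt))
    have hc : 0 ≤ c₁ + c₂ := by positivity
    refine ⟨5 * (c₁ + c₂ + 1) ^ 2, by positivity, ?_⟩
    intro n Ξ _ Q hQ hf xs hxs x₁ hx₁ hV hΔ ε hε hε1 Nbar hN hK μ hμ hμV Ω _ P _ R ξ v hrun
    have hn := RSPGF.one_le_of_smoothing_le hμ hμV
    obtain ⟨h1, h2⟩ := RSPGF.sqrt_div_le_of_budget hn hc hε hε1 hK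
    obtain ⟨-, -, -, h3⟩ := hrun.convex_bound hQ hL hα hσ hDt hx₁ hN hμ hf hxs hμV
    have h4 := RSPGF.Cbar_le (M := M) (σ := σ) hL hα hDt h1 (hQ.V_nonneg hα hxs.1 hx₁)
      (hV.trans (le_abs_self _))
    have h5 := RSPGF.div_iterLimit_le_mul_sqrt (M := M) (σ := σ) hL hDt h1
      (sub_nonneg.2 (hxs.2 hx₁)) (hΔ.trans (le_abs_self _))
    rw [add_mul] at h2
    exact h3.trans ((add_le_add h4 h5).trans h2)
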